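/- **Setting.** Let $b$ be a prime, $s,t,m\in\mathbb N$ (positive integers), $N=b^m$, $\alpha,\beta>1$, and let $\gamma^{(i)}=(\gamma^{(i)}_j)_{j\ge1}$, $i=1,2$, be non-increasing sequences with $0<\gamma^{(i)}_j\le 1$. *Basis functions.* For $k\in\mathbb N_0$ with $b$-adic expansion $k=\kappa_0+\kappa_1b+\dots+\kappa_ab^a$ and $x\in[0,1)$ with $b$-adic expansion $x=\xi_1b^{-1}+\xi_2b^{-2}+\cdots$ (infinitely many $\xi_i\ne b-1$), let $\mathrm{wal}_k(x)=\exp(2\pi \mathtt i(\xi_1\kappa_0+\dots+\xi_{a+1}\kappa_a)/b)$. For $\boldsymbol k\in\mathbb N_0^s$, $\boldsymbol l\in\mathbb Z^t$ let $\mathrm{wal}_{\boldsymbol k}(\boldsymbol x)=\prod_{j=1}^s\mathrm{wal}_{k_j}(x_j)$ and $\mathrm e_{\boldsymbol l}(\boldsymbol y)=\exp(2\pi \mathtt i\,\boldsymbol l\cdot\boldsymbol y)$. *Function space.* Let $\rho(\boldsymbol k)=\prod_{j=1}^s\rho_j(k_j)$ with $\rho_j(0)=1$ and $\rho_j(k)=\gamma_j^{(1)}b^{-\alpha\lfloor\log_bk\rfloor}$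 for $k\ne0$, and $r(\boldsymbol l)=\prod_{j=1}^tr_j(l_j)$ with $r_j(0)=1$ and $r_j(l)=\gamma_j^{(2)}|l|^{-\beta}$ for $l\neq0$. Let $\widehat f(\boldsymbol k,\boldsymbol l)=\int_{[0,1]^{s+t}}f(\boldsymbol x,\boldsymbol y)\overline{\mathrm{wal}_{\boldsymbol k}(\boldsymbol x)\mathrm e_{\boldsymbol l}(\boldsymbol y)}\,d\boldsymbol x\,d\boldsymbol y$. The hybrid space $\mathcal H_{s,t}$ consists of all $f:[0,1)^{s+t}\to\mathbb C$ that are everywhere the sum of their absolutely convergent series $\sum_{\boldsymbol k,\boldsymbol l}\widehat f(\boldsymbol k,\boldsymbol l)\,\mathrm{wal}_{\boldsymbol k}(\boldsymbol x)\,\mathrm e_{\boldsymbol l}(\boldsymbol y)$ and satisfy $\|f\|^2:=\sum_{\boldsymbol k\in\mathbb N_0^s}\sum_{\boldsymbol l\in\mathbb Z^t}|\widehat f(\boldsymbol k,\boldsymbol l)|^2/(\rho(\boldsymbol k)r(\boldsymbol l))<\infty$. (For the construction below, $\mathcal H_{d_1,d_2}$ is defined in the same way for all dimensions $d_1,d_2\ge0$,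 with the first $d_1$, respectively $d_2$, weights.) *Point set.* Let $f\in\mathbb F_b[x]$ be irreducible with $\deg f=m$. For $0\le v<N$ with base-$b$ digits $v_0,\dots,v_{m-1}$ let $v(x)=\sum_{i<m}v_ix^i\in\mathbb F_b[x]$. For $\boldsymbol g=(g_1,\dots,g_s)\in\mathbb F_b[x]^s$ and $\boldsymbol z=(z_1,\dots,z_t)$ put $\boldsymbol p_v=\big(\nu_m(v(x)g_j(x)/f(x))\big)_{j\le s}$, where $\nu_m(\sum_{i}t_ix^{-i})=\sum_{i=1}^m t_ib^{-i}$ on $\mathbb F_b((x^{-1}))$, and $\boldsymbol q_v=(\{vz_j/N\})_{j\le t}$. The hybrid point set consists of $(\boldsymbol p_v,\boldsymbol q_v)$, $0\le v<N$. The vectors $\boldsymbol g,\boldsymbol z$ are constructed component by component (algorithm of Kritzer and Pillichshammer): start with $g_1=1$; in each further step either append to $(g_1,\dots,g_{d_1})$ a component $g_{d_1+1}\ne0$ with $\deg g_{d_1+1}<m$, or append to $(z_1,\dots,z_{d_2})$ a component $z_{d_2+1}\in\{1,\dots,N-1\}$ with $\gcd(z_{d_2+1},N)=1$, so that the new component minimises,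 among all such candidates, the worst-case error of the quasi-Monte Carlo rule with the resulting point set for integration over the unit ball of the hybrid space of the dimension reached. The order in which the two vectors are extended is arbitrary. *Algorithm.* For real $M$ let $\mathcal A_M=\{(\boldsymbol k,\boldsymbol l)\in\mathbb N_0^s\times\mathbb Z^t:\rho(\boldsymbol k)^{-1}r(\boldsymbol l)^{-1}\le M\}$ (a finite set) and, for $h\in\mathcal H_{s,t}$, $$A_{N,s,t,M}(h)(\boldsymbol x,\boldsymbol y)=\sum_{(\boldsymbol k,\boldsymbol l)\in\mathcal A_M}\Big(\frac1N\sum_{v=0}^{N-1}h(\boldsymbol p_v,\boldsymbol q_v)\overline{\mathrm{wal}_{\boldsymbol k}(\boldsymbol p_v)\mathrm e_{\boldsymbol l}(\boldsymbol q_v)}\Big)\mathrm{wal}_{\boldsymbol k}(\boldsymbol x)\,\mathrm e_{\boldsymbol l}(\boldsymbol y).$$ Its worst-case error is $e^{\mathbb L_2\text{-app}}(A_{N,s,t,M})=\sup_{h\in\mathcal H_{s,t},\,\|h\|\le1}\|h-A_{N,s,t,M}(h)\|_{\mathbb L_2([0,1]^{s+t})}$. **Proposition 1.** Let $\kappa>1/\theta$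 with $\theta=\min(\alpha,\beta)$, and let $$c=2\prod_{j=1}^s\big(1+2\gamma^{(1)}_j\mu(\alpha)\big)\prod_{j=1}^t\big(1+4\gamma^{(2)}_j\zeta(\beta)\big)\prod_{j=1}^t\max(1,2^\beta\gamma_j^{(2)})\prod_{j=1}^s\big(1+2\zeta(\theta\kappa)(b^\alpha\gamma_j^{(1)})^\kappa\big)\prod_{j=1}^t\big(1+2\zeta(\theta\kappa)(\gamma_j^{(2)})^\kappa\big),$$ where $\mu(x)=\frac{b^x(b-1)}{b^x-b}$ and $\zeta$ is the Riemann zeta function. Then, for the hybrid point set with $N=b^m$ points given by any $\boldsymbol g,\boldsymbol z$ so constructed and for $M=(N/c)^{1/(2+\kappa)}$, $$e^{\mathbb L_2\text{-app}}(A_{N,s,t,M})\le\sqrt2\,\Big(\frac cN\Big)^{1/(4+2\kappa)}.$$ -/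

import Mathlib

open scoped ENNReal Polynomial

noncomputable section

namespace HybridSpace

/-- The points `(x, y)` with `x` having `s` and `y` having `t` coordinates. -/
abbrev Pt (s t : ℕ) : Type := (Fin s → ℝ) × (Fin t → ℝ)

/-- The frequencies `(k, l) ∈ ℕ₀ˢ × ℤᵗ`. -/
abbrev Freq (s t : ℕ) : Type := (Fin s → ℕ) × (Fin t → ℤ)

/-- The half-open unit cube `[0,1)^(s+t)`. -/
def cube (s t : ℕ) : Set (Pt s t) :=
  {p | (∀ j, p.1 j ∈ Set.Ico (0 : ℝ) 1) ∧ ∀ j, p.2 j ∈ Set.Ico (0 : ℝ) 1}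

/-- Lebesgue measure on the unit cube. -/
def cubeMeasure (s t : ℕ) : MeasureTheory.Measure (Pt s t) :=
  MeasureTheory.volume.restrict (cube s t)

/-! ### Walsh and trigonometric functions -/

/-- The digit `ξ_i` (`i ≥ 1`) in the `b`-adic expansion `x = ∑ ξ_i b^(-i)` of `x ∈ [0,1)`, the
expansion having infinitely many digits different from `b - 1`. -/
def realDigit (b : ℕ) (x : ℝ) (i : ℕ) : ℕ := ⌊x * (b : ℝ) ^ i⌋₊ % b

/-- The coefficient `κ_i` of `b^i` in the `b`-adic expansion of `k`. -/
def natDigit (b k i : ℕ) : ℕ := k / b ^ i % b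

/-- The one-dimensional `k`-th Walsh function in base `b`. -/
def wal (b k : ℕ) (x : ℝ) : ℂ :=
  Complex.exp (2 * Real.pi * Complex.I *
    ((∑ i ∈ Finset.range (Nat.log b k + 1), realDigit b x (i + 1) * natDigit b k i : ℕ) : ℂ) / b)

/-- The `k`-th `s`-variate Walsh function. -/
def walVec (b : ℕ) {s : ℕ} (k : Fin s → ℕ) (x : Fin s → ℝ) : ℂ := ∏ j, wal b (k j) (x j)

/-- The `l`-th `t`-variate trigonometric function `exp(2πi l·y)`. -/
def trigVec {t : ℕ} (l : Fin t → ℤ) (y : Fin t → ℝ) : ℂ :=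
  Complex.exp (2 * Real.pi * Complex.I * ((∑ j, (l j : ℝ) * y j : ℝ) : ℂ))

/-- The product basis function `wal_k(x) e_l(y)`. -/
def basisFun (b : ℕ) {s t : ℕ} (kl : Freq s t) (p : Pt s t) : ℂ :=
  walVec b kl.1 p.1 * trigVec kl.2 p.2

/-! ### Weights; `γ j` stands for the weight of the coordinate with number `j + 1` -/

/-- `ρ_{α,γ}(k)`; here `Nat.log b k = ⌊log_b k⌋`. -/
def rho (b : ℕ) (α γ : ℝ) (k : ℕ) : ℝ :=
  if k = 0 then 1 else γ * (b : ℝ) ^ (-(α * (Nat.log b k : ℝ)))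

/-- `r_{β,γ}(l)`. -/
def r (β γ : ℝ) (l : ℤ) : ℝ := if l = 0 then 1 else γ * |(l : ℝ)| ^ (-β)

/-- The product `ρ_{α,γ₁}(k) r_{β,γ₂}(l)`. -/
def weight (b : ℕ) (α β : ℝ) (γ₁ γ₂ : ℕ → ℝ) {s t : ℕ} (kl : Freq s t) : ℝ :=
  (∏ j : Fin s, rho b α (γ₁ j) (kl.1 j)) * ∏ j : Fin t, r β (γ₂ j) (kl.2 j)

/-! ### The hybrid function space

A function on the cube is represented by a function on `Pt s t`; its values outside the cube
play no role. -/

/-- The Walsh-Fourier coefficient `f̂(k, l)`. -/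
def coeff (b : ℕ) {s t : ℕ} (f : Pt s t → ℂ) (kl : Freq s t) : ℂ :=
  ∫ p, f p * (starRingEnd ℂ) (basisFun b kl p) ∂(cubeMeasure s t)

/-- Membership in the hybrid space: `f` is on the whole cube the sum of its absolutely convergent
Walsh-Fourier series, and its norm is finite. -/
structure MemH (b : ℕ) (α β : ℝ) (γ₁ γ₂ : ℕ → ℝ) {s t : ℕ} (f : Pt s t → ℂ) : Prop where
  summable_coeff : Summable fun kl : Freq s t => ‖coeff b f kl‖
  eq_series : ∀ p ∈ cube s t, f p = ∑' kl : Freq s t, coeff b f kl * basisFun b kl p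
  summable_norm : Summable fun kl : Freq s t => ‖coeff b f kl‖ ^ 2 / weight b α β γ₁ γ₂ kl

/-- The norm of the hybrid space. -/
def normH (b : ℕ) (α β : ℝ) (γ₁ γ₂ : ℕ → ℝ) {s t : ℕ} (f : Pt s t → ℂ) : ℝ :=
  Real.sqrt (∑' kl : Freq s t, ‖coeff b f kl‖ ^ 2 / weight b α β γ₁ γ₂ kl)

/-- The worst-case error in the hybrid space of an approximation operator `A`, measured in
`L₂([0,1]^(s+t))`. -/
def appError (b : ℕ) (α β : ℝ) (γ₁ γ₂ : ℕ → ℝ) {s t : ℕ}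
    (A : (Pt s t → ℂ) → (Pt s t → ℂ)) : ℝ≥0∞ :=
  ⨆ (f : Pt s t → ℂ) (_ : MemH b α β γ₁ γ₂ f) (_ : normH b α β γ₁ γ₂ f ≤ 1),
    MeasureTheory.eLpNorm (fun p => f p - A f p) 2 (cubeMeasure s t)

/-- The worst-case error in the hybrid space of the quasi-Monte Carlo integration rule with nodes
`pts 0, …, pts (N - 1)`. -/
def intError (b : ℕ) (α β : ℝ) (γ₁ γ₂ : ℕ → ℝ) {s t : ℕ} (N : ℕ) (pts : ℕ → Pt s t) : ℝ≥0∞ :=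
  ⨆ (f : Pt s t → ℂ) (_ : MemH b α β γ₁ γ₂ f) (_ : normH b α β γ₁ γ₂ f ≤ 1),
    ‖(∫ p, f p ∂(cubeMeasure s t)) - (1 / (N : ℂ)) * ∑ v ∈ Finset.range N, f (pts v)‖ₑ

/-! ### The hybrid point set -/

/-- The embedding of `𝔽_b[x]` into `𝔽_b((x⁻¹))`; the latter is the field of Laurent series in the
variable `x⁻¹`, so that `coeff i` is the coefficient of `x^(-i)`. -/
def polyToLaurent (b : ℕ) [Fact b.Prime] (p : (ZMod b)[X]) : LaurentSeries (ZMod b) :=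
  Polynomial.aeval (HahnSeries.single (-1 : ℤ) (1 : ZMod b) : LaurentSeries (ZMod b)) p

/-- The map `ν_m : 𝔽_b((x⁻¹)) → [0,1)`. -/
def nu (b : ℕ) (m : ℕ) [Fact b.Prime] (L : LaurentSeries (ZMod b)) : ℝ :=
  ∑ i ∈ Finset.Icc 1 m, ((HahnSeries.coeff L (i : ℤ)).val : ℝ) / (b : ℝ) ^ i

/-- The polynomial over `𝔽_b` of degree less than `m` associated with the integer `v < b^m`. -/
def polyOfNat (b m v : ℕ) : (ZMod b)[X] :=
  ∑ i ∈ Finset.range m, Polynomial.C ((natDigit b v i : ℕ) : ZMod b) * Polynomial.X ^ i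

/-- The `v`-th point of the polynomial lattice point set with modulus `f` and generating vector
`(g 0, …, g (s - 1))`. -/
def polyLatticePt (b m : ℕ) [Fact b.Prime] (f : (ZMod b)[X]) (g : ℕ → (ZMod b)[X]) (s v : ℕ) :
    Fin s → ℝ :=
  fun j => nu b m (polyToLaurent b (polyOfNat b m v * g j) / polyToLaurent b f)

/-- The `v`-th point of the `N`-point lattice point set with generating vector
`(z 0, …, z (t - 1))`. -/
def latticePt (N : ℕ) (z : ℕ → ℕ) (t v : ℕ) : Fin t → ℝ :=
  fun j => Int.fract ((v : ℝ) * (z j : ℝ) / (N : ℝ))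

/-- The `v`-th point `(p_v, q_v)` of the hybrid point set with `b^m` points. -/
def hybridPt (b m : ℕ) [Fact b.Prime] (f : (ZMod b)[X]) (g : ℕ → (ZMod b)[X]) (z : ℕ → ℕ)
    (s t v : ℕ) : Pt s t :=
  (polyLatticePt b m f g s v, latticePt (b ^ m) z t v)

/-- Candidates for components of `g`: the nonzero polynomials of degree less than `m`. -/
def polyCandidates (b m : ℕ) : Set (ZMod b)[X] := {h | h ≠ 0 ∧ h.degree < m}

/-- Candidates for components of `z`: the integers in `{1, …, N - 1}` that are prime to `N`. -/
def intCandidates (N : ℕ) : Set ℕ := {w | 1 ≤ w ∧ w ≤ N - 1 ∧ Nat.gcd w N = 1}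

/-- `IsCBC b m α β γ₁ γ₂ f g z d₁ d₂`: the vectors `(g 0, …, g (d₁ - 1))` and
`(z 0, …, z (d₂ - 1))` arise from the component-by-component algorithm. It starts with the first
component of `g` equal to `1`; every further step appends one component to `g` or one to `z`, which
minimises, over all candidates, the worst-case integration error in the hybrid space of the
dimension reached. The order in which the two vectors are extended is left free. -/
inductive IsCBC (b m : ℕ) [Fact b.Prime] (α β : ℝ) (γ₁ γ₂ : ℕ → ℝ) (f : (ZMod b)[X])
    (g : ℕ → (ZMod b)[X]) (z : ℕ → ℕ) : ℕ → ℕ → Prop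
  | start : g 0 = 1 → IsCBC b m α β γ₁ γ₂ f g z 1 0
  | stepPoly (d₁ d₂ : ℕ) : IsCBC b m α β γ₁ γ₂ f g z d₁ d₂ → g d₁ ∈ polyCandidates b m →
      (∀ h ∈ polyCandidates b m,
        intError b α β γ₁ γ₂ (b ^ m) (hybridPt b m f g z (d₁ + 1) d₂) ≤
          intError b α β γ₁ γ₂ (b ^ m)
            (hybridPt b m f (Function.update g d₁ h) z (d₁ + 1) d₂)) →
      IsCBC b m α β γ₁ γ₂ f g z (d₁ + 1) d₂
  | stepInt (d₁ d₂ : ℕ) : IsCBC b m α β γ₁ γ₂ f g z d₁ d₂ → z d₂ ∈ intCandidates (b ^ m) →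
      (∀ w ∈ intCandidates (b ^ m),
        intError b α β γ₁ γ₂ (b ^ m) (hybridPt b m f g z d₁ (d₂ + 1)) ≤
          intError b α β γ₁ γ₂ (b ^ m)
            (hybridPt b m f g (Function.update z d₂ w) d₁ (d₂ + 1))) →
      IsCBC b m α β γ₁ γ₂ f g z d₁ (d₂ + 1)

/-! ### The approximation algorithm -/

/-- The index set `𝒜_M`. -/
def indexSet (b : ℕ) (α β : ℝ) (γ₁ γ₂ : ℕ → ℝ) (s t : ℕ) (M : ℝ) : Set (Freq s t) :=
  {kl | (weight b α β γ₁ γ₂ kl)⁻¹ ≤ M}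

/-- The algorithm `A_{N,s,t,M}` with nodes `pts 0, …, pts (N - 1)`; the outer sum is finite by
`indexSet_finite` below. -/
def algorithm (b : ℕ) (α β : ℝ) (γ₁ γ₂ : ℕ → ℝ) {s t : ℕ} (N : ℕ) (M : ℝ) (pts : ℕ → Pt s t)
    (f : Pt s t → ℂ) : Pt s t → ℂ :=
  fun p => ∑ᶠ kl ∈ indexSet b α β γ₁ γ₂ s t M,
    ((1 / (N : ℂ)) * ∑ v ∈ Finset.range N, f (pts v) * (starRingEnd ℂ) (basisFun b kl (pts v))) *
      basisFun b kl p

/-! ### The constant -/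

/-- `μ(x) = b^x (b - 1) / (b^x - b)`. -/
def mu (b : ℕ) (x : ℝ) : ℝ := (b : ℝ) ^ x * ((b : ℝ) - 1) / ((b : ℝ) ^ x - (b : ℝ))

/-- The Riemann zeta function at a real argument. -/
def zeta (x : ℝ) : ℝ := (riemannZeta (x : ℂ)).re

/-- The constant `c_{s,t,α,β,γ,κ}`. -/
def const (b : ℕ) (α β : ℝ) (γ₁ γ₂ : ℕ → ℝ) (s t : ℕ) (κ : ℝ) : ℝ :=
  2 * (∏ j ∈ Finset.range s, (1 + γ₁ j * (2 * mu b α))) *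
    (∏ j ∈ Finset.range t, (1 + γ₂ j * (4 * zeta β))) *
    (∏ j ∈ Finset.range t, max 1 ((2 : ℝ) ^ β * γ₂ j)) *
    (∏ j ∈ Finset.range s, (1 + 2 * zeta (min α β * κ) * ((b : ℝ) ^ α * γ₁ j) ^ κ)) *
    ∏ j ∈ Finset.range t, (1 + 2 * zeta (min α β * κ) * (γ₂ j) ^ κ)

/-! ### Finiteness of the index set -/

theorem rho_pos {b : ℕ} (hb : 1 < b) {α γ : ℝ} (h0 : 0 < γ) (k : ℕ) : 0 < rho b α γ k := by
  unfold rho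
  have : (0 : ℝ) < b := by exact_mod_cast (by omega : 0 < b)
  split_ifs <;> positivity

theorem rho_le_one {b : ℕ} (hb : 1 < b) {α γ : ℝ} (hα : 1 < α) (h1 : γ ≤ 1) (k : ℕ) :
    rho b α γ k ≤ 1 := by
  unfold rho
  have hb' : (1 : ℝ) ≤ b := by exact_mod_cast hb.le
  split_ifs
  · exact le_rfl
  · have : (b : ℝ) ^ (-(α * (Nat.log b k : ℝ))) ≤ 1 :=
      Real.rpow_le_one_of_one_le_of_nonpos hb' (by
        have : 0 ≤ α * (Nat.log b k : ℝ) := by positivity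
        linarith)
    have h' : 0 ≤ (b : ℝ) ^ (-(α * (Nat.log b k : ℝ))) := by positivity
    nlinarith

theorem r_pos {β γ : ℝ} (h0 : 0 < γ) (l : ℤ) : 0 < r β γ l := by
  unfold r
  split_ifs with h
  · exact one_pos
  · have : 0 < |(l : ℝ)| := abs_pos.mpr (by exact_mod_cast h)
    positivity

theorem r_le_one {β γ : ℝ} (hβ : 1 < β) (h1 : γ ≤ 1) (l : ℤ) : r β γ l ≤ 1 := by
  unfold r
  split_ifs with h
  · exact le_rfl
  · have h2 : (1 : ℝ) ≤ |(l : ℝ)| := by exact_mod_cast Int.one_le_abs h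
    have : |(l : ℝ)| ^ (-β) ≤ 1 := Real.rpow_le_one_of_one_le_of_nonpos h2 (by linarith)
    have h' : 0 ≤ |(l : ℝ)| ^ (-β) := by positivity
    nlinarith

theorem rho_finite {b : ℕ} (hb : 1 < b) {α γ : ℝ} (hα : 1 < α) (h1 : γ ≤ 1) {M : ℝ}
    (hM : 0 < M) : {k : ℕ | M⁻¹ ≤ rho b α γ k}.Finite := by
  have hb' : (1 : ℝ) < b := by exact_mod_cast hb
  obtain ⟨n, hn⟩ := pow_unbounded_of_one_lt M hb'
  refine (Set.finite_Iio (b ^ n)).subset fun k hk => ?_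
  by_contra hk'
  have hk' : b ^ n ≤ k := by simpa using hk'
  have hk0 : k ≠ 0 := by have : 0 < b ^ n := by positivity
                         omega
  have hlog : n ≤ Nat.log b k := Nat.le_log_of_pow_le hb hk'
  have hk : M⁻¹ ≤ γ * (b : ℝ) ^ (-(α * (Nat.log b k : ℝ))) := by simpa [rho, hk0] using hk
  have hlog' : (n : ℝ) ≤ Nat.log b k := by exact_mod_cast hlog
  have h2 : (b : ℝ) ^ (-(α * (Nat.log b k : ℝ))) ≤ (b : ℝ) ^ (-(n : ℝ)) :=
    Real.rpow_le_rpow_of_exponent_le hb'.le (by nlinarith [Nat.cast_nonneg (α := ℝ) n])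
  rw [Real.rpow_neg (by positivity) (n : ℝ), Real.rpow_natCast] at h2
  have h3 : ((b : ℝ) ^ n)⁻¹ < M⁻¹ := inv_strictAnti₀ hM hn
  have h' : 0 ≤ (b : ℝ) ^ (-(α * (Nat.log b k : ℝ))) := by positivity
  nlinarith

theorem r_finite {β γ : ℝ} (hβ : 1 < β) (h1 : γ ≤ 1) {M : ℝ} (hM : 0 < M) :
    {l : ℤ | M⁻¹ ≤ r β γ l}.Finite := by
  obtain ⟨n, hn⟩ := exists_nat_gt M
  refine (Set.finite_Icc (-(n : ℤ)) n).subset fun l hl => ?_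
  by_contra hl'
  have hl2 : (n : ℤ) < |l| := by
    by_contra h
    exact hl' (by simpa [Set.mem_Icc] using abs_le.mp (not_lt.mp h))
  have hl0 : l ≠ 0 := by rintro rfl; simp at hl2; omega
  have hl : M⁻¹ ≤ γ * |(l : ℝ)| ^ (-β) := by simpa [r, hl0] using hl
  have h2 : (n : ℝ) < |(l : ℝ)| := by exact_mod_cast hl2
  have h3 : (1 : ℝ) ≤ |(l : ℝ)| := by exact_mod_cast Int.one_le_abs hl0
  have h4 : |(l : ℝ)| ^ (-β) ≤ |(l : ℝ)| ^ (-(1 : ℝ)) :=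
    Real.rpow_le_rpow_of_exponent_le h3 (by linarith)
  rw [Real.rpow_neg_one] at h4
  have h5 : |(l : ℝ)|⁻¹ < M⁻¹ := inv_strictAnti₀ hM (hn.trans h2)
  have h' : 0 ≤ |(l : ℝ)| ^ (-β) := by positivity
  nlinarith

theorem indexSet_finite {b : ℕ} (hb : 1 < b) {α β : ℝ} (hα : 1 < α) (hβ : 1 < β)
    {γ₁ γ₂ : ℕ → ℝ} (hγ₁ : ∀ j, 0 < γ₁ j ∧ γ₁ j ≤ 1) (hγ₂ : ∀ j, 0 < γ₂ j ∧ γ₂ j ≤ 1)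
    (s t : ℕ) (M : ℝ) : (indexSet b α β γ₁ γ₂ s t M).Finite := by
  have hP1 (k : Fin s → ℕ) : 0 < ∏ j : Fin s, rho b α (γ₁ j) (k j) :=
    Finset.prod_pos fun j _ => rho_pos hb (hγ₁ j).1 _
  have hP2 (l : Fin t → ℤ) : 0 < ∏ j : Fin t, r β (γ₂ j) (l j) :=
    Finset.prod_pos fun j _ => r_pos (hγ₂ j).1 _
  have hQ1 (k : Fin s → ℕ) : ∏ j : Fin s, rho b α (γ₁ j) (k j) ≤ 1 :=
    Finset.prod_le_one (fun j _ => (rho_pos hb (hγ₁ j).1 _).le)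
      fun j _ => rho_le_one hb hα (hγ₁ j).2 _
  have hQ2 (l : Fin t → ℤ) : ∏ j : Fin t, r β (γ₂ j) (l j) ≤ 1 :=
    Finset.prod_le_one (fun j _ => (r_pos (hγ₂ j).1 _).le) fun j _ => r_le_one hβ (hγ₂ j).2 _
  rcases le_or_gt M 0 with hM | hM
  · convert Set.finite_empty
    ext kl
    simp only [indexSet, weight, Set.mem_ofPred_eq, Set.mem_empty_iff_false, iff_false, not_le]
    exact hM.trans_lt (inv_pos.mpr (mul_pos (hP1 _) (hP2 _)))
  · refine ((Set.Finite.pi' fun j : Fin s => rho_finite hb hα (hγ₁ j).2 hM).prod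
      (Set.Finite.pi' fun j : Fin t => r_finite hβ (hγ₂ j).2 hM)).subset ?_
    rintro ⟨k, l⟩ hkl
    have hkl : M⁻¹ ≤ (∏ j : Fin s, rho b α (γ₁ j) (k j)) * ∏ j : Fin t, r β (γ₂ j) (l j) :=
      inv_le_of_inv_le₀ (mul_pos (hP1 k) (hP2 l)) hkl
    refine ⟨fun j => ?_, fun j => ?_⟩
    · have h1 : ∏ i : Fin s, rho b α (γ₁ i) (k i) ≤ rho b α (γ₁ j) (k j) := by
        rw [← Finset.mul_prod_erase _ _ (Finset.mem_univ j)]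
        exact mul_le_of_le_one_right (rho_pos hb (hγ₁ j).1 _).le
          (Finset.prod_le_one (fun i _ => (rho_pos hb (hγ₁ i).1 _).le)
            fun i _ => rho_le_one hb hα (hγ₁ i).2 _)
      exact hkl.trans ((mul_le_of_le_one_right (hP1 k).le (hQ2 l)).trans h1)
    · have h1 : ∏ i : Fin t, r β (γ₂ i) (l i) ≤ r β (γ₂ j) (l j) := by
        rw [← Finset.mul_prod_erase _ _ (Finset.mem_univ j)]
        exact mul_le_of_le_one_right (r_pos (hγ₂ j).1 _).le
          (Finset.prod_le_one (fun i _ => (r_pos (hγ₂ i).1 _).le)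
            fun i _ => r_le_one hβ (hγ₂ i).2 _)
      exact hkl.trans ((mul_le_of_le_one_left (hP2 l).le (hQ1 k)).trans h1)

end HybridSpace

end

noncomputable section

namespace HybridSpace

section

/-! ### Digits -/

/-! Write φ_k for the product basis, w(k) for its weight and N = b^m. The φ_k are orthonormal and
form a group of characters: φ_l · conj φ_k = φ_{l⊖k}, with digitwise subtraction in the Walsh part.
By Parseval the squared L₂ error of the algorithm is a sum over frequencies of a truncation part and
an aliasing part.

Truncation: outside 𝒜_M one has w(k) < 1/M, so on the unit ball this part costs at most 1/M.
Aliasing: for k in 𝒜_M the computed coefficient differs from the true one by the sum over l ≠ k of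
f̂(l) times the node mean of φ_{l⊖k}. Weighted Cauchy–Schwarz and the quasi-multiplicativity w(l)
w(k) ≤ C w(l⊖k), with C = ∏ max(1, 2^β γ₂), bound the square of this by C · M · D
(`aliasing_error_le`). Here D, the `defect`, is the sum over h ≠ 0 of w(h) |mean φ_h|², which is
exactly the squared worst-case integration error (`intError_eq`). So only |𝒜_M| and D are needed.
The first is at most M^κ ∑ w^κ ≤ M^κ B (`card_indexSet_le`); the second is at most 2Q/N by the
component-by-component construction (`energy_le_of_isCBC`). With c = 2QCB the squared error is at
most 1/M + M^(1+κ) c/N, and the prescribed M makes the two terms equal (`sqrt_balanced_eq`).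

For the construction one follows the `energy` 1 + D. As a function of the new component u it is a
weighted sum of |N⁻¹ ∑_v c_v χ(vu)|², where the unimodular c_v come from the components already
fixed and χ is a character given by the new frequency. A minimiser is no worse than the average over
the candidates. If χ is not trivial on the nodes, Parseval in u bounds the sum over all u, whatever
the c_v (`sum_normSq_mean_eq_one`). If it is trivial, the term reproduces the old energy; apart from
the frequency 0 this happens only for multiples of N, of total weight O(N^(-α)) or O(N^(-β)). For
lattice components, l may share a factor with N, so several units u can give the same residue lu;
the decay of r compensates for this multiplicity (`tsum_r_card_unitSolutions_le`). At least half of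
N residues are candidates, so one step multiplies Q by at most 1 + 2δ, where δ is the bound used for
the total weight of the nonzero new frequencies (`le_of_averaging`). -/

theorem natDigit_lt {b : ℕ} (hb : 0 < b) (k i : ℕ) : natDigit b k i < b := Nat.mod_lt _ hb

theorem natDigit_zero_right (b k : ℕ) : natDigit b k 0 = k % b := by simp [natDigit]

theorem natDigit_succ (b k i : ℕ) : natDigit b k (i + 1) = natDigit b (k / b) i := by
  simp [natDigit, pow_succ', Nat.div_div_eq_div_mul]

theorem natDigit_eq_zero_of_lt {b k n i : ℕ} (hb : 0 < b) (hk : k < b ^ n) (hi : n ≤ i) :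
    natDigit b k i = 0 := by
  have : k < b ^ i := hk.trans_le (Nat.pow_le_pow_right hb hi)
  simp [natDigit, Nat.div_eq_of_lt this]

theorem natDigit_cast (b k i : ℕ) : ((natDigit b k i : ℕ) : ZMod b) = ((k / b ^ i : ℕ) : ZMod b) := by
  simp [natDigit]

theorem natDigit_sum {b : ℕ} (d : ℕ → ℕ) (hd : ∀ i, d i < b) (n i : ℕ) :
    natDigit b (∑ j ∈ Finset.range n, d j * b ^ j) i = if i < n then d i else 0 := by
  induction n generalizing d i with
  | zero => simp [natDigit]
  | succ n ih =>
    have hb : 0 < b := (Nat.zero_le _).trans_lt (hd 0)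
    have h : ∑ j ∈ Finset.range (n + 1), d j * b ^ j
        = d 0 + b * ∑ j ∈ Finset.range n, d (j + 1) * b ^ j := by
      rw [Finset.sum_range_succ', Finset.mul_sum, add_comm]
      simp only [pow_zero, mul_one, pow_succ]
      congr 1
      exact Finset.sum_congr rfl fun j _ => by ring
    rw [h]
    cases i with
    | zero => simp [natDigit_zero_right, Nat.mod_eq_of_lt (hd 0)]
    | succ i =>
      rw [natDigit_succ, Nat.add_mul_div_left _ _ hb, Nat.div_eq_of_lt (hd 0), zero_add,
        ih (fun j => d (j + 1)) fun j => hd _]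
      simp

theorem sum_digits_lt {b : ℕ} (d : ℕ → ℕ) (hd : ∀ i, d i < b) (n : ℕ) :
    ∑ j ∈ Finset.range n, d j * b ^ j < b ^ n := by
  induction n with
  | zero => simp
  | succ n ih =>
    rw [Finset.sum_range_succ, pow_succ]
    have := hd n
    have : d n * b ^ n + b ^ n ≤ b ^ n * b := by
      rw [mul_comm (b ^ n) b, ← Nat.succ_mul]
      exact Nat.mul_le_mul_right _ this
    omega

theorem natDigit_ext {b : ℕ} (hb : 1 < b) {k l : ℕ} (h : ∀ i, natDigit b k i = natDigit b l i) :
    k = l := by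
  induction k using Nat.strong_induction_on generalizing l with
  | _ k ih =>
    rcases Nat.eq_zero_or_pos k with rfl | hk
    · by_contra hl
      have hl : l ≠ 0 := fun h => hl h.symm
      have h1 := h (Nat.log b l)
      have h2 : b ^ Nat.log b l ≤ l := Nat.pow_log_le_self b hl
      have h3 : l < b ^ (Nat.log b l + 1) := Nat.lt_pow_succ_log_self hb l
      have h4 : l / b ^ Nat.log b l < b := by
        rw [Nat.div_lt_iff_lt_mul (by positivity)]
        rwa [pow_succ, mul_comm] at h3
      have h5 : 0 < l / b ^ Nat.log b l := Nat.div_pos h2 (by positivity)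
      simp [natDigit, Nat.mod_eq_of_lt h4] at h1
      omega
    · have h0 := h 0
      have h1 := ih (k / b) (Nat.div_lt_self hk hb) (l := l / b) fun i => by
        rw [← natDigit_succ, ← natDigit_succ]; exact h _
      simp only [natDigit_zero_right] at h0
      rw [← Nat.div_add_mod k b, ← Nat.div_add_mod l b, h0, h1]

theorem natDigit_zero (b i : ℕ) : natDigit b 0 i = 0 := by simp [natDigit]

theorem exists_natDigit_ne_zero {b k : ℕ} (hb : 1 < b) (hk : k ≠ 0) : ∃ i, natDigit b k i ≠ 0 := by
  by_contra! h
  exact hk (natDigit_ext hb fun i => by rw [h, natDigit_zero])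

/-- Nodes with m digits see only the lowest m digits of a frequency. This separates the frequencies
that act nontrivially from the multiples of b^m, which act as the constant 1. -/
theorem exists_natDigit_ne_zero_of_not_dvd {b m k : ℕ} (hk : ¬ b ^ m ∣ k) :
    ∃ i < m, natDigit b k i ≠ 0 := by
  by_contra! h
  refine hk ?_
  clear hk
  induction m with
  | zero => simp
  | succ m ih =>
    have h1 := Nat.mod_eq_zero_of_dvd (ih fun i hi => h i (by omega))
    have h2 : k / b ^ m % b = 0 := h m (by omega)
    exact Nat.dvd_of_mod_eq_zero (by rw [Nat.mod_pow_succ, h1, h2, mul_zero, add_zero])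

/-! ### Digitwise subtraction -/

/-- Digitwise subtraction modulo `b`, written `k ⊖ l` in the literature. -/
def digitSub (b k l : ℕ) : ℕ :=
  ∑ i ∈ Finset.range (max k l), (((k / b ^ i : ℕ) : ZMod b) - ((l / b ^ i : ℕ) : ZMod b)).val * b ^ i

variable {b : ℕ}

theorem natDigit_digitSub (hb : 1 < b) (k l i : ℕ) :
    natDigit b (digitSub b k l) i =
      (((k / b ^ i : ℕ) : ZMod b) - ((l / b ^ i : ℕ) : ZMod b)).val := by
  have : NeZero b := ⟨by omega⟩
  rw [digitSub, natDigit_sum _ (fun i => ZMod.val_lt _)]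
  split_ifs with h
  · rfl
  · have hk : k < b ^ i := (le_max_left k l |>.trans (not_lt.mp h)).trans_lt (Nat.lt_pow_self hb)
    have hl : l < b ^ i := (le_max_right k l |>.trans (not_lt.mp h)).trans_lt (Nat.lt_pow_self hb)
    simp [Nat.div_eq_of_lt hk, Nat.div_eq_of_lt hl]

theorem digitSub_cast (hb : 1 < b) (k l i : ℕ) :
    ((natDigit b (digitSub b k l) i : ℕ) : ZMod b) =
      (natDigit b k i : ZMod b) - (natDigit b l i : ZMod b) := by
  have : NeZero b := ⟨by omega⟩
  rw [natDigit_digitSub hb, natDigit_cast, natDigit_cast, ZMod.natCast_zmod_val]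

theorem natDigit_eq_of_cast_eq (hb : 1 < b) {k l i j : ℕ}
    (h : (natDigit b k i : ZMod b) = (natDigit b l j : ZMod b)) :
    natDigit b k i = natDigit b l j := by
  rw [ZMod.natCast_eq_natCast_iff] at h
  exact Nat.ModEq.eq_of_lt_of_lt h (natDigit_lt (by omega) _ _) (natDigit_lt (by omega) _ _)

theorem digitSub_left_injective (hb : 1 < b) (l : ℕ) : Function.Injective fun k => digitSub b k l := by
  intro k k' h
  refine natDigit_ext hb fun i => natDigit_eq_of_cast_eq hb ?_
  have h1 := digitSub_cast hb k l i
  have h2 := digitSub_cast hb k' l i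
  simp only at h
  rw [h, h2] at h1
  exact (sub_left_injective h1).symm

theorem digitSub_self (hb : 1 < b) (k : ℕ) : digitSub b k k = 0 :=
  natDigit_ext hb fun i => natDigit_eq_of_cast_eq hb <| by
    rw [digitSub_cast hb, sub_self, natDigit_zero, Nat.cast_zero]

theorem lt_pow_of_natDigit_eq_zero (hb : 1 < b) {k n : ℕ}
    (h : ∀ i, n ≤ i → natDigit b k i = 0) : k < b ^ n := by
  have : k = ∑ j ∈ Finset.range n, natDigit b k j * b ^ j :=
    natDigit_ext hb fun i => by
      rw [natDigit_sum _ (fun i => natDigit_lt (by omega) _ _)]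
      split_ifs with hi
      · rfl
      · exact h i (not_lt.mp hi)
  rw [this]
  exact sum_digits_lt _ (fun i => natDigit_lt (by omega) _ _) n

theorem digitSub_lt_pow (hb : 1 < b) {k l n : ℕ} (hk : k < b ^ n) (hl : l < b ^ n) :
    digitSub b k l < b ^ n := by
  have : NeZero b := ⟨by omega⟩
  refine lt_pow_of_natDigit_eq_zero hb fun i hi => ?_
  rw [natDigit_digitSub hb,
    Nat.div_eq_of_lt (hk.trans_le (Nat.pow_le_pow_right (by omega) hi)),
    Nat.div_eq_of_lt (hl.trans_le (Nat.pow_le_pow_right (by omega) hi))]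
  simp

/-! ### Walsh functions as additive characters -/

/-- The exponent matters only modulo b. The free length n lets two frequencies be written over a
common range, so products of Walsh functions become sums of digits in `ZMod b`. -/
theorem wal_eq_stdAddChar [NeZero b] (hb : 1 < b) {k n : ℕ} (hk : k < b ^ n) (x : ℝ) :
    wal b k x = ZMod.stdAddChar
      (∑ i ∈ Finset.range n, (realDigit b x (i + 1) : ZMod b) * (natDigit b k i : ZMod b)) := by
  have hb0 : 0 < b := by omega
  have aux (n' : ℕ) (h : k < b ^ n') (N : ℕ) (hN : n' ≤ N) :
      ∑ i ∈ Finset.range n', realDigit b x (i + 1) * natDigit b k i =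
        ∑ i ∈ Finset.range N, realDigit b x (i + 1) * natDigit b k i :=
    Finset.sum_subset (Finset.range_mono hN) fun i _ hi => by
      rw [natDigit_eq_zero_of_lt hb0 h (by simpa using hi), mul_zero]
  have h1 := aux _ (Nat.lt_pow_succ_log_self hb k) (max n (Nat.log b k + 1)) (le_max_right _ _)
  have h2 := aux n hk (max n (Nat.log b k + 1)) (le_max_left _ _)
  rw [wal, h1, ← h2]
  have := ZMod.stdAddChar_coe (N := b)
    ((∑ i ∈ Finset.range n, realDigit b x (i + 1) * natDigit b k i : ℕ) : ℤ)
  push_cast at this ⊢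
  rw [this]

theorem wal_zero (b : ℕ) (x : ℝ) : wal b 0 x = 1 := by simp [wal, natDigit]

theorem norm_wal (b k : ℕ) (x : ℝ) : ‖wal b k x‖ = 1 := by
  have h (n : ℕ) : 2 * (Real.pi : ℂ) * Complex.I * (n : ℂ) / b
      = ((2 * Real.pi * n / b : ℝ) : ℂ) * Complex.I := by push_cast; ring
  rw [wal, h, Complex.norm_exp_ofReal_mul_I]

theorem wal_mul_conj [NeZero b] (hb : 1 < b) (k l : ℕ) (x : ℝ) :
    wal b k x * (starRingEnd ℂ) (wal b l x) = wal b (digitSub b k l) x := by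
  have hk : k < b ^ (max k l) := (le_max_left k l).trans_lt (Nat.lt_pow_self hb)
  have hl : l < b ^ (max k l) := (le_max_right k l).trans_lt (Nat.lt_pow_self hb)
  rw [wal_eq_stdAddChar hb hk, wal_eq_stdAddChar hb hl,
    wal_eq_stdAddChar hb (digitSub_lt_pow hb hk hl), ← AddChar.map_neg_eq_conj,
    ← AddChar.map_add_eq_mul, ← sub_eq_add_neg, ← Finset.sum_sub_distrib]
  congr 1
  exact Finset.sum_congr rfl fun i _ => by rw [digitSub_cast hb]; ring

theorem measurable_realDigit (b i : ℕ) : Measurable fun x : ℝ => realDigit b x i := by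
  unfold realDigit
  exact (measurable_from_nat (f := fun n => n % b)).comp
    (Nat.measurable_floor.comp (measurable_id.mul_const _))

theorem measurable_wal (b k : ℕ) : Measurable (wal b k) := by
  unfold wal
  have h : Measurable fun x : ℝ =>
      (∑ i ∈ Finset.range (Nat.log b k + 1), realDigit b x (i + 1) * natDigit b k i) :=
    Finset.measurable_sum _ fun i _ => (measurable_realDigit b (i + 1)).mul_const _
  exact (measurable_from_nat
    (f := fun n : ℕ => Complex.exp (2 * Real.pi * Complex.I * (n : ℂ) / b))).comp h

/-! ### Integrals of Walsh functions -/

theorem realDigit_add_one {x : ℝ} (hx : 0 ≤ x) {i : ℕ} (hi : 1 ≤ i) :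
    realDigit b (x + 1) i = realDigit b x i := by
  unfold realDigit
  have h : (x + 1) * (b : ℝ) ^ i = x * (b : ℝ) ^ i + ((b ^ i : ℕ) : ℝ) := by push_cast; ring
  rw [h, Nat.floor_add_natCast (by positivity), Nat.add_mod,
    Nat.mod_eq_zero_of_dvd (dvd_pow_self b (by omega : i ≠ 0)), add_zero, Nat.mod_mod]

theorem wal_add_one {x : ℝ} (hx : 0 ≤ x) (k : ℕ) : wal b k (x + 1) = wal b k x := by
  unfold wal
  simp only [realDigit_add_one hx (Nat.le_add_left 1 _)]

/-- Carries move only towards earlier digits, so from the shifted position on the digits are known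
modulo b. For j < i nothing as simple holds. -/
theorem realDigit_add_inv_pow (hb : 1 < b) {x : ℝ} (hx : 0 ≤ x) {i j : ℕ} (hij : i ≤ j) :
    (realDigit b (x + ((b : ℝ) ^ (i + 1))⁻¹) (j + 1) : ZMod b) =
      realDigit b x (j + 1) + if i = j then 1 else 0 := by
  unfold realDigit
  have hb' : (b : ℝ) ≠ 0 := by positivity
  have h : (x + ((b : ℝ) ^ (i + 1))⁻¹) * (b : ℝ) ^ (j + 1)
      = x * (b : ℝ) ^ (j + 1) + ((b ^ (j - i) : ℕ) : ℝ) := by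
    rw [add_mul]
    congr 1
    push_cast
    rw [inv_mul_eq_iff_eq_mul₀ (by positivity), ← pow_add]
    congr 1
    omega
  rw [h, Nat.floor_add_natCast (by positivity), ZMod.natCast_mod, ZMod.natCast_mod]
  push_cast
  congr 1
  split_ifs with h
  · simp [h]
  · have : j - i ≠ 0 := by omega
    simp [this]

/-- Periodicity is required only on the nonnegative axis, because the digits are defined through the
floor in ℕ. -/
theorem integral_periodic {F : ℝ → ℂ} (hF : ∀ x, 0 ≤ x → F (x + 1) = F x)
    (hint : ∀ a c : ℝ, IntervalIntegrable F MeasureTheory.volume a c) {h : ℝ} (h0 : 0 ≤ h) :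
    ∫ x in (0 : ℝ)..1, F (x + h) = ∫ x in (0 : ℝ)..1, F x := by
  have h1 : ∫ x in (1 : ℝ)..(1 + h), F x = ∫ x in (0 : ℝ)..h, F x := by
    have := intervalIntegral.integral_comp_add_right (a := 0) (b := h) F 1
    rw [zero_add, add_comm h 1] at this
    rw [← this]
    refine intervalIntegral.integral_congr fun x hx => ?_
    rw [Set.uIcc_of_le h0] at hx
    exact hF x hx.1
  rw [intervalIntegral.integral_comp_add_right, zero_add,
    ← intervalIntegral.integral_add_adjacent_intervals (hint h 1) (hint 1 (1 + h)), h1, add_comm,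
    intervalIntegral.integral_add_adjacent_intervals (hint 0 h) (hint h 1)]

/-- A suitable shift multiplies the Walsh function by a nontrivial root of unity, while periodicity
leaves the integral unchanged; hence the integral is 0. -/
theorem integral_wal [Fact b.Prime] (k : ℕ) :
    ∫ x in Set.Ico (0 : ℝ) 1, wal b k x = if k = 0 then 1 else 0 := by
  have hb : 1 < b := (Fact.out : b.Prime).one_lt
  split_ifs with hk
  · simp [hk, wal_zero]
  classical
  rw [MeasureTheory.integral_Ico_eq_integral_Ioc, ← intervalIntegral.integral_of_le zero_le_one]
  have hex := exists_natDigit_ne_zero hb hk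
  -- The lowest nonzero digit of k is chosen: the uncontrolled carries of the shift by b^(-(i+1))
  -- fall on positions where k has digit 0.
  set i := Nat.find hex
  have hi : natDigit b k i ≠ 0 := Nat.find_spec hex
  have hmin (j : ℕ) (hj : j < i) : natDigit b k j = 0 := not_not.mp (Nat.find_min hex hj)
  have hin : i < k := by
    by_contra hik
    exact hi (natDigit_eq_zero_of_lt (by omega) (Nat.lt_pow_self hb) (not_lt.mp hik))
  have key (x : ℝ) (hx : 0 ≤ x) : wal b k (x + ((b : ℝ) ^ (i + 1))⁻¹)
      = wal b k x * ZMod.stdAddChar (natDigit b k i : ZMod b) := by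
    rw [wal_eq_stdAddChar hb (Nat.lt_pow_self hb), wal_eq_stdAddChar hb (Nat.lt_pow_self hb),
      ← AddChar.map_add_eq_mul]
    congr 1
    have : (natDigit b k i : ZMod b)
        = ∑ j ∈ Finset.range k, if i = j then (natDigit b k j : ZMod b) else 0 := by
      simp [hin]
    rw [this, ← Finset.sum_add_distrib]
    refine Finset.sum_congr rfl fun j _ => ?_
    rcases lt_or_ge j i with hj | hj
    · simp [hmin j hj]
    · rw [realDigit_add_inv_pow hb hx hj]
      split_ifs <;> ring
  have hint (a c : ℝ) : IntervalIntegrable (wal b k) MeasureTheory.volume a c := by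
    refine (intervalIntegrable_const (c := (1 : ℝ))).mono_fun
      (measurable_wal b k).aestronglyMeasurable (Filter.Eventually.of_forall fun x => ?_)
    simp [norm_wal]
  have h1 := integral_periodic (fun x hx => wal_add_one hx k) hint
    (h := ((b : ℝ) ^ (i + 1))⁻¹) (by positivity)
  have h2 : ∫ x in (0 : ℝ)..1, wal b k (x + ((b : ℝ) ^ (i + 1))⁻¹)
      = ∫ x in (0 : ℝ)..1, wal b k x * ZMod.stdAddChar (natDigit b k i : ZMod b) := by
    refine intervalIntegral.integral_congr fun x hx => ?_
    rw [Set.uIcc_of_le zero_le_one] at hx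
    exact key x hx.1
  rw [h2, intervalIntegral.integral_mul_const] at h1
  have h3 : (ZMod.stdAddChar (natDigit b k i : ZMod b) : ℂ) ≠ 1 := by
    intro h
    have h0 : (natDigit b k i : ZMod b) = 0 := ZMod.injective_stdAddChar (by simpa using h)
    rw [ZMod.natCast_eq_zero_iff] at h0
    exact hi (Nat.eq_zero_of_dvd_of_lt h0 (natDigit_lt (by omega) _ _))
  by_contra h4
  exact h3 (mul_left_cancel₀ h4 (by rw [h1, mul_one]))

/-! ### The product basis -/

variable {s t : ℕ}

/-- The frequency of `φ_k · conj φ_l`. -/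
def freqSub (b : ℕ) (k l : Freq s t) : Freq s t := (fun j => digitSub b (k.1 j) (l.1 j), k.2 - l.2)

theorem freqSub_left_injective (hb : 1 < b) (l : Freq s t) :
    Function.Injective fun k => freqSub b k l := by
  intro k k' h
  have h1 := congrArg Prod.fst h
  have h2 := congrArg Prod.snd h
  refine Prod.ext (funext fun j => digitSub_left_injective hb (l.1 j) (congrFun h1 j)) ?_
  exact sub_left_injective h2

theorem freqSub_eq_zero_iff (hb : 1 < b) {k l : Freq s t} : freqSub b k l = 0 ↔ k = l := by
  have h0 : freqSub b l l = 0 := by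
    simp only [freqSub, digitSub_self hb, sub_self]; rfl
  exact ⟨fun h => freqSub_left_injective hb l (by simp only [h, h0]), fun h => h ▸ h0⟩

theorem trigVec_eq (l : Fin t → ℤ) (y : Fin t → ℝ) :
    trigVec l y = ∏ j, Complex.exp (2 * Real.pi * Complex.I * (l j : ℂ) * (y j : ℂ)) := by
  rw [trigVec, ← Complex.exp_sum]
  push_cast
  rw [Finset.mul_sum]
  congr 1
  exact Finset.sum_congr rfl fun j _ => by ring

theorem trigVec_mul_conj (k l : Fin t → ℤ) (y : Fin t → ℝ) :
    trigVec k y * (starRingEnd ℂ) (trigVec l y) = trigVec (k - l) y := by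
  unfold trigVec
  rw [← Complex.exp_conj, ← Complex.exp_add]
  congr 1
  simp only [map_mul, Complex.conj_I, Complex.conj_ofReal, map_ofNat, Pi.sub_apply]
  push_cast
  simp only [sub_mul, Finset.sum_sub_distrib]
  ring

theorem norm_trigVec (l : Fin t → ℤ) (y : Fin t → ℝ) : ‖trigVec l y‖ = 1 := by
  have : 2 * (Real.pi : ℂ) * Complex.I * ((∑ j, (l j : ℝ) * y j : ℝ) : ℂ)
      = ((2 * Real.pi * ∑ j, (l j : ℝ) * y j : ℝ) : ℂ) * Complex.I := by push_cast; ring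
  rw [trigVec, this, Complex.norm_exp_ofReal_mul_I]

theorem norm_basisFun (kl : Freq s t) (p : Pt s t) : ‖basisFun b kl p‖ = 1 := by
  simp [basisFun, walVec, norm_wal, norm_trigVec]

theorem basisFun_mul_conj [NeZero b] (hb : 1 < b) (k l : Freq s t) (p : Pt s t) :
    basisFun b k p * (starRingEnd ℂ) (basisFun b l p) = basisFun b (freqSub b k l) p := by
  simp only [basisFun, walVec, map_mul, map_prod, freqSub]
  rw [← trigVec_mul_conj, mul_mul_mul_comm, ← Finset.prod_mul_distrib]
  simp only [wal_mul_conj hb]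

theorem basisFun_zero (p : Pt s t) : basisFun b 0 p = 1 := by
  simp [basisFun, walVec, trigVec, wal_zero]

theorem measurable_basisFun (kl : Freq s t) : Measurable (basisFun b kl) := by
  unfold basisFun walVec trigVec
  refine Measurable.mul (Finset.measurable_prod _ fun j _ => (measurable_wal b _).comp
    ((measurable_pi_apply j).comp measurable_fst)) ?_
  fun_prop

end

section

/-! ### Orthonormality -/

variable {b s t : ℕ}

theorem cubeMeasure_eq (s t : ℕ) : cubeMeasure s t =
    (MeasureTheory.Measure.pi fun _ : Fin s => MeasureTheory.volume.restrict (Set.Ico (0 : ℝ) 1)).prod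
      (MeasureTheory.Measure.pi fun _ : Fin t =>
        MeasureTheory.volume.restrict (Set.Ico (0 : ℝ) 1)) := by
  have h : cube s t = (Set.univ.pi fun _ : Fin s => Set.Ico (0 : ℝ) 1) ×ˢ
      (Set.univ.pi fun _ : Fin t => Set.Ico (0 : ℝ) 1) := by
    ext p; simp [cube, Set.mem_pi]
  rw [cubeMeasure, h, ← MeasureTheory.Measure.restrict_pi_pi,
    ← MeasureTheory.Measure.restrict_pi_pi, MeasureTheory.Measure.prod_restrict]
  rfl

instance isProbabilityMeasure_restrict_Ico :
    MeasureTheory.IsProbabilityMeasure (MeasureTheory.volume.restrict (Set.Ico (0 : ℝ) 1)) :=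
  ⟨by simp⟩

instance isProbabilityMeasure_cubeMeasure :
    MeasureTheory.IsProbabilityMeasure (cubeMeasure s t) := by
  rw [cubeMeasure_eq]; infer_instance

theorem measurableSet_cube (s t : ℕ) : MeasurableSet (cube s t) := by
  have h : cube s t = (Set.univ.pi fun _ : Fin s => Set.Ico (0 : ℝ) 1) ×ˢ
      (Set.univ.pi fun _ : Fin t => Set.Ico (0 : ℝ) 1) := by
    ext p; simp [cube, Set.mem_pi]
  rw [h]
  exact (MeasurableSet.univ_pi fun _ => measurableSet_Ico).prod
    (MeasurableSet.univ_pi fun _ => measurableSet_Ico)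

theorem ae_mem_cube (s t : ℕ) : ∀ᵐ p ∂(cubeMeasure s t), p ∈ cube s t :=
  MeasureTheory.ae_restrict_mem (measurableSet_cube s t)

theorem integral_exp_int (l : ℤ) :
    ∫ y in Set.Ico (0 : ℝ) 1, Complex.exp (2 * Real.pi * Complex.I * (l : ℂ) * (y : ℂ)) =
      if l = 0 then 1 else 0 := by
  split_ifs with hl
  · simp [hl]
  have hc : 2 * (Real.pi : ℂ) * Complex.I * (l : ℂ) ≠ 0 := by
    simp [hl, Real.pi_ne_zero]
  rw [MeasureTheory.integral_Ico_eq_integral_Ioc, ← intervalIntegral.integral_of_le zero_le_one,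
    integral_exp_mul_complex hc]
  have : 2 * (Real.pi : ℂ) * Complex.I * (l : ℂ) * ((1 : ℝ) : ℂ)
      = l * (2 * Real.pi * Complex.I) := by push_cast; ring
  rw [this, Complex.exp_int_mul_two_pi_mul_I]
  simp

theorem integral_basisFun [Fact b.Prime] (kl : Freq s t) :
    ∫ p, basisFun b kl p ∂(cubeMeasure s t) = if kl = 0 then 1 else 0 := by
  have h (p : Pt s t) : basisFun b kl p = (∏ j, wal b (kl.1 j) (p.1 j)) *
      ∏ j, Complex.exp (2 * Real.pi * Complex.I * (kl.2 j : ℂ) * (p.2 j : ℂ)) := by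
    rw [basisFun, walVec, trigVec_eq]
  simp_rw [h]
  rw [cubeMeasure_eq]
  refine (MeasureTheory.integral_prod_mul (fun x : Fin s → ℝ => ∏ j, wal b (kl.1 j) (x j))
    (fun y : Fin t → ℝ =>
      ∏ j, Complex.exp (2 * Real.pi * Complex.I * (kl.2 j : ℂ) * (y j : ℂ)))).trans ?_
  rw [MeasureTheory.integral_fintype_prod_eq_prod (fun j : Fin s => wal b (kl.1 j)),
    MeasureTheory.integral_fintype_prod_eq_prod (fun (j : Fin t) (u : ℝ) =>
      Complex.exp (2 * Real.pi * Complex.I * (kl.2 j : ℂ) * (u : ℂ)))]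
  simp_rw [integral_wal, integral_exp_int, Fintype.prod_ite_zero, Finset.prod_const_one,
    ite_zero_mul_ite_zero, mul_one]
  simp only [Prod.ext_iff, funext_iff, Prod.fst_zero, Prod.snd_zero, Pi.zero_apply]

theorem integrable_basisFun_mul_conj (k l : Freq s t) :
    MeasureTheory.Integrable (fun p => basisFun b k p * (starRingEnd ℂ) (basisFun b l p))
      (cubeMeasure s t) := by
  refine MeasureTheory.Integrable.of_bound (C := 1) (Measurable.aestronglyMeasurable ?_)
    (Filter.Eventually.of_forall fun p => ?_)
  · exact (measurable_basisFun k).mul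
      (Complex.continuous_conj.measurable.comp (measurable_basisFun l))
  · simp [norm_basisFun]

theorem integral_basisFun_mul_conj [Fact b.Prime] (k l : Freq s t) :
    ∫ p, basisFun b k p * (starRingEnd ℂ) (basisFun b l p) ∂(cubeMeasure s t) =
      if k = l then 1 else 0 := by
  have hb := (Fact.out : b.Prime).one_lt
  simp_rw [basisFun_mul_conj hb, integral_basisFun, freqSub_eq_zero_iff hb]

/-! ### Absolutely convergent series -/

theorem summable_mul_basisFun {d : Freq s t → ℂ} (hd : Summable fun kl => ‖d kl‖) (p : Pt s t) :
    Summable fun kl => d kl * basisFun b kl p :=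
  Summable.of_norm (by simpa [norm_basisFun] using hd)

theorem coeff_series [Fact b.Prime] {d : Freq s t → ℂ} (hd : Summable fun kl => ‖d kl‖)
    (l : Freq s t) : coeff b (fun p => ∑' kl, d kl * basisFun b kl p) l = d l := by
  have hF (k : Freq s t) (p : Pt s t) : d k * basisFun b k p * (starRingEnd ℂ) (basisFun b l p)
      = d k * (basisFun b k p * (starRingEnd ℂ) (basisFun b l p)) := mul_assoc _ _ _
  have h := MeasureTheory.hasSum_integral_of_summable_integral_norm (μ := cubeMeasure s t)
    (F := fun (k : Freq s t) p => d k * (basisFun b k p * (starRingEnd ℂ) (basisFun b l p)))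
    (fun k => (integrable_basisFun_mul_conj k l).const_mul _)
    (by simpa [norm_basisFun] using hd)
  simp_rw [MeasureTheory.integral_const_mul, integral_basisFun_mul_conj] at h
  have h' : HasSum (fun k => d k * if k = l then 1 else 0) (d l) := by
    have := hasSum_single (f := fun k => d k * if k = l then (1 : ℂ) else 0) l
      (fun k hk => by simp [hk])
    simpa using this
  rw [coeff, h'.unique h]
  refine MeasureTheory.integral_congr_ae (Filter.Eventually.of_forall fun p => ?_)
  simp only [← hF]
  rw [tsum_mul_right]

theorem coeff_congr {f g : Pt s t → ℂ} (h : ∀ p ∈ cube s t, f p = g p) (kl : Freq s t) :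
    coeff b f kl = coeff b g kl :=
  MeasureTheory.integral_congr_ae ((ae_mem_cube s t).mono fun p hp => by simp only [h p hp])

theorem integral_eq_coeff_zero (f : Pt s t → ℂ) : ∫ p, f p ∂(cubeMeasure s t) = coeff b f 0 := by
  simp [coeff, basisFun_zero]

/-- Absolute convergence allows the square to be expanded as a double series and integrated term by
term; only the diagonal survives. No completeness of the system is needed. -/
theorem integral_normSq_series [Fact b.Prime] {d : Freq s t → ℂ}
    (hd : Summable fun kl => ‖d kl‖) :
    ∫ p, ‖∑' kl, d kl * basisFun b kl p‖ ^ 2 ∂(cubeMeasure s t) = ∑' kl, ‖d kl‖ ^ 2 := by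
  have hsum : Summable fun q : Freq s t × Freq s t => ‖d q.1‖ * ‖d q.2‖ :=
    hd.mul_of_nonneg hd (fun _ => norm_nonneg _) fun _ => norm_nonneg _
  have h := MeasureTheory.hasSum_integral_of_summable_integral_norm (μ := cubeMeasure s t)
    (F := fun (q : Freq s t × Freq s t) p => d q.1 * (starRingEnd ℂ) (d q.2) *
      (basisFun b q.1 p * (starRingEnd ℂ) (basisFun b q.2 p)))
    (fun q => (integrable_basisFun_mul_conj q.1 q.2).const_mul _)
    (by simpa [norm_basisFun] using hsum)
  simp_rw [MeasureTheory.integral_const_mul, integral_basisFun_mul_conj] at h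
  have h1 (p : Pt s t) : ∑' q : Freq s t × Freq s t, d q.1 * (starRingEnd ℂ) (d q.2) *
      (basisFun b q.1 p * (starRingEnd ℂ) (basisFun b q.2 p)) =
      ((‖∑' kl, d kl * basisFun b kl p‖ ^ 2 : ℝ) : ℂ) := by
    have hs := summable_mul_basisFun (b := b) hd p
    have hs' : Summable fun kl => (starRingEnd ℂ) (d kl * basisFun b kl p) := by
      refine Summable.of_norm ?_
      simpa [norm_basisFun] using hd
    have hm := hs.hasSum.mul hs'.hasSum (by
      refine Summable.of_norm ?_
      simpa [norm_basisFun] using hsum)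
    have hc : ∑' kl, (starRingEnd ℂ) (d kl * basisFun b kl p)
        = (starRingEnd ℂ) (∑' kl, d kl * basisFun b kl p) := (Complex.conj_tsum _).symm
    rw [hc, Complex.mul_conj, Complex.normSq_eq_norm_sq] at hm
    rw [← hm.tsum_eq]
    refine tsum_congr fun q => ?_
    rw [map_mul]; ring
  simp_rw [h1] at h
  rw [integral_complex_ofReal] at h
  have h2 : HasSum (fun q : Freq s t × Freq s t => d q.1 * (starRingEnd ℂ) (d q.2) *
      if q.1 = q.2 then (1 : ℂ) else 0) ((∑' kl, ‖d kl‖ ^ 2 : ℝ) : ℂ) := by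
    have hsq : Summable fun kl => ‖d kl‖ ^ 2 := by
      have := hsum.comp_injective (i := fun kl : Freq s t => (kl, kl))
        (fun a b h => (Prod.mk.inj h).1)
      simpa [Function.comp_def, pow_two] using this
    have hi : Function.Injective fun kl : Freq s t => (kl, kl) := fun a b h => (Prod.mk.inj h).1
    rw [← hi.hasSum_iff]
    · have := (Complex.hasSum_ofReal (f := fun kl => ‖d kl‖ ^ 2)).mpr hsq.hasSum
      refine this.congr_fun fun k => ?_
      simp [Complex.mul_conj, Complex.normSq_eq_norm_sq]
    · rintro ⟨k, l⟩ hkl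
      have : k ≠ l := by rintro rfl; exact hkl ⟨k, rfl⟩
      simp [this]
  exact_mod_cast (h2.unique h).symm

/-- The function f need not be measurable: on the cube it equals the series, which is a pointwise
limit of measurable finite sums bounded by ∑ ‖d‖. -/
theorem eLpNorm_series [Fact b.Prime] {f : Pt s t → ℂ} {d : Freq s t → ℂ}
    (hd : Summable fun kl => ‖d kl‖)
    (hf : ∀ p ∈ cube s t, f p = ∑' kl, d kl * basisFun b kl p) :
    MeasureTheory.eLpNorm f 2 (cubeMeasure s t) = ENNReal.ofReal √(∑' kl, ‖d kl‖ ^ 2) := by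
  have hmeas : MeasureTheory.AEStronglyMeasurable (fun p => ∑' kl, d kl * basisFun b kl p)
      (cubeMeasure s t) := by
    refine (measurable_of_tendsto_metrizable' (f := fun (F : Finset (Freq s t)) p =>
      ∑ kl ∈ F, d kl * basisFun b kl p) Filter.atTop (fun F => Finset.measurable_sum _ fun kl _ =>
        (measurable_basisFun kl).const_mul _) ?_).aestronglyMeasurable
    exact tendsto_pi_nhds.mpr fun p => (summable_mul_basisFun hd p).hasSum
  have hbd (p : Pt s t) : ‖∑' kl, d kl * basisFun b kl p‖ ≤ ∑' kl, ‖d kl‖ := by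
    have := norm_tsum_le_tsum_norm (f := fun kl => d kl * basisFun b kl p)
      (by simpa [norm_basisFun] using hd)
    simpa [norm_basisFun] using this
  have hmem : MeasureTheory.MemLp (fun p => ∑' kl, d kl * basisFun b kl p) 2 (cubeMeasure s t) :=
    MeasureTheory.MemLp.of_bound hmeas _ (Filter.Eventually.of_forall hbd)
  rw [MeasureTheory.eLpNorm_congr_ae ((ae_mem_cube s t).mono hf),
    hmem.eLpNorm_eq_integral_rpow_norm two_ne_zero ENNReal.ofNat_ne_top]
  rw [← integral_normSq_series (b := b) hd, Real.sqrt_eq_rpow]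
  simp

end

section

/-! ### The worst-case integration error -/

variable {b s t : ℕ}

/-- Cauchy–Schwarz with weights split as w^(-1/2) and w^(1/2), proved on finite partial sums and
passed to the limit. -/
theorem norm_tsum_mul_sq_le {ι : Type*} {d a : ι → ℂ} {w : ι → ℝ} (hw : ∀ i, 0 < w i)
    (hd : Summable fun i => ‖d i‖ ^ 2 / w i) (ha : Summable fun i => w i * ‖a i‖ ^ 2)
    (hda : Summable fun i => d i * a i) :
    ‖∑' i, d i * a i‖ ^ 2 ≤ (∑' i, ‖d i‖ ^ 2 / w i) * ∑' i, w i * ‖a i‖ ^ 2 := by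
  have hlim := (hda.hasSum.norm).pow 2
  refine le_of_tendsto hlim (Filter.Eventually.of_forall fun F => ?_)
  have h1 : ‖∑ i ∈ F, d i * a i‖ ≤ ∑ i ∈ F, ‖d i‖ * ‖a i‖ :=
    (norm_sum_le _ _).trans_eq (Finset.sum_congr rfl fun i _ => norm_mul _ _)
  have h2 : (∑ i ∈ F, ‖d i‖ * ‖a i‖) ^ 2 ≤
      (∑ i ∈ F, ‖d i‖ ^ 2 / w i) * ∑ i ∈ F, w i * ‖a i‖ ^ 2 := by
    refine Finset.sum_sq_le_sum_mul_sum_of_sq_le_mul F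
      (fun i _ => div_nonneg (sq_nonneg _) (hw i).le)
      (fun i _ => mul_nonneg (hw i).le (sq_nonneg _)) fun i _ => ?_
    have := (hw i).ne'
    exact le_of_eq (by field_simp)
  have hn1 (i : ι) : 0 ≤ ‖d i‖ ^ 2 / w i := div_nonneg (sq_nonneg _) (hw i).le
  have hn2 (i : ι) : 0 ≤ w i * ‖a i‖ ^ 2 := mul_nonneg (hw i).le (sq_nonneg _)
  calc ‖∑ i ∈ F, d i * a i‖ ^ 2 ≤ (∑ i ∈ F, ‖d i‖ * ‖a i‖) ^ 2 := by gcongr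
    _ ≤ _ := h2
    _ ≤ _ := mul_le_mul (hd.sum_le_tsum F fun i _ => hn1 i) (ha.sum_le_tsum F fun i _ => hn2 i)
      (Finset.sum_nonneg fun i _ => hn2 i) (tsum_nonneg hn1)

/-- The value of the quadrature rule at a basis function. -/
def nodeMean (b N : ℕ) (pts : ℕ → Pt s t) (kl : Freq s t) : ℂ :=
  (1 / (N : ℂ)) * ∑ v ∈ Finset.range N, basisFun b kl (pts v)

/-- The weighted mean square of the quadrature rule over all basis functions. -/
def energy (b : ℕ) (α β : ℝ) (γ₁ γ₂ : ℕ → ℝ) (N : ℕ) (pts : ℕ → Pt s t) : ℝ≥0∞ :=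
  ∑' kl : Freq s t, ENNReal.ofReal (weight b α β γ₁ γ₂ kl) * ‖nodeMean b N pts kl‖ₑ ^ 2

theorem norm_mean_le_one {N : ℕ} {c : ℕ → ℂ} (hc : ∀ v, ‖c v‖ ≤ 1) :
    ‖(1 / (N : ℂ)) * ∑ v ∈ Finset.range N, c v‖ ≤ 1 := by
  rw [norm_mul, norm_div, norm_one, Complex.norm_natCast, one_div]
  have : ‖∑ v ∈ Finset.range N, c v‖ ≤ N := by
    refine (norm_sum_le _ _).trans ((Finset.sum_le_sum fun v _ => hc v).trans ?_)
    simp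
  exact (mul_le_mul_of_nonneg_left this (by positivity)).trans (inv_mul_le_one)

theorem norm_nodeMean_le_one (N : ℕ) (pts : ℕ → Pt s t) (kl : Freq s t) :
    ‖nodeMean b N pts kl‖ ≤ 1 :=
  norm_mean_le_one fun _ => (norm_basisFun kl _).le

theorem nodeMean_zero {N : ℕ} (hN : N ≠ 0) (pts : ℕ → Pt s t) : nodeMean b N pts 0 = 1 := by
  have : (N : ℂ) ≠ 0 := by exact_mod_cast hN
  simp [nodeMean, basisFun_zero, this]

theorem weight_zero (b : ℕ) (α β : ℝ) (γ₁ γ₂ : ℕ → ℝ) :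
    weight b α β γ₁ γ₂ (0 : Freq s t) = 1 := by
  simp [weight, rho, r]

theorem weight_pos (hb : 1 < b) {α β : ℝ} {γ₁ γ₂ : ℕ → ℝ}
    (hγ₁ : ∀ j, 0 < γ₁ j) (hγ₂ : ∀ j, 0 < γ₂ j) (kl : Freq s t) :
    0 < weight b α β γ₁ γ₂ kl :=
  mul_pos (Finset.prod_pos fun j _ => rho_pos hb (hγ₁ j) _)
    (Finset.prod_pos fun j _ => r_pos (hγ₂ j) _)

/-- The factor c serves two purposes: c = 1 gives the quadrature rule, and c = conj φ_k gives the
approximate coefficient used by the algorithm. -/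
theorem mean_mul_eq_tsum {f : Pt s t → ℂ} {d : Freq s t → ℂ} (hd : Summable fun kl => ‖d kl‖)
    (hf : ∀ p ∈ cube s t, f p = ∑' kl, d kl * basisFun b kl p)
    {N : ℕ} {pts : ℕ → Pt s t} (hpts : ∀ v, pts v ∈ cube s t) (c : ℕ → ℂ) :
    (1 / (N : ℂ)) * ∑ v ∈ Finset.range N, f (pts v) * c v =
      ∑' kl, d kl * ((1 / (N : ℂ)) * ∑ v ∈ Finset.range N, basisFun b kl (pts v) * c v) := by
  have h (v : ℕ) : HasSum (fun kl => d kl * basisFun b kl (pts v) * c v) (f (pts v) * c v) := by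
    rw [hf _ (hpts v)]
    exact (summable_mul_basisFun hd (pts v)).hasSum.mul_right _
  have h2 := (hasSum_sum (s := Finset.range N) fun v _ => h v).mul_left (1 / (N : ℂ))
  rw [← h2.tsum_eq]
  refine tsum_congr fun kl => ?_
  simp only [Finset.mul_sum]
  exact Finset.sum_congr rfl fun v _ => by ring

theorem integral_sub_mean [Fact b.Prime] {f : Pt s t → ℂ} {d : Freq s t → ℂ}
    (hd : Summable fun kl => ‖d kl‖)
    (hf : ∀ p ∈ cube s t, f p = ∑' kl, d kl * basisFun b kl p)
    {N : ℕ} (hN : N ≠ 0) {pts : ℕ → Pt s t} (hpts : ∀ v, pts v ∈ cube s t) :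
    (∫ p, f p ∂(cubeMeasure s t)) - (1 / (N : ℂ)) * ∑ v ∈ Finset.range N, f (pts v) =
      - ∑' kl, d kl * if kl = 0 then 0 else nodeMean b N pts kl := by
  have h1 := mean_mul_eq_tsum hd hf (N := N) hpts fun _ => 1
  simp only [mul_one] at h1
  rw [integral_eq_coeff_zero (b := b), coeff_congr hf, coeff_series hd, h1]
  have hs : Summable fun kl => d kl * nodeMean b N pts kl := by
    refine Summable.of_norm_bounded hd fun kl => ?_
    rw [norm_mul]
    exact mul_le_of_le_one_right (norm_nonneg _) (norm_nodeMean_le_one N pts kl)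
  have h2 := hs.tsum_eq_add_tsum_ite 0
  change d 0 - ∑' kl, d kl * nodeMean b N pts kl = _
  rw [h2, nodeMean_zero hN, mul_one, sub_add_cancel_left]
  congr 1
  exact tsum_congr fun kl => by split_ifs <;> simp

/-- Cauchy–Schwarz gives the upper bound, and its equality case lies in the unit ball. Equality is
essential: the construction minimises the worst-case error itself, so an upper bound alone could not
be averaged over candidates. -/
theorem intError_eq [Fact b.Prime] {α β : ℝ} {γ₁ γ₂ : ℕ → ℝ}
    (hγ₁ : ∀ j, 0 < γ₁ j) (hγ₂ : ∀ j, 0 < γ₂ j)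
    (hw : Summable fun kl : Freq s t => weight b α β γ₁ γ₂ kl)
    {N : ℕ} (hN : N ≠ 0) {pts : ℕ → Pt s t} (hpts : ∀ v, pts v ∈ cube s t) :
    intError b α β γ₁ γ₂ N pts = ENNReal.ofReal √(∑' kl : Freq s t, weight b α β γ₁ γ₂ kl *
      ‖if kl = 0 then 0 else nodeMean b N pts kl‖ ^ 2) := by
  have hb := (Fact.out : b.Prime).one_lt
  set a : Freq s t → ℂ := fun kl => if kl = 0 then 0 else nodeMean b N pts kl with ha_def
  set w : Freq s t → ℝ := fun kl => weight b α β γ₁ γ₂ kl with hw_def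
  have hwpos (kl : Freq s t) : 0 < w kl := weight_pos hb hγ₁ hγ₂ kl
  have ha1 (kl : Freq s t) : ‖a kl‖ ≤ 1 := by
    simp only [ha_def]
    split_ifs
    · simp
    · exact norm_nodeMean_le_one N pts kl
  have hwa : Summable fun kl => w kl * ‖a kl‖ ^ 2 := by
    refine Summable.of_nonneg_of_le (fun kl => mul_nonneg (hwpos kl).le (sq_nonneg _))
      (fun kl => ?_) hw
    exact mul_le_of_le_one_right (hwpos kl).le (pow_le_one₀ (norm_nonneg _) (ha1 kl))
  set G : ℝ := ∑' kl, w kl * ‖a kl‖ ^ 2 with hG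
  have hG0 : 0 ≤ G := tsum_nonneg fun kl => mul_nonneg (hwpos kl).le (sq_nonneg _)
  apply le_antisymm
  · refine iSup_le fun f => iSup_le fun hf => iSup_le fun hn => ?_
    rw [integral_sub_mean hf.summable_coeff hf.eq_series hN hpts, enorm_neg,
      ← ofReal_norm]
    refine ENNReal.ofReal_le_ofReal (Real.le_sqrt_of_sq_le ?_)
    have hda : Summable fun kl => coeff b f kl * a kl := by
      refine Summable.of_norm_bounded hf.summable_coeff fun kl => ?_
      rw [norm_mul]
      exact mul_le_of_le_one_right (norm_nonneg _) (ha1 kl)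
    refine (norm_tsum_mul_sq_le hwpos hf.summable_norm hwa hda).trans ?_
    refine mul_le_of_le_one_left hG0 ?_
    rw [normH, Real.sqrt_le_one] at hn
    exact hn
  · rcases hG0.eq_or_lt with h0 | hGpos
    · simp [← h0]
    -- Equality case of Cauchy–Schwarz: the coefficients w · conj a, divided by √G to have norm 1.
    set d : Freq s t → ℂ := fun kl => (w kl : ℂ) * (starRingEnd ℂ) (a kl) / (√G : ℂ) with hd_def
    have hsq : 0 < √G := Real.sqrt_pos.mpr hGpos
    have hdn (kl : Freq s t) : ‖d kl‖ = w kl * ‖a kl‖ / √G := by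
      simp [hd_def, abs_of_pos (hwpos kl), abs_of_pos hsq]
    have hd : Summable fun kl => ‖d kl‖ := by
      simp_rw [hdn]
      refine Summable.div_const ?_ _
      exact Summable.of_nonneg_of_le (fun kl => mul_nonneg (hwpos kl).le (norm_nonneg _))
        (fun kl => mul_le_of_le_one_right (hwpos kl).le (ha1 kl)) hw
    have hdw (kl : Freq s t) : ‖d kl‖ ^ 2 / w kl = (w kl * ‖a kl‖ ^ 2) / G := by
      rw [hdn, div_pow, Real.sq_sqrt hG0]
      have := (hwpos kl).ne'
      field_simp
    set f : Pt s t → ℂ := fun p => ∑' kl, d kl * basisFun b kl p with hf_def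
    have hfc (kl : Freq s t) : coeff b f kl = d kl := coeff_series hd kl
    have hmem : MemH b α β γ₁ γ₂ f := by
      refine ⟨by simpa [hfc] using hd, fun p _ => tsum_congr fun kl => by rw [hfc], ?_⟩
      simp_rw [hfc]
      exact (hwa.div_const G).congr fun kl => (hdw kl).symm
    have hnorm : normH b α β γ₁ γ₂ f ≤ 1 := by
      rw [normH]
      simp_rw [hfc]
      have h : ∑' kl, ‖d kl‖ ^ 2 / w kl = 1 := by
        simp_rw [hdw]
        rw [tsum_div_const, div_self hGpos.ne']
      simp only [hw_def] at h
      rw [h, Real.sqrt_one]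
    refine le_trans ?_ (le_iSup_of_le f (le_iSup_of_le hmem (le_iSup_of_le hnorm le_rfl)))
    rw [integral_sub_mean hd (fun p _ => rfl) hN hpts, enorm_neg, ← ofReal_norm]
    refine ENNReal.ofReal_le_ofReal (le_of_eq ?_)
    have h : ∑' kl, d kl * a kl = ((√G : ℝ) : ℂ) := by
      have h1 (kl : Freq s t) : d kl * a kl = ((w kl * ‖a kl‖ ^ 2 / √G : ℝ) : ℂ) := by
        simp only [hd_def]
        push_cast
        rw [← Complex.mul_conj']
        ring
      simp_rw [h1]
      rw [← Complex.ofReal_tsum, tsum_div_const, ← hG]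
      congr 1
      rw [div_eq_iff hsq.ne', Real.mul_self_sqrt hG0]
    rw [h, Complex.norm_real, Real.norm_of_nonneg hsq.le]

/-- The frequency 0 contributes exactly 1. Including it turns the error into a sum over all
frequencies, which unfolds one coordinate at a time. -/
theorem intError_sq_add_one [Fact b.Prime] {α β : ℝ} {γ₁ γ₂ : ℕ → ℝ}
    (hγ₁ : ∀ j, 0 < γ₁ j) (hγ₂ : ∀ j, 0 < γ₂ j)
    (hw : Summable fun kl : Freq s t => weight b α β γ₁ γ₂ kl)
    {N : ℕ} (hN : N ≠ 0) {pts : ℕ → Pt s t} (hpts : ∀ v, pts v ∈ cube s t) :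
    intError b α β γ₁ γ₂ N pts ^ 2 + 1 = energy b α β γ₁ γ₂ N pts := by
  have hb := (Fact.out : b.Prime).one_lt
  have hwpos (kl : Freq s t) : 0 < weight b α β γ₁ γ₂ kl := weight_pos hb hγ₁ hγ₂ kl
  have hn (kl : Freq s t) : 0 ≤ weight b α β γ₁ γ₂ kl *
      ‖if kl = 0 then 0 else nodeMean b N pts kl‖ ^ 2 :=
    mul_nonneg (hwpos kl).le (sq_nonneg _)
  have hs : Summable fun kl : Freq s t => weight b α β γ₁ γ₂ kl *
      ‖if kl = 0 then 0 else nodeMean b N pts kl‖ ^ 2 := by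
    refine Summable.of_nonneg_of_le hn (fun kl => ?_) hw
    refine mul_le_of_le_one_right (hwpos kl).le (pow_le_one₀ (norm_nonneg _) ?_)
    split_ifs
    · simp
    · exact norm_nodeMean_le_one N pts kl
  have h1 : intError b α β γ₁ γ₂ N pts ^ 2 = ∑' kl : Freq s t, ENNReal.ofReal
      (weight b α β γ₁ γ₂ kl * ‖if kl = 0 then 0 else nodeMean b N pts kl‖ ^ 2) := by
    rw [intError_eq hγ₁ hγ₂ hw hN hpts, ← ENNReal.ofReal_pow (Real.sqrt_nonneg _),
      Real.sq_sqrt (tsum_nonneg hn), ENNReal.ofReal_tsum_of_nonneg hn hs]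
  have h2 : energy b α β γ₁ γ₂ N pts = _ := ENNReal.tsum_eq_add_tsum_ite 0
  rw [h1, h2, weight_zero, nodeMean_zero hN, add_comm]
  refine congrArg₂ _ (by simp) (tsum_congr fun kl => ?_)
  split_ifs
  · simp
  · rw [ENNReal.ofReal_mul (hwpos kl).le, ENNReal.ofReal_pow (norm_nonneg _), ofReal_norm]

end

section

/-! ### Sums of weights -/

variable {b s t : ℕ}

theorem tsum_pi_prod {ι : Type*} (a : ℕ → ι → ℝ≥0∞) (s : ℕ) :
    ∑' k : Fin s → ι, ∏ j : Fin s, a j (k j) = ∏ j ∈ Finset.range s, ∑' i, a j i := by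
  induction s with
  | zero => simp
  | succ s ih =>
    rw [← (Fin.snocEquiv fun _ : Fin (s + 1) => ι).tsum_eq, Finset.prod_range_succ, ← ih]
    have h (c : ι × (Fin s → ι)) : ∏ j : Fin (s + 1), a j (Fin.snocEquiv (fun _ : Fin (s + 1) => ι) c j) =
        (fun x (k : Fin s → ι) => (∏ j : Fin s, a j (k j)) * a s x) c.1 c.2 := by
      simp [Fin.prod_univ_castSucc, Fin.snocEquiv]
    rw [tsum_congr h, ENNReal.tsum_prod (f := fun x (k : Fin s → ι) =>
      (∏ j : Fin s, a j (k j)) * a s x)]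
    simp_rw [ENNReal.tsum_mul_right, ENNReal.tsum_mul_left]

theorem tsum_freq_prod (A : ℕ → ℕ → ℝ≥0∞) (B : ℕ → ℤ → ℝ≥0∞) (s t : ℕ) :
    ∑' kl : Freq s t, (∏ j : Fin s, A j (kl.1 j)) * ∏ j : Fin t, B j (kl.2 j) =
      (∏ j ∈ Finset.range s, ∑' i, A j i) * ∏ j ∈ Finset.range t, ∑' i, B j i := by
  rw [← tsum_pi_prod, ← tsum_pi_prod, ENNReal.tsum_prod (f := fun (k : Fin s → ℕ)
    (l : Fin t → ℤ) => (∏ j : Fin s, A j (k j)) * ∏ j : Fin t, B j (l j))]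
  simp_rw [ENNReal.tsum_mul_left, ENNReal.tsum_mul_right]

theorem hasSum_zeta {x : ℝ} (hx : 1 < x) : HasSum (fun n : ℕ => ((n : ℝ) + 1) ^ (-x)) (zeta x) := by
  have hs : Summable fun n : ℕ => ((n : ℝ) + 1) ^ (-x) := by
    have := (Real.summable_nat_rpow (p := -x)).mpr (by linarith)
    have := (summable_nat_add_iff 1).mpr this
    simpa using this
  have h : zeta x = ∑' n : ℕ, ((n : ℝ) + 1) ^ (-x) := by
    rw [zeta, zeta_eq_tsum_one_div_nat_add_one_cpow (by simpa using hx)]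
    have (n : ℕ) : 1 / ((n : ℂ) + 1) ^ (x : ℂ) = ((((n : ℝ) + 1) ^ (-x) : ℝ) : ℂ) := by
      rw [Real.rpow_neg (by positivity), Complex.ofReal_inv, Complex.ofReal_cpow (by positivity)]
      push_cast
      rw [one_div]
    simp_rw [this]
    rw [← Complex.ofReal_tsum, Complex.ofReal_re]
  rw [h]
  exact hs.hasSum

theorem tsum_zeta {x : ℝ} (hx : 1 < x) :
    ∑' n : ℕ, ENNReal.ofReal (((n : ℝ) + 1) ^ (-x)) = ENNReal.ofReal (zeta x) := by
  rw [← (hasSum_zeta hx).tsum_eq,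
    ENNReal.ofReal_tsum_of_nonneg (fun n => by positivity) (hasSum_zeta hx).summable]

theorem zeta_pos {x : ℝ} (hx : 1 < x) : 0 < zeta x := by
  have := (hasSum_zeta hx).summable.sum_le_tsum {0} (fun n _ => by positivity)
  rw [(hasSum_zeta hx).tsum_eq] at this
  simp at this
  linarith

theorem tsum_int_zeta {x : ℝ} (hx : 1 < x) :
    ∑' l : ℤ, (if l = 0 then 0 else ENNReal.ofReal (|(l : ℝ)| ^ (-x))) =
      ENNReal.ofReal (2 * zeta x) := by
  rw [tsum_of_nat_of_neg_add_one ENNReal.summable ENNReal.summable,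
    tsum_eq_zero_add' ENNReal.summable, two_mul,
    ENNReal.ofReal_add (zeta_pos hx).le (zeta_pos hx).le, ← tsum_zeta hx]
  congr 1
  · rw [if_pos (by simp), zero_add]
    refine tsum_congr fun n => ?_
    rw [if_neg (by omega)]
    push_cast
    rw [abs_of_pos (by positivity)]
  · refine tsum_congr fun n => ?_
    rw [if_neg (by omega)]
    push_cast
    rw [abs_neg, abs_of_pos (by positivity)]

/-- Substituting l = d l' extracts the factor d^(-β). -/
theorem tsum_r_dvd {β γ : ℝ} (hβ : 1 < β) (hγ : 0 < γ) {d : ℕ} (hd : 0 < d) :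
    ∑' l : ℤ, (if l ≠ 0 ∧ (d : ℤ) ∣ l then ENNReal.ofReal (r β γ l) else 0) =
      ENNReal.ofReal (2 * γ * zeta β * (d : ℝ) ^ (-β)) := by
  have hinj : Function.Injective fun l : ℤ => (d : ℤ) * l :=
    mul_right_injective₀ (by exact_mod_cast hd.ne')
  rw [← hinj.tsum_eq (f := fun l : ℤ =>
    if l ≠ 0 ∧ (d : ℤ) ∣ l then ENNReal.ofReal (r β γ l) else 0)]
  · have h : 2 * γ * zeta β * (d : ℝ) ^ (-β) = γ * (d : ℝ) ^ (-β) * (2 * zeta β) := by ring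
    rw [h, ENNReal.ofReal_mul (by positivity), ← tsum_int_zeta hβ, ← ENNReal.tsum_mul_left]
    refine tsum_congr fun l => ?_
    by_cases hl : l = 0
    · simp [hl]
    · have hd' : (d : ℤ) ≠ 0 := by exact_mod_cast hd.ne'
      have hne : (d : ℤ) * l ≠ 0 := mul_ne_zero hd' hl
      rw [if_pos ⟨hne, dvd_mul_right _ _⟩, if_neg hl, ← ENNReal.ofReal_mul (by positivity), r,
        if_neg hne]
      push_cast
      rw [abs_mul, Nat.abs_cast, Real.mul_rpow (by positivity) (abs_nonneg _), mul_assoc]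
  · intro l hl
    have : l ≠ 0 ∧ (d : ℤ) ∣ l := by
      by_contra h
      simp [h] at hl
    obtain ⟨c, hc⟩ := this.2
    exact ⟨c, hc.symm⟩

theorem tsum_r_ne_zero {β γ : ℝ} (hβ : 1 < β) (hγ : 0 < γ) :
    ∑' l : ℤ, (if l ≠ 0 then ENNReal.ofReal (r β γ l) else 0) =
      ENNReal.ofReal (2 * γ * zeta β) := by
  have := tsum_r_dvd hβ hγ (d := 1) one_pos
  simpa using this

theorem rpow_one_sub_lt_one (hb : 1 < b) {α : ℝ} (hα : 1 < α) : (b : ℝ) ^ (1 - α) < 1 :=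
  Real.rpow_lt_one_of_one_lt_of_neg (by exact_mod_cast hb) (by linarith)

theorem mu_eq (hb : 1 < b) {α : ℝ} (hα : 1 < α) :
    mu b α = ((b : ℝ) - 1) / (1 - (b : ℝ) ^ (1 - α)) := by
  have hb' : (0 : ℝ) < b := by positivity
  have h := rpow_one_sub_lt_one hb hα
  have h2 : (b : ℝ) ^ (1 - α) * (b : ℝ) ^ α = b := by
    rw [← Real.rpow_add hb', sub_add_cancel, Real.rpow_one]
  have h3 : 0 < (b : ℝ) ^ α := by positivity
  have h4 : (b : ℝ) ^ α - b = (b : ℝ) ^ α * (1 - (b : ℝ) ^ (1 - α)) := by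
    rw [mul_sub, mul_one, mul_comm _ ((b : ℝ) ^ (1 - α)), h2]
  rw [mu, h4, mul_div_mul_left _ _ h3.ne']

theorem mu_pos (hb : 1 < b) {α : ℝ} (hα : 1 < α) : 0 < mu b α := by
  rw [mu_eq hb hα]
  have hb' : (1 : ℝ) < b := by exact_mod_cast hb
  exact div_pos (by linarith) (by linarith [rpow_one_sub_lt_one hb hα])

/-- On the block b^a ≤ k < b^(a+1) the logarithm is constant. The block has (b - 1) b^a elements,
which leaves a geometric series of ratio b^(1-α). -/
theorem sum_range_pow_rpow_log_le (hb : 1 < b) {α : ℝ} (hα : 1 < α) (n : ℕ) :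
    ∑ k ∈ Finset.range (b ^ n), (if k = 0 then 0 else (b : ℝ) ^ (-(α * (Nat.log b k : ℝ)))) ≤
      mu b α := by
  set q : ℝ := (b : ℝ) ^ (1 - α) with hq
  have hq1 : q < 1 := rpow_one_sub_lt_one hb hα
  have hb' : (0 : ℝ) < b := by positivity
  have hq0 : 0 < q := by positivity
  have hb1 : (1 : ℝ) < b := by exact_mod_cast hb
  have key : ∑ k ∈ Finset.range (b ^ n), (if k = 0 then 0 else (b : ℝ) ^ (-(α * (Nat.log b k : ℝ))))
      = (b - 1) * ∑ a ∈ Finset.range n, q ^ a := by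
    induction n with
    | zero => simp
    | succ n ih =>
      rw [← Finset.sum_range_add_sum_Ico _ (Nat.pow_le_pow_right (by omega) (Nat.le_succ n)), ih,
        Finset.sum_range_succ, mul_add]
      congr 1
      have h (k : ℕ) (hk : k ∈ Finset.Ico (b ^ n) (b ^ (n + 1))) :
          (if k = 0 then 0 else (b : ℝ) ^ (-(α * (Nat.log b k : ℝ)))) = (b : ℝ) ^ (-(α * n)) := by
        rw [Finset.mem_Ico] at hk
        have : 0 < b ^ n := by positivity
        rw [if_neg (by omega), Nat.log_eq_of_pow_le_of_lt_pow hk.1 hk.2]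
      rw [Finset.sum_congr rfl h, Finset.sum_const, Nat.card_Ico, nsmul_eq_mul,
        Nat.cast_sub (Nat.pow_le_pow_right (by omega) (Nat.le_succ n)), hq, ← Real.rpow_natCast,
        ← Real.rpow_mul hb'.le]
      push_cast
      have h5 : (b : ℝ) ^ ((1 - α) * n) = (b : ℝ) ^ n * (b : ℝ) ^ (-(α * n)) := by
        rw [← Real.rpow_natCast, ← Real.rpow_add hb']
        congr 1; ring
      rw [h5, Nat.succ_eq_add_one]; ring
  rw [key, mu_eq hb hα, div_eq_mul_inv]
  refine mul_le_mul_of_nonneg_left ?_ (by linarith)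
  rw [← tsum_geometric_of_lt_one hq0.le hq1]
  exact (summable_geometric_of_lt_one hq0.le hq1).sum_le_tsum _ fun _ _ => by positivity

theorem rho_eq_mul {α γ : ℝ} {k : ℕ} (hk : k ≠ 0) :
    rho b α γ k = γ * (b : ℝ) ^ (-(α * (Nat.log b k : ℝ))) := by simp [rho, hk]

theorem tsum_rho_ne_zero_le (hb : 1 < b) {α γ : ℝ} (hα : 1 < α) (hγ : 0 < γ) :
    ∑' k : ℕ, (if k ≠ 0 then ENNReal.ofReal (rho b α γ k) else 0) ≤
      ENNReal.ofReal (γ * mu b α) := by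
  refine ENNReal.tsum_le_of_sum_range_le fun n => ?_
  have h (k : ℕ) : (if k ≠ 0 then ENNReal.ofReal (rho b α γ k) else 0) =
      ENNReal.ofReal (γ * if k = 0 then 0 else (b : ℝ) ^ (-(α * (Nat.log b k : ℝ)))) := by
    by_cases hk : k = 0
    · simp [hk]
    · simp [hk, rho_eq_mul hk]
  have hn (k : ℕ) : 0 ≤ γ * if k = 0 then 0 else (b : ℝ) ^ (-(α * (Nat.log b k : ℝ))) := by
    split_ifs <;> positivity
  simp_rw [h]
  rw [← ENNReal.ofReal_sum_of_nonneg fun k _ => hn k]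
  refine ENNReal.ofReal_le_ofReal ?_
  refine (Finset.sum_le_sum_of_subset_of_nonneg
    (Finset.range_mono (Nat.lt_pow_self hb (n := n)).le) fun k _ _ => hn k).trans ?_
  rw [← Finset.mul_sum]
  exact mul_le_mul_of_nonneg_left (sum_range_pow_rpow_log_le hb hα n) hγ.le

/-- Multiplication by b^m raises the integer logarithm by exactly m, hence the factor b^(-αm). -/
theorem tsum_rho_dvd_le (hb : 1 < b) {α γ : ℝ} (hα : 1 < α) (hγ : 0 < γ) (m : ℕ) :
    ∑' k : ℕ, (if k ≠ 0 ∧ b ^ m ∣ k then ENNReal.ofReal (rho b α γ k) else 0) ≤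
      ENNReal.ofReal (γ * mu b α * ((b ^ m : ℕ) : ℝ) ^ (-α)) := by
  have hbm : b ^ m ≠ 0 := by positivity
  have hb' : (0 : ℝ) < b := by positivity
  have hinj : Function.Injective fun l : ℕ => b ^ m * l := mul_right_injective₀ hbm
  rw [← hinj.tsum_eq (f := fun k : ℕ =>
    if k ≠ 0 ∧ b ^ m ∣ k then ENNReal.ofReal (rho b α γ k) else 0)]
  · rw [mul_comm (γ * mu b α), ENNReal.ofReal_mul (by positivity)]
    refine le_trans (le_of_eq ?_) (mul_le_mul_right (tsum_rho_ne_zero_le hb hα hγ) _)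
    rw [← ENNReal.tsum_mul_left]
    refine tsum_congr fun k => ?_
    by_cases hk : k = 0
    · simp [hk]
    · have hne : b ^ m * k ≠ 0 := mul_ne_zero hbm hk
      rw [if_pos ⟨hne, dvd_mul_right _ _⟩, if_pos hk, ← ENNReal.ofReal_mul (by positivity),
        rho_eq_mul hne, rho_eq_mul hk]
      have hlog : Nat.log b (b ^ m * k) = m + Nat.log b k := by
        refine Nat.log_eq_of_pow_le_of_lt_pow ?_ ?_
        · rw [pow_add]
          exact Nat.mul_le_mul_left _ (Nat.pow_log_le_self b hk)
        · rw [add_assoc, pow_add]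
          exact Nat.mul_lt_mul_of_pos_left (Nat.lt_pow_succ_log_self hb k) (by positivity)
      rw [hlog]
      push_cast
      rw [← Real.rpow_natCast, ← Real.rpow_mul hb'.le, mul_left_comm, ← Real.rpow_add hb']
      congr 3
      ring
  · intro l hl
    have : l ≠ 0 ∧ b ^ m ∣ l := by
      by_contra h
      simp [h] at hl
    obtain ⟨c, hc⟩ := this.2
    exact ⟨c, hc.symm⟩

theorem ofReal_weight {α β : ℝ} {γ₁ γ₂ : ℕ → ℝ} (hb : 1 < b)
    (hγ₁ : ∀ j, 0 < γ₁ j) (hγ₂ : ∀ j, 0 < γ₂ j) (kl : Freq s t) :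
    ENNReal.ofReal (weight b α β γ₁ γ₂ kl) =
      (∏ j : Fin s, ENNReal.ofReal (rho b α (γ₁ j) (kl.1 j))) *
        ∏ j : Fin t, ENNReal.ofReal (r β (γ₂ j) (kl.2 j)) := by
  have h1 (j : Fin s) : 0 ≤ rho b α (γ₁ j) (kl.1 j) := (rho_pos hb (hγ₁ j) _).le
  have h2 (j : Fin t) : 0 ≤ r β (γ₂ j) (kl.2 j) := (r_pos (hγ₂ j) _).le
  rw [weight, ENNReal.ofReal_mul (Finset.prod_nonneg fun j _ => h1 j),
    ENNReal.ofReal_prod_of_nonneg fun j _ => h1 j, ENNReal.ofReal_prod_of_nonneg fun j _ => h2 j]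

theorem tsum_weight_le {α β : ℝ} {γ₁ γ₂ : ℕ → ℝ} (hb : 1 < b) (hα : 1 < α) (hβ : 1 < β)
    (hγ₁ : ∀ j, 0 < γ₁ j) (hγ₂ : ∀ j, 0 < γ₂ j) :
    ∑' kl : Freq s t, ENNReal.ofReal (weight b α β γ₁ γ₂ kl) ≤
      ENNReal.ofReal ((∏ j ∈ Finset.range s, (1 + γ₁ j * mu b α)) *
        ∏ j ∈ Finset.range t, (1 + 2 * γ₂ j * zeta β)) := by
  have hμ := mu_pos hb hα
  have hζ := zeta_pos hβ
  have h1 (j : ℕ) : 0 ≤ 1 + γ₁ j * mu b α := by have := hγ₁ j; positivity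
  have h2 (j : ℕ) : 0 ≤ 1 + 2 * γ₂ j * zeta β := by have := hγ₂ j; positivity
  simp_rw [ofReal_weight hb hγ₁ hγ₂]
  rw [tsum_freq_prod (fun j k => ENNReal.ofReal (rho b α (γ₁ j) k))
    fun j l => ENNReal.ofReal (r β (γ₂ j) l), ENNReal.ofReal_mul (Finset.prod_nonneg fun j _ => h1 j),
    ENNReal.ofReal_prod_of_nonneg fun j _ => h1 j, ENNReal.ofReal_prod_of_nonneg fun j _ => h2 j]
  gcongr with j _ j _
  · rw [ENNReal.tsum_eq_add_tsum_ite 0, ENNReal.ofReal_add zero_le_one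
      (mul_nonneg (hγ₁ j).le hμ.le)]
    refine add_le_add (by simp [rho]) (le_trans (le_of_eq ?_) (tsum_rho_ne_zero_le hb hα (hγ₁ j)))
    exact tsum_congr fun k => by split_ifs <;> simp_all
  · rw [ENNReal.tsum_eq_add_tsum_ite 0, ENNReal.ofReal_add zero_le_one
      (by have := hγ₂ j; positivity)]
    refine add_le_add (by simp [r]) (le_trans (le_of_eq ?_) (tsum_r_ne_zero hβ (hγ₂ j)).le)
    exact tsum_congr fun k => by split_ifs <;> simp_all

theorem summable_weight {α β : ℝ} {γ₁ γ₂ : ℕ → ℝ} (hb : 1 < b) (hα : 1 < α) (hβ : 1 < β)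
    (hγ₁ : ∀ j, 0 < γ₁ j) (hγ₂ : ∀ j, 0 < γ₂ j) :
    Summable fun kl : Freq s t => weight b α β γ₁ γ₂ kl := by
  have h := ENNReal.summable_toReal
    (ne_top_of_le_ne_top ENNReal.ofReal_ne_top (tsum_weight_le (s := s) (t := t) hb hα hβ hγ₁ hγ₂))
  refine h.congr fun kl => ?_
  exact ENNReal.toReal_ofReal (weight_pos hb hγ₁ hγ₂ kl).le

/-! ### The size of the index set -/

/-- From k < b^(⌊log_b k⌋+1) one gets ρ(k) ≤ b^α γ k^(-α) ≤ b^α γ k^(-θ). This is the source of b^α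
in the constant, and it reduces the sum to a zeta value. -/
theorem tsum_rho_rpow_le (hb : 1 < b) {α θ γ κ : ℝ} (hα : 1 < α) (hθ : θ ≤ α) (hκ : 0 < κ)
    (hθκ : 1 < θ * κ) (hγ : 0 < γ) :
    ∑' k : ℕ, ENNReal.ofReal (rho b α γ k) ^ κ ≤
      ENNReal.ofReal (1 + 2 * zeta (θ * κ) * ((b : ℝ) ^ α * γ) ^ κ) := by
  have hb' : (0 : ℝ) < b := by positivity
  have hb1 : (1 : ℝ) ≤ b := by exact_mod_cast hb.le
  have hζ := zeta_pos hθκ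
  have hX : 0 ≤ ((b : ℝ) ^ α * γ) ^ κ := by positivity
  rw [tsum_eq_zero_add' ENNReal.summable]
  have h0 : ENNReal.ofReal (rho b α γ 0) ^ κ = ENNReal.ofReal 1 := by simp [rho]
  have hk (k : ℕ) : ENNReal.ofReal (rho b α γ (k + 1)) ^ κ ≤
      ENNReal.ofReal (((b : ℝ) ^ α * γ) ^ κ) * ENNReal.ofReal (((k : ℝ) + 1) ^ (-(θ * κ))) := by
    have hk1 : (1 : ℝ) ≤ (k : ℝ) + 1 := by linarith [Nat.cast_nonneg (α := ℝ) k]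
    rw [ENNReal.ofReal_rpow_of_nonneg (rho_pos hb hγ _).le hκ.le, ← ENNReal.ofReal_mul hX]
    refine ENNReal.ofReal_le_ofReal ?_
    have h1 : rho b α γ (k + 1) ≤ (b : ℝ) ^ α * γ * ((k : ℝ) + 1) ^ (-θ) := by
      rw [rho_eq_mul (Nat.succ_ne_zero k)]
      have hlt : (k : ℝ) + 1 ≤ (b : ℝ) ^ (Nat.log b (k + 1) + 1) := by
        exact_mod_cast (Nat.lt_pow_succ_log_self hb (k + 1)).le
      have h2 : ((b : ℝ) ^ (Nat.log b (k + 1) + 1)) ^ (-α) ≤ ((k : ℝ) + 1) ^ (-α) :=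
        Real.rpow_le_rpow_of_nonpos (by positivity) hlt (by linarith)
      have h3 : ((k : ℝ) + 1) ^ (-α) ≤ ((k : ℝ) + 1) ^ (-θ) :=
        Real.rpow_le_rpow_of_exponent_le hk1 (by linarith)
      have h4 : (b : ℝ) ^ (-(α * (Nat.log b (k + 1) : ℝ))) =
          (b : ℝ) ^ α * ((b : ℝ) ^ (Nat.log b (k + 1) + 1)) ^ (-α) := by
        rw [← Real.rpow_natCast, ← Real.rpow_mul hb'.le, ← Real.rpow_add hb']
        congr 1; push_cast; ring
      rw [h4]
      calc γ * ((b : ℝ) ^ α * ((b : ℝ) ^ (Nat.log b (k + 1) + 1)) ^ (-α))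
          = (b : ℝ) ^ α * γ * ((b : ℝ) ^ (Nat.log b (k + 1) + 1)) ^ (-α) := by ring
        _ ≤ _ := mul_le_mul_of_nonneg_left (h2.trans h3) (by positivity)
    refine (Real.rpow_le_rpow (rho_pos hb hγ _).le h1 hκ.le).trans_eq ?_
    rw [Real.mul_rpow (by positivity) (by positivity), ← Real.rpow_mul (by positivity), neg_mul]
  rw [h0, ENNReal.ofReal_add zero_le_one (by positivity)]
  refine add_le_add le_rfl ((ENNReal.tsum_le_tsum hk).trans ?_)
  rw [ENNReal.tsum_mul_left, tsum_zeta hθκ, ← ENNReal.ofReal_mul hX]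
  refine ENNReal.ofReal_le_ofReal ?_
  -- Only positive integers are summed here, so one zeta value suffices; the factor 2 is slack.
  nlinarith [mul_nonneg hX hζ.le]

theorem tsum_r_rpow_le {β θ γ κ : ℝ} (hθ : θ ≤ β) (hκ : 0 < κ)
    (hθκ : 1 < θ * κ) (hγ : 0 < γ) :
    ∑' l : ℤ, ENNReal.ofReal (r β γ l) ^ κ ≤
      ENNReal.ofReal (1 + 2 * zeta (θ * κ) * γ ^ κ) := by
  have hζ := zeta_pos hθκ
  have hX : 0 ≤ γ ^ κ := by positivity
  rw [ENNReal.tsum_eq_add_tsum_ite 0]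
  have h0 : ENNReal.ofReal (r β γ 0) ^ κ = ENNReal.ofReal 1 := by simp [r]
  have hk (l : ℤ) : (if l = 0 then 0 else ENNReal.ofReal (r β γ l) ^ κ) ≤
      ENNReal.ofReal (γ ^ κ) * if l = 0 then 0 else ENNReal.ofReal (|(l : ℝ)| ^ (-(θ * κ))) := by
    split_ifs with hl
    · simp
    have hl1 : (1 : ℝ) ≤ |(l : ℝ)| := by exact_mod_cast Int.one_le_abs hl
    rw [ENNReal.ofReal_rpow_of_nonneg (r_pos hγ _).le hκ.le, ← ENNReal.ofReal_mul hX]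
    refine ENNReal.ofReal_le_ofReal ?_
    have h1 : r β γ l ≤ γ * |(l : ℝ)| ^ (-θ) := by
      rw [r, if_neg hl]
      exact mul_le_mul_of_nonneg_left
        (Real.rpow_le_rpow_of_exponent_le hl1 (by linarith)) hγ.le
    refine (Real.rpow_le_rpow (r_pos hγ _).le h1 hκ.le).trans_eq ?_
    rw [Real.mul_rpow hγ.le (by positivity), ← Real.rpow_mul (abs_nonneg _), neg_mul]
  rw [h0, ENNReal.ofReal_add zero_le_one (by positivity)]
  refine add_le_add le_rfl (le_trans (le_of_eq (tsum_congr fun l => ?_))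
    ((ENNReal.tsum_le_tsum hk).trans_eq ?_))
  · split_ifs <;> rfl
  rw [ENNReal.tsum_mul_left, tsum_int_zeta hθκ, ← ENNReal.ofReal_mul hX, mul_comm]

theorem tsum_weight_rpow_le {α β : ℝ} {γ₁ γ₂ : ℕ → ℝ} (hb : 1 < b) (hα : 1 < α)
    {κ : ℝ} (hκ : 0 < κ) (hθκ : 1 < min α β * κ)
    (hγ₁ : ∀ j, 0 < γ₁ j) (hγ₂ : ∀ j, 0 < γ₂ j) :
    ∑' kl : Freq s t, ENNReal.ofReal (weight b α β γ₁ γ₂ kl) ^ κ ≤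
      ENNReal.ofReal
        ((∏ j ∈ Finset.range s, (1 + 2 * zeta (min α β * κ) * ((b : ℝ) ^ α * γ₁ j) ^ κ)) *
          ∏ j ∈ Finset.range t, (1 + 2 * zeta (min α β * κ) * (γ₂ j) ^ κ)) := by
  have hζ := zeta_pos hθκ
  have h1 (j : ℕ) : 0 ≤ 1 + 2 * zeta (min α β * κ) * ((b : ℝ) ^ α * γ₁ j) ^ κ := by
    have := hγ₁ j; positivity
  have h2 (j : ℕ) : 0 ≤ 1 + 2 * zeta (min α β * κ) * (γ₂ j) ^ κ := by
    have := hγ₂ j; positivity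
  simp_rw [ofReal_weight hb hγ₁ hγ₂, ENNReal.mul_rpow_of_nonneg _ _ hκ.le,
    ← ENNReal.prod_rpow_of_nonneg hκ.le]
  rw [tsum_freq_prod (fun j k => ENNReal.ofReal (rho b α (γ₁ j) k) ^ κ)
    fun j l => ENNReal.ofReal (r β (γ₂ j) l) ^ κ,
    ENNReal.ofReal_mul (Finset.prod_nonneg fun j _ => h1 j),
    ENNReal.ofReal_prod_of_nonneg fun j _ => h1 j, ENNReal.ofReal_prod_of_nonneg fun j _ => h2 j]
  exact mul_le_mul' (Finset.prod_le_prod' fun j _ =>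
      tsum_rho_rpow_le hb hα (min_le_left _ _) hκ hθκ (hγ₁ j))
    (Finset.prod_le_prod' fun j _ => tsum_r_rpow_le (min_le_right _ _) hκ hθκ (hγ₂ j))

end

section

/-! ### Parseval's inequality for orthogonal families of unimodular sequences -/

/-- Expanding the square, the off-diagonal terms vanish, and each of the N diagonal terms equals N,
against the prefactor N^(-2). Only |c_v| = 1 enters, so the earlier components play no role. -/
theorem sum_normSq_mean_eq_one {ι : Type*} (W : Finset ι) {N : ℕ} (hN : N ≠ 0) (E : ℕ → ι → ℂ)
    (hE : ∀ v < N, ∀ v' < N, ∑ w ∈ W, E v w * (starRingEnd ℂ) (E v' w) = if v = v' then (N : ℂ) else 0)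
    {c : ℕ → ℂ} (hc : ∀ v, ‖c v‖ = 1) :
    ∑ w ∈ W, ‖(1 / (N : ℂ)) * ∑ v ∈ Finset.range N, c v * E v w‖ₑ ^ 2 = 1 := by
  have hN' : (N : ℂ) ≠ 0 := by exact_mod_cast hN
  have hreal : ∑ w ∈ W, ‖(1 / (N : ℂ)) * ∑ v ∈ Finset.range N, c v * E v w‖ ^ 2 = 1 := by
    have h (w : ι) : ((‖(1 / (N : ℂ)) * ∑ v ∈ Finset.range N, c v * E v w‖ ^ 2 : ℝ) : ℂ) =
        (1 / (N : ℂ)) ^ 2 * ∑ v ∈ Finset.range N, ∑ v' ∈ Finset.range N,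
          c v * (starRingEnd ℂ) (c v') * (E v w * (starRingEnd ℂ) (E v' w)) := by
      push_cast
      rw [← Complex.mul_conj']
      simp only [map_mul, map_sum, map_div₀, map_one, map_natCast]
      rw [mul_mul_mul_comm, Finset.sum_mul_sum, pow_two]
      congr 1
      exact Finset.sum_congr rfl fun v _ => Finset.sum_congr rfl fun v' _ => by ring
    have h1 : ((∑ w ∈ W, ‖(1 / (N : ℂ)) * ∑ v ∈ Finset.range N, c v * E v w‖ ^ 2 : ℝ) : ℂ) = 1 := by
      rw [Complex.ofReal_sum, Finset.sum_congr rfl fun w _ => h w, ← Finset.mul_sum,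
        Finset.sum_comm]
      have h2 : ∀ v ∈ Finset.range N, ∑ w ∈ W, ∑ v' ∈ Finset.range N,
          c v * (starRingEnd ℂ) (c v') * (E v w * (starRingEnd ℂ) (E v' w)) = N := by
        intro v hv
        rw [Finset.sum_comm]
        have h3 : ∀ v' ∈ Finset.range N, ∑ w ∈ W,
            c v * (starRingEnd ℂ) (c v') * (E v w * (starRingEnd ℂ) (E v' w)) =
            if v = v' then (N : ℂ) else 0 := by
          intro v' hv'
          rw [← Finset.mul_sum, hE v (Finset.mem_range.mp hv) v' (Finset.mem_range.mp hv')]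
          split_ifs with hvv
          · rw [← hvv, Complex.mul_conj', hc]; simp
          · simp
        rw [Finset.sum_congr rfl h3]
        simp only [Finset.sum_ite_eq, hv, if_true]
      rw [Finset.sum_congr rfl h2]
      simp only [Finset.sum_const, Finset.card_range, nsmul_eq_mul]
      field_simp
    exact_mod_cast h1
  have h := congrArg ENNReal.ofReal hreal
  rw [ENNReal.ofReal_sum_of_nonneg fun _ _ => sq_nonneg _, ENNReal.ofReal_one] at h
  rw [← h]
  exact Finset.sum_congr rfl fun w _ => by rw [ENNReal.ofReal_pow (norm_nonneg _), ofReal_norm]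

/-! ### Laurent coefficients of rational functions -/

variable {b m : ℕ} [Fact b.Prime]

theorem coeff_polyToLaurent (p : (ZMod b)[X]) (n : ℤ) :
    (polyToLaurent b p).coeff n = if n ≤ 0 then p.coeff (-n).toNat else 0 := by
  unfold polyToLaurent
  induction p using Polynomial.induction_on' with
  | add p q hp hq =>
    rw [map_add, HahnSeries.coeff_add, hp, hq]
    split_ifs <;> simp
  | monomial i a =>
    rw [Polynomial.aeval_monomial, HahnSeries.single_pow, one_pow,
      HahnSeries.algebraMap_apply', PowerSeries.algebraMap_apply, Algebra.algebraMap_self,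
      RingHom.id_apply, HahnSeries.ofPowerSeries_C, HahnSeries.C_apply,
      HahnSeries.single_mul_single, HahnSeries.coeff_single, Polynomial.coeff_monomial]
    simp only [nsmul_eq_mul, zero_add, mul_one, mul_neg]
    split_ifs <;> first | rfl | omega

theorem polyToLaurent_ne_zero {p : (ZMod b)[X]} (hp : p ≠ 0) : polyToLaurent b p ≠ 0 := by
  intro h
  refine hp (Polynomial.ext fun n => ?_)
  have := coeff_polyToLaurent p (-(n : ℤ))
  rw [h] at this
  simpa using this.symm

theorem order_polyToLaurent {p : (ZMod b)[X]} (hp : p ≠ 0) :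
    (polyToLaurent b p).order = -(p.natDegree : ℤ) := by
  have h0 := polyToLaurent_ne_zero hp
  apply le_antisymm
  · refine HahnSeries.order_le_of_coeff_ne_zero ?_
    rw [coeff_polyToLaurent]
    simpa using hp
  · have h := HahnSeries.coeff_order_eq_zero.not.mpr h0
    rw [coeff_polyToLaurent] at h
    split_ifs at h with hle
    · have := Polynomial.le_natDegree_of_ne_zero h
      omega
    · exact absurd rfl h

/-- The coefficient of `x^(-(i+1))` in the Laurent expansion of `p / f`. -/
def quotCoeff (b : ℕ) [Fact b.Prime] (f p : (ZMod b)[X]) (i : ℕ) : ZMod b :=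
  HahnSeries.coeff (polyToLaurent b p / polyToLaurent b f) ((i + 1 : ℕ) : ℤ)

theorem quotCoeff_add (f p q : (ZMod b)[X]) (i : ℕ) :
    quotCoeff b f (p + q) i = quotCoeff b f p i + quotCoeff b f q i := by
  simp only [quotCoeff, polyToLaurent, map_add, add_div, HahnSeries.coeff_add]

theorem quotCoeff_mul_self {f : (ZMod b)[X]} (hf : f ≠ 0) (q : (ZMod b)[X]) (i : ℕ) :
    quotCoeff b f (f * q) i = 0 := by
  have h : polyToLaurent b (f * q) = polyToLaurent b f * polyToLaurent b q := by
    simp [polyToLaurent]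
  rw [quotCoeff, h, mul_div_cancel_left₀ _ (polyToLaurent_ne_zero hf), coeff_polyToLaurent,
    if_neg (by omega)]

theorem quotCoeff_zero (f : (ZMod b)[X]) (i : ℕ) : quotCoeff b f 0 i = 0 := by
  simp [quotCoeff, polyToLaurent]

theorem quotCoeff_sub (f p q : (ZMod b)[X]) (i : ℕ) :
    quotCoeff b f (p - q) i = quotCoeff b f p i - quotCoeff b f q i := by
  rw [eq_sub_iff_add_eq, ← quotCoeff_add, sub_add_cancel]

/-- If h ≠ 0, the Laurent order of h/f in x⁻¹ is m - deg h, which lies between 1 and m; the leading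
coefficient would be one of those assumed to vanish. -/
theorem eq_zero_of_quotCoeff_eq_zero {f h : (ZMod b)[X]} (hf : f ≠ 0) (hfm : f.natDegree = m)
    (hh : h.degree < m) (h0 : ∀ i < m, quotCoeff b f h i = 0) : h = 0 := by
  by_contra hne
  have hP := polyToLaurent_ne_zero hne
  have hF := polyToLaurent_ne_zero hf
  set L := polyToLaurent b h / polyToLaurent b f with hL
  have hL0 : L ≠ 0 := div_ne_zero hP hF
  have hmul : L * polyToLaurent b f = polyToLaurent b h := div_mul_cancel₀ _ hF
  have hord := congrArg HahnSeries.order hmul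
  rw [HahnSeries.order_mul hL0 hF, order_polyToLaurent hf, order_polyToLaurent hne, hfm] at hord
  have hdeg : h.natDegree < m := (Polynomial.natDegree_lt_iff_degree_lt hne).mpr hh
  have hc := HahnSeries.coeff_order_eq_zero.not.mpr hL0
  have ho : HahnSeries.order L = ((m - h.natDegree - 1 + 1 : ℕ) : ℤ) := by omega
  rw [ho] at hc
  exact hc (h0 (m - h.natDegree - 1) (by omega))

/-! ### Walsh functions at the points of a polynomial lattice -/

/-- Written over the common denominator b^m, the value of ν_m has an integer numerator with the
Laurent coefficients as digits in reverse order; its real digits can then be read off. -/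
theorem nu_eq (L : LaurentSeries (ZMod b)) : nu b m L =
    ((∑ i ∈ Finset.range m, (HahnSeries.coeff L ((m - i : ℕ) : ℤ)).val * b ^ i : ℕ) : ℝ) /
      (b : ℝ) ^ m := by
  have hb : (b : ℝ) ≠ 0 := by exact_mod_cast (Fact.out : b.Prime).ne_zero
  rw [nu, ← Finset.sum_range_reflect]
  push_cast
  have h := Finset.sum_Ico_add' (fun i : ℕ =>
    ((HahnSeries.coeff L (i : ℤ)).val : ℝ) / (b : ℝ) ^ i) 0 m 1
  have h' : Finset.Icc 1 m = Finset.Ico (0 + 1) (m + 1) := by ext; simp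
  rw [h', ← h, Finset.sum_div, ← Finset.range_eq_Ico]
  refine Finset.sum_congr rfl fun i hi => ?_
  rw [Finset.mem_range] at hi
  have h1 : m - (m - 1 - i) = i + 1 := by omega
  have h2 : (b : ℝ) ^ m = (b : ℝ) ^ (m - 1 - i) * (b : ℝ) ^ (i + 1) := by
    rw [← pow_add]; congr 1; omega
  rw [h1, h2]
  field_simp

theorem nu_mem_Ico (L : LaurentSeries (ZMod b)) : nu b m L ∈ Set.Ico (0 : ℝ) 1 := by
  have hb : 0 < b := (Fact.out : b.Prime).pos
  rw [nu_eq]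
  refine ⟨by positivity, ?_⟩
  rw [div_lt_one (by positivity)]
  exact_mod_cast sum_digits_lt _ (fun i => ZMod.val_lt _) m

theorem realDigit_nu (L : LaurentSeries (ZMod b)) (i : ℕ) :
    (realDigit b (nu b m L) (i + 1) : ZMod b) =
      if i < m then HahnSeries.coeff L ((i + 1 : ℕ) : ℤ) else 0 := by
  have hb : b ≠ 0 := (Fact.out : b.Prime).ne_zero
  have hb' : (b : ℝ) ≠ 0 := by exact_mod_cast hb
  rw [nu_eq, realDigit]
  set T := ∑ i ∈ Finset.range m, (HahnSeries.coeff L ((m - i : ℕ) : ℤ)).val * b ^ i with hT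
  split_ifs with h
  · have h1 : (T : ℝ) / (b : ℝ) ^ m * (b : ℝ) ^ (i + 1) = (T : ℝ) / ((b ^ (m - 1 - i) : ℕ) : ℝ) := by
      have : m = (m - 1 - i) + (i + 1) := by omega
      push_cast
      rw [div_mul_eq_mul_div, div_eq_div_iff (by positivity) (by positivity), mul_assoc, ← pow_add]
      congr 2
      omega
    rw [h1, Nat.floor_div_natCast, Nat.floor_natCast]
    have h2 := natDigit_sum (b := b) (fun i => (HahnSeries.coeff L ((m - i : ℕ) : ℤ)).val)
      (fun i => ZMod.val_lt _) m (m - 1 - i)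
    rw [if_pos (by omega), ← hT] at h2
    change ((natDigit b T (m - 1 - i) : ℕ) : ZMod b) = _
    rw [h2, ZMod.natCast_zmod_val]
    congr 2
    omega
  · have h1 : (T : ℝ) / (b : ℝ) ^ m * (b : ℝ) ^ (i + 1) = ((T * b ^ (i + 1 - m) : ℕ) : ℝ) := by
      push_cast
      rw [div_mul_eq_mul_div, div_eq_iff (by positivity), mul_assoc, ← pow_add]
      congr 2
      omega
    rw [h1, Nat.floor_natCast, ZMod.natCast_mod]
    have : i + 1 - m ≠ 0 := by omega
    simp [this]

theorem wal_nu (k : ℕ) (L : LaurentSeries (ZMod b)) :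
    wal b k (nu b m L) = ZMod.stdAddChar (∑ i ∈ Finset.range m,
      HahnSeries.coeff L ((i + 1 : ℕ) : ℤ) * (natDigit b k i : ZMod b)) := by
  have hb := (Fact.out : b.Prime).one_lt
  have hk : k < b ^ (max k m) := (le_max_left k m).trans_lt (Nat.lt_pow_self hb)
  rw [wal_eq_stdAddChar hb hk]
  congr 1
  rw [← Finset.sum_subset (Finset.range_mono (le_max_right k m))]
  · refine Finset.sum_congr rfl fun i hi => ?_
    rw [realDigit_nu, if_pos (Finset.mem_range.mp hi)]
  · intro i _ hi
    rw [realDigit_nu, if_neg (by simpa using hi), zero_mul]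

/-- The value of the `k`-th Walsh function at `ν_m(p / f)`. -/
def walQuot (b m : ℕ) [Fact b.Prime] (f : (ZMod b)[X]) (k : ℕ) (p : (ZMod b)[X]) : ℂ :=
  wal b k (nu b m (polyToLaurent b p / polyToLaurent b f))

theorem walQuot_eq (f : (ZMod b)[X]) (k : ℕ) (p : (ZMod b)[X]) :
    walQuot b m f k p = ZMod.stdAddChar (∑ i ∈ Finset.range m,
      quotCoeff b f p i * (natDigit b k i : ZMod b)) := wal_nu k _

theorem walQuot_eq_one_of_dvd (f : (ZMod b)[X]) {k : ℕ} (hk : b ^ m ∣ k) (p : (ZMod b)[X]) :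
    walQuot b m f k p = 1 := by
  rw [walQuot_eq, Finset.sum_eq_zero, AddChar.map_zero_eq_one]
  intro i hi
  rw [Finset.mem_range] at hi
  obtain ⟨c, rfl⟩ := hk
  have hb := (Fact.out : b.Prime).pos
  have : b ^ m * c = b ^ i * (b * (b ^ (m - i - 1) * c)) := by
    have : m = i + 1 + (m - i - 1) := by omega
    conv_lhs => rw [this, pow_add, pow_succ]
    ring
  rw [natDigit, this, Nat.mul_div_cancel_left _ (by positivity)]
  simp

theorem walQuot_sub (f : (ZMod b)[X]) (k : ℕ) (p q : (ZMod b)[X]) :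
    walQuot b m f k p * (starRingEnd ℂ) (walQuot b m f k q) = walQuot b m f k (p - q) := by
  simp only [walQuot_eq]
  rw [← AddChar.map_neg_eq_conj, ← AddChar.map_add_eq_mul, ← sub_eq_add_neg,
    ← Finset.sum_sub_distrib]
  congr 1
  exact Finset.sum_congr rfl fun i _ => by rw [quotCoeff_sub]; ring

/-! ### Polynomials of degree less than m as digit vectors, and character sums over them -/

/-- The polynomial with given coefficient vector. -/
def polyOfVec (x : Fin m → ZMod b) : (ZMod b)[X] := ∑ i : Fin m, Polynomial.C (x i) * Polynomial.X ^ (i : ℕ)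

theorem polyOfVec_add (x y : Fin m → ZMod b) : polyOfVec (x + y) = polyOfVec x + polyOfVec y := by
  simp [polyOfVec, add_mul, Finset.sum_add_distrib]

theorem coeff_polyOfVec (x : Fin m → ZMod b) (i : Fin m) : (polyOfVec x).coeff i = x i := by
  simp [polyOfVec, Polynomial.coeff_X_pow, Fin.val_inj]

theorem degree_polyOfVec_lt (x : Fin m → ZMod b) : (polyOfVec x).degree < m := by
  refine (Polynomial.degree_sum_le _ _).trans_lt ?_
  refine (Finset.sup_lt_iff (WithBot.bot_lt_coe m)).mpr fun i _ => ?_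
  exact (Polynomial.degree_C_mul_X_pow_le _ _).trans_lt (WithBot.coe_lt_coe.mpr i.2)

theorem exists_polyOfVec_eq {p : (ZMod b)[X]} (hp : p.degree < m) :
    ∃ x : Fin m → ZMod b, polyOfVec x = p := by
  refine ⟨fun i => p.coeff i, ?_⟩
  rw [polyOfVec, Fin.sum_univ_eq_sum_range (fun i => Polynomial.C (p.coeff i) * Polynomial.X ^ i)]
  ext n
  simp only [Polynomial.finsetSum_coeff, Polynomial.coeff_C_mul, Polynomial.coeff_X_pow, mul_ite,
    mul_one, mul_zero, Finset.sum_ite_eq, Finset.mem_range]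
  split_ifs with hn
  · rfl
  · refine (Polynomial.coeff_eq_zero_of_degree_lt (hp.trans_le ?_)).symm
    exact_mod_cast not_lt.mp hn

/-- The vector of the `m` lowest digits. -/
def digitVec (b m w : ℕ) : Fin m → ZMod b := fun i => (natDigit b w i : ZMod b)

theorem polyOfNat_eq (w : ℕ) : polyOfNat b m w = polyOfVec (digitVec b m w) := by
  rw [polyOfNat, polyOfVec]
  exact (Fin.sum_univ_eq_sum_range (fun i => Polynomial.C ((natDigit b w i : ℕ) : ZMod b) *
    Polynomial.X ^ i) m).symm

theorem digitVec_injOn {v w : ℕ} (hv : v < b ^ m) (hw : w < b ^ m)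
    (h : digitVec b m v = digitVec b m w) : v = w := by
  have hb := (Fact.out : b.Prime).one_lt
  refine natDigit_ext hb fun i => ?_
  by_cases hi : i < m
  · exact natDigit_eq_of_cast_eq hb (congrFun h ⟨i, hi⟩)
  · rw [natDigit_eq_zero_of_lt (by omega) hv (not_lt.mp hi),
      natDigit_eq_zero_of_lt (by omega) hw (not_lt.mp hi)]

theorem polyOfNat_injOn {v w : ℕ} (hv : v < b ^ m) (hw : w < b ^ m)
    (h : polyOfNat b m v = polyOfNat b m w) : v = w := by
  refine digitVec_injOn hv hw (funext fun i => ?_)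
  rw [polyOfNat_eq, polyOfNat_eq] at h
  rw [← coeff_polyOfVec (digitVec b m v), h, coeff_polyOfVec]

theorem degree_polyOfNat_lt (w : ℕ) : (polyOfNat b m w).degree < m := by
  rw [polyOfNat_eq]; exact degree_polyOfVec_lt _

theorem polyOfNat_zero : polyOfNat b m 0 = 0 := by simp [polyOfNat, natDigit_zero]

theorem polyOfNat_mem_polyCandidates {w : ℕ} (hw : w ∈ Finset.Ico 1 (b ^ m)) :
    polyOfNat b m w ∈ polyCandidates b m := by
  rw [Finset.mem_Ico] at hw
  refine ⟨fun h => ?_, degree_polyOfNat_lt w⟩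
  rw [← polyOfNat_zero (b := b) (m := m)] at h
  have := polyOfNat_injOn hw.2 (by omega) h
  omega

theorem sum_range_digitVec (F : (Fin m → ZMod b) → ℂ) :
    ∑ w ∈ Finset.range (b ^ m), F (digitVec b m w) = ∑ x, F x := by
  rw [Finset.sum_range (fun w => F (digitVec b m w))]
  have hbij : Function.Bijective fun w : Fin (b ^ m) => digitVec b m w := by
    rw [Fintype.bijective_iff_injective_and_card]
    refine ⟨fun v w h => Fin.ext (digitVec_injOn v.2 w.2 h), ?_⟩
    simp [ZMod.card]
  exact hbij.sum_comp F

/-- The first m Laurent coefficients of p/f determine p when deg p < m. By finiteness every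
coefficient pattern occurs, in particular one supported at a single nonzero digit of k. -/
theorem exists_walQuot_ne_one {f : (ZMod b)[X]} (hf : f ≠ 0) (hfm : f.natDegree = m) {k : ℕ}
    (hk : ¬ b ^ m ∣ k) : ∃ x : Fin m → ZMod b, walQuot b m f k (polyOfVec x) ≠ 1 := by
  obtain ⟨i, hi, hki⟩ := exists_natDigit_ne_zero_of_not_dvd hk
  have hinj : Function.Injective fun (x : Fin m → ZMod b) (j : Fin m) =>
      quotCoeff b f (polyOfVec x) j := by
    intro x y hxy
    have h0 : polyOfVec x - polyOfVec y = 0 := by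
      refine eq_zero_of_quotCoeff_eq_zero hf hfm
        ((Polynomial.degree_sub_le _ _).trans_lt
          (max_lt (degree_polyOfVec_lt x) (degree_polyOfVec_lt y))) fun j hj => ?_
      rw [quotCoeff_sub, sub_eq_zero]
      exact congrFun hxy ⟨j, hj⟩
    funext j
    rw [← coeff_polyOfVec x, sub_eq_zero.mp h0, coeff_polyOfVec]
  obtain ⟨x, hx⟩ := (Finite.surjective_of_injective hinj) (Pi.single ⟨i, hi⟩ 1)
  refine ⟨x, ?_⟩
  rw [walQuot_eq, ← Fin.sum_univ_eq_sum_range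
    (fun j => quotCoeff b f (polyOfVec x) j * (natDigit b k j : ZMod b))]
  have hx' (j : Fin m) : quotCoeff b f (polyOfVec x) j =
      (Pi.single ⟨i, hi⟩ 1 : Fin m → ZMod b) j := congrFun hx j
  simp_rw [hx']
  have hsum : ∑ j : Fin m, (Pi.single ⟨i, hi⟩ 1 : Fin m → ZMod b) j * (natDigit b k j : ZMod b) =
      (natDigit b k i : ZMod b) := by
    simp [Pi.single_apply]
  rw [hsum]
  intro h
  have h0 : (natDigit b k i : ZMod b) = 0 := ZMod.injective_stdAddChar (by simpa using h)
  rw [ZMod.natCast_eq_zero_iff] at h0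
  exact hki (Nat.eq_zero_of_dvd_of_lt h0 (natDigit_lt (Fact.out : b.Prime).pos _ _))

/-- The summand is an additive character of the polynomials of degree less than m. It is nontrivial
because u is invertible modulo the irreducible f, so multiplication by u reaches every residue. -/
theorem sum_walQuot_eq_zero {f : (ZMod b)[X]} (hf : Irreducible f) (hfm : f.natDegree = m)
    {u : (ZMod b)[X]} (hu : u ≠ 0) (hum : u.degree < m) {k : ℕ} (hk : ¬ b ^ m ∣ k) :
    ∑ w ∈ Finset.range (b ^ m), walQuot b m f k (u * polyOfNat b m w) = 0 := by
  simp_rw [polyOfNat_eq]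
  rw [sum_range_digitVec (fun x => walQuot b m f k (u * polyOfVec x))]
  set φ : (Fin m → ZMod b) →+ ZMod b := AddMonoidHom.mk' (fun x => ∑ i ∈ Finset.range m,
      quotCoeff b f (u * polyOfVec x) i * (natDigit b k i : ZMod b)) fun x y => by
    simp [polyOfVec_add, mul_add, quotCoeff_add, add_mul, Finset.sum_add_distrib] with hφ
  set ψ : AddChar (Fin m → ZMod b) ℂ := (ZMod.stdAddChar (N := b)).compAddMonoidHom φ with hψ
  have hψ' (x : Fin m → ZMod b) : walQuot b m f k (u * polyOfVec x) = ψ x := walQuot_eq _ _ _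
  simp_rw [hψ']
  apply AddChar.sum_eq_zero_of_ne_one
  intro h1
  obtain ⟨x, hx⟩ := exists_walQuot_ne_one hf.ne_zero hfm hk
  have hcop : IsCoprime f u := by
    refine (hf.coprime_iff_not_dvd).mpr fun hdvd => ?_
    have := Polynomial.degree_le_of_dvd hdvd hu
    rw [Polynomial.degree_eq_natDegree hf.ne_zero, hfm] at this
    exact absurd (this.trans_lt hum) (lt_irrefl _)
  obtain ⟨a, c, hac⟩ := hcop
  have hdeg : (c * polyOfVec x % f).degree < m := by
    have h := EuclideanDomain.mod_lt (c * polyOfVec x) hf.ne_zero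
    have h2 : f.degree = (m : WithBot ℕ) := by
      rw [Polynomial.degree_eq_natDegree hf.ne_zero, hfm]
    exact h2 ▸ h
  obtain ⟨y, hy⟩ := exists_polyOfVec_eq hdeg
  apply hx
  have heq : walQuot b m f k (polyOfVec x) = ψ y := by
    rw [← hψ', hy, walQuot_eq, walQuot_eq]
    congr 1
    refine Finset.sum_congr rfl fun i _ => ?_
    congr 1
    -- Bézout writes x as u·y plus a multiple of f; that multiple is invisible to the Laurent
    -- coefficients with negative powers of x.
    have hq : polyOfVec x = u * (c * polyOfVec x % f) +
        f * (a * polyOfVec x + u * (c * polyOfVec x / f)) := by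
      have h2 := EuclideanDomain.div_add_mod (c * polyOfVec x) f
      calc polyOfVec x = (a * f + c * u) * polyOfVec x := by rw [hac, one_mul]
        _ = f * (a * polyOfVec x) + u * (c * polyOfVec x) := by ring
        _ = f * (a * polyOfVec x) + u * (f * (c * polyOfVec x / f) + c * polyOfVec x % f) := by
          rw [h2]
        _ = _ := by ring
    conv_lhs => rw [hq, quotCoeff_add, quotCoeff_mul_self hf.ne_zero, add_zero]
  rw [heq, h1, AddChar.one_apply]

theorem sum_normSq_mean_walQuot {f : (ZMod b)[X]} (hf : Irreducible f) (hfm : f.natDegree = m)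
    {k : ℕ} (hk : ¬ b ^ m ∣ k) {c : ℕ → ℂ} (hc : ∀ v, ‖c v‖ = 1) :
    ∑ w ∈ Finset.range (b ^ m), ‖(1 / ((b ^ m : ℕ) : ℂ)) * ∑ v ∈ Finset.range (b ^ m),
      c v * walQuot b m f k (polyOfNat b m v * polyOfNat b m w)‖ₑ ^ 2 = 1 := by
  have hb := (Fact.out : b.Prime).pos
  refine sum_normSq_mean_eq_one _ (by positivity)
    (fun v w => walQuot b m f k (polyOfNat b m v * polyOfNat b m w)) (fun v hv v' hv' => ?_) hc
  simp_rw [walQuot_sub, ← sub_mul]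
  split_ifs with h
  · simp [h, walQuot_eq, quotCoeff_zero]
  · refine sum_walQuot_eq_zero hf hfm (fun h0 => h ?_) ?_ hk
    · exact polyOfNat_injOn hv hv' (sub_eq_zero.mp h0)
    · exact (Polynomial.degree_sub_le _ _).trans_lt
        (max_lt (degree_polyOfNat_lt v) (degree_polyOfNat_lt v'))

end

section

/-! ### Averages over the candidates for a component -/

theorem ofReal_rho_zero (b : ℕ) (α γ : ℝ) : ENNReal.ofReal (rho b α γ 0) = 1 := by simp [rho]

theorem ofReal_r_zero (β γ : ℝ) : ENNReal.ofReal (r β γ 0) = 1 := by simp [r]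

theorem tsum_rho_dvd_add_one_le {b : ℕ} (hb : 1 < b) {α γ : ℝ} (hα : 1 < α) (hγ : 0 < γ) (m : ℕ) :
    ∑' k : ℕ, (if b ^ m ∣ k then ENNReal.ofReal (rho b α γ k) else 0) ≤
      1 + ENNReal.ofReal (γ * mu b α * ((b ^ m : ℕ) : ℝ) ^ (-α)) := by
  rw [ENNReal.tsum_eq_add_tsum_ite 0, if_pos (dvd_zero _), ofReal_rho_zero]
  refine add_le_add le_rfl (le_trans (le_of_eq (tsum_congr fun k => ?_))
    (tsum_rho_dvd_le hb hα hγ m))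
  by_cases hk : k = 0 <;> simp [hk]

/-- For multiples of b^m the Walsh factor is 1 and the candidates all give the mean of c, which
belongs to the old energy. For all other k, Parseval bounds the whole sum over candidates by 1. -/
theorem sum_poly_candidates_le {b m : ℕ} [Fact b.Prime] {f : (ZMod b)[X]} (hf : Irreducible f)
    (hfm : f.natDegree = m) {α γ : ℝ} (hα : 1 < α) (hγ : 0 < γ) {c : ℕ → ℂ} (hc : ∀ v, ‖c v‖ = 1) :
    ∑ w ∈ Finset.Ico 1 (b ^ m), ∑' k : ℕ, ENNReal.ofReal (rho b α γ k) *
        ‖(1 / ((b ^ m : ℕ) : ℂ)) * ∑ v ∈ Finset.range (b ^ m),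
          c v * walQuot b m f k (polyOfNat b m v * polyOfNat b m w)‖ₑ ^ 2 ≤
      ((Finset.Ico 1 (b ^ m)).card : ℝ≥0∞) *
        ‖(1 / ((b ^ m : ℕ) : ℂ)) * ∑ v ∈ Finset.range (b ^ m), c v‖ₑ ^ 2 *
          (1 + ENNReal.ofReal (γ * mu b α * ((b ^ m : ℕ) : ℝ) ^ (-α))) +
        ENNReal.ofReal (γ * mu b α) := by
  have hb := (Fact.out : b.Prime).one_lt
  set D : ℝ≥0∞ := ((Finset.Ico 1 (b ^ m)).card : ℝ≥0∞) *
    ‖(1 / ((b ^ m : ℕ) : ℂ)) * ∑ v ∈ Finset.range (b ^ m), c v‖ₑ ^ 2 with hD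
  have hk (k : ℕ) : ∑ w ∈ Finset.Ico 1 (b ^ m), ENNReal.ofReal (rho b α γ k) *
        ‖(1 / ((b ^ m : ℕ) : ℂ)) * ∑ v ∈ Finset.range (b ^ m),
          c v * walQuot b m f k (polyOfNat b m v * polyOfNat b m w)‖ₑ ^ 2 ≤
      D * (if b ^ m ∣ k then ENNReal.ofReal (rho b α γ k) else 0) +
        if k ≠ 0 then ENNReal.ofReal (rho b α γ k) else 0 := by
    rw [← Finset.mul_sum]
    by_cases hdvd : b ^ m ∣ k
    · refine le_add_right (le_of_eq ?_)
      simp only [walQuot_eq_one_of_dvd f hdvd, mul_one, Finset.sum_const, nsmul_eq_mul, hdvd,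
        if_true]
      rw [mul_comm]
    · have hk0 : k ≠ 0 := fun h => hdvd (h ▸ dvd_zero _)
      refine le_add_left ?_
      rw [if_pos hk0]
      refine mul_le_of_le_one_right' ?_
      rw [← sum_normSq_mean_walQuot hf hfm hdvd hc]
      -- The candidates omit w = 0; adding this nonnegative term completes the sum for Parseval.
      exact Finset.sum_le_sum_of_subset fun w hw => by simp at hw ⊢; omega
  rw [← Summable.tsum_finsetSum fun _ _ => ENNReal.summable]
  refine (ENNReal.tsum_le_tsum hk).trans ?_
  rw [ENNReal.tsum_add, ENNReal.tsum_mul_left]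
  exact add_le_add (mul_le_mul_right (tsum_rho_dvd_add_one_le hb hα hγ m) _)
    (tsum_rho_ne_zero_le hb hα hγ)

/-! ### Lattice rules -/

theorem exp_fract {N : ℕ} [NeZero N] (l : ℤ) (v w : ℕ) :
    Complex.exp (2 * Real.pi * Complex.I * (l : ℂ) *
      ((Int.fract ((v : ℝ) * (w : ℝ) / (N : ℝ)) : ℝ) : ℂ)) =
      ZMod.stdAddChar ((v : ZMod N) * ((l : ZMod N) * (w : ZMod N))) := by
  have h := ZMod.stdAddChar_coe (N := N) ((v : ℤ) * (l * (w : ℤ)))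
  push_cast at h
  rw [h, Complex.exp_eq_exp_iff_exists_int]
  refine ⟨-(l * ⌊(v : ℝ) * (w : ℝ) / (N : ℝ)⌋), ?_⟩
  rw [Int.fract]
  push_cast
  ring

theorem sum_normSq_mean_stdAddChar {N : ℕ} [NeZero N] {c : ℕ → ℂ} (hc : ∀ v, ‖c v‖ = 1) :
    ∑ x : ZMod N, ‖(1 / (N : ℂ)) * ∑ v ∈ Finset.range N,
      c v * ZMod.stdAddChar ((v : ZMod N) * x)‖ₑ ^ 2 = 1 := by
  refine sum_normSq_mean_eq_one _ (NeZero.ne N)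
    (fun v (x : ZMod N) => ZMod.stdAddChar ((v : ZMod N) * x)) (fun v hv v' hv' => ?_) hc
  have h (x : ZMod N) : (ZMod.stdAddChar ((v : ZMod N) * x) : ℂ) *
      (starRingEnd ℂ) (ZMod.stdAddChar ((v' : ZMod N) * x)) =
      ZMod.stdAddChar (x * ((v : ZMod N) - (v' : ZMod N))) := by
    rw [← AddChar.map_neg_eq_conj, ← AddChar.map_add_eq_mul]
    congr 1; ring
  simp_rw [h]
  rw [AddChar.sum_mulShift _ (ZMod.isPrimitive_stdAddChar N), ZMod.card]
  have hiff : ((v : ZMod N) - (v' : ZMod N) = 0) ↔ v = v' := by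
    rw [sub_eq_zero, ZMod.natCast_eq_natCast_iff]
    exact ⟨fun h => Nat.ModEq.eq_of_lt_of_lt h hv hv', fun h => h ▸ rfl⟩
  simp only [hiff]
  split_ifs <;> simp

/-- The number of solutions `w < N`, prime to `N`, of `l w ≡ x` modulo `N`. -/
def unitSolutions (N : ℕ) (l : ℤ) (x : ZMod N) : Finset ℕ :=
  {w ∈ Finset.range N | N.Coprime w ∧ (l : ZMod N) * (w : ZMod N) = x}

/-- A divisor of both x and N divides lw, and w is prime to N. -/
theorem dvd_of_mem_unitSolutions {N : ℕ} [NeZero N] {l : ℤ} {x : ZMod N} {w : ℕ}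
    (hw : w ∈ unitSolutions N l x) : ((Nat.gcd x.val N : ℕ) : ℤ) ∣ l := by
  simp only [unitSolutions, Finset.mem_filter] at hw
  obtain ⟨-, hcop, hx⟩ := hw
  set d := Nat.gcd x.val N with hd
  have h1 : ((l * (w : ℤ) : ℤ) : ZMod N) = ((x.val : ℤ) : ZMod N) := by
    push_cast
    rw [hx, ZMod.natCast_zmod_val]
  rw [ZMod.intCast_eq_intCast_iff_dvd_sub] at h1
  have hdN : (d : ℤ) ∣ (N : ℤ) := by exact_mod_cast Nat.gcd_dvd_right _ _
  have hdx : (d : ℤ) ∣ (x.val : ℤ) := by exact_mod_cast Nat.gcd_dvd_left _ _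
  have h2 : (d : ℤ) ∣ l * (w : ℤ) := by
    have := dvd_sub hdx (hdN.trans h1)
    simpa using this
  refine IsCoprime.dvd_of_dvd_mul_right ?_ h2
  exact Nat.isCoprime_iff_coprime.mpr (Nat.Coprime.coprime_dvd_left (Nat.gcd_dvd_right _ _) hcop)

/-- Differences of solutions are killed by gcd(l, N), which divides gcd(x, N) once a solution
exists. A cyclic group has at most d elements killed by d. -/
theorem card_unitSolutions_le {N : ℕ} [NeZero N] {l : ℤ} {x : ZMod N} :
    (unitSolutions N l x).card ≤ Nat.gcd x.val N := by
  classical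
  set d := Nat.gcd x.val N with hd
  have hdpos : 0 < d := Nat.gcd_pos_of_pos_right _ (NeZero.pos N)
  rcases (unitSolutions N l x).eq_empty_or_nonempty with h | ⟨w₀, hw₀⟩
  · simp [h]
  refine le_trans ?_ (IsAddCyclic.card_nsmul_eq_zero_le (α := ZMod N) hdpos)
  refine Finset.card_le_card_of_injOn (fun w : ℕ => (w : ZMod N) - w₀) (fun w hw => ?_) ?_
  · have hw : w ∈ unitSolutions N l x := hw
    simp only [unitSolutions, Finset.mem_filter, Finset.mem_range] at hw hw₀
    simp only [Finset.coe_filter, Finset.mem_univ, true_and, Set.mem_ofPred_eq, nsmul_eq_mul]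
    have hl : (l : ZMod N) * ((w : ZMod N) - w₀) = 0 := by rw [mul_sub, hw.2.2, hw₀.2.2, sub_self]
    have hN : ((N : ℤ) : ZMod N) * ((w : ZMod N) - w₀) = 0 := by simp
    have hg : ((Int.gcd l N : ℤ) : ZMod N) * ((w : ZMod N) - w₀) = 0 := by
      rw [Int.gcd_eq_gcd_ab]
      push_cast
      push_cast at hN
      linear_combination ((Int.gcdA l N : ℤ) : ZMod N) * hl + ((Int.gcdB l N : ℤ) : ZMod N) * hN
    have hdvd : Int.gcd l N ∣ d := by
      refine Nat.dvd_gcd ?_ ?_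
      · have h1 : ((l * (w : ℤ) : ℤ) : ZMod N) = ((x.val : ℤ) : ZMod N) := by
          push_cast
          rw [hw.2.2, ZMod.natCast_zmod_val]
        rw [ZMod.intCast_eq_intCast_iff_dvd_sub] at h1
        have h2 : ((Int.gcd l N : ℕ) : ℤ) ∣ (x.val : ℤ) - l * (w : ℤ) :=
          (Int.gcd_dvd_right _ _).trans h1
        have h3 : ((Int.gcd l N : ℕ) : ℤ) ∣ l * (w : ℤ) := (Int.gcd_dvd_left _ _).mul_right _
        have h4 := dvd_add h2 h3
        rw [sub_add_cancel] at h4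
        exact_mod_cast h4
      · exact_mod_cast Int.gcd_dvd_right l (N : ℤ)
    obtain ⟨e, he⟩ := hdvd
    rw [he]
    push_cast at hg ⊢
    rw [mul_comm (((Int.gcd l N : ℕ) : ZMod N)), mul_assoc, hg, mul_zero]
  · intro v hv w hw hvw
    have hv : v ∈ unitSolutions N l x := hv
    have hw : w ∈ unitSolutions N l x := hw
    simp only [unitSolutions, Finset.mem_filter, Finset.mem_range] at hv hw
    have h : (v : ZMod N) = w := sub_left_injective hvw
    rw [ZMod.natCast_eq_natCast_iff] at h
    exact Nat.ModEq.eq_of_lt_of_lt h hv.1 hw.1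

/-- With d = gcd(x, N), only multiples of d contribute, each with at most d solutions; the total
carries d · d^(-β) ≤ 1. For x = 0, where d = N, the count is bounded by φ(N) instead. -/
theorem tsum_r_card_unitSolutions_le {N : ℕ} [NeZero N] {β γ : ℝ} (hβ : 1 < β) (hγ : 0 < γ)
    (x : ZMod N) : ∑' l : ℤ, (if l ≠ 0 then
      ENNReal.ofReal (r β γ l) * ((unitSolutions N l x).card : ℝ≥0∞) else 0) ≤
      ENNReal.ofReal (2 * γ * zeta β) + if x = 0 then
        (N.totient : ℝ≥0∞) * ENNReal.ofReal (2 * γ * zeta β * (N : ℝ) ^ (-β)) else 0 := by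
  have hζ := zeta_pos hβ
  set d := Nat.gcd x.val N with hd
  have hdpos : 0 < d := Nat.gcd_pos_of_pos_right _ (NeZero.pos N)
  have key (C : ℕ) (hC : ∀ l : ℤ, (unitSolutions N l x).card ≤ C) : ∑' l : ℤ, (if l ≠ 0 then
      ENNReal.ofReal (r β γ l) * ((unitSolutions N l x).card : ℝ≥0∞) else 0) ≤
      (C : ℝ≥0∞) * ENNReal.ofReal (2 * γ * zeta β * (d : ℝ) ^ (-β)) := by
    rw [← tsum_r_dvd hβ hγ hdpos, ← ENNReal.tsum_mul_left]
    refine ENNReal.tsum_le_tsum fun l => ?_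
    by_cases hl : l = 0
    · simp [hl]
    rcases (unitSolutions N l x).eq_empty_or_nonempty with h | ⟨w, hw⟩
    · simp [h]
    · rw [if_pos hl, if_pos ⟨hl, dvd_of_mem_unitSolutions hw⟩, mul_comm]
      exact mul_le_mul_left (by exact_mod_cast hC l) _
  split_ifs with hx
  · refine le_add_left ?_
    have hdN : d = N := by rw [hd, hx, ZMod.val_zero, Nat.gcd_zero_left]
    rw [hdN] at key
    refine key _ fun l => ?_
    refine Finset.card_le_card fun w hw => ?_
    simp only [unitSolutions, Finset.mem_filter] at hw ⊢
    exact ⟨hw.1, hw.2.1⟩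
  · rw [add_zero]
    refine (key d fun l => card_unitSolutions_le).trans ?_
    rw [← ENNReal.ofReal_natCast, ← ENNReal.ofReal_mul (by positivity)]
    refine ENNReal.ofReal_le_ofReal ?_
    have hd1 : (1 : ℝ) ≤ d := by exact_mod_cast hdpos
    have h1 : (d : ℝ) * (d : ℝ) ^ (-β) ≤ 1 := by
      have h2 : (d : ℝ) * (d : ℝ) ^ (-β) = (d : ℝ) ^ (1 - β) := by
        rw [sub_eq_add_neg, Real.rpow_add (by positivity), Real.rpow_one]
      rw [h2]
      exact Real.rpow_le_one_of_one_le_of_nonpos hd1 (by linarith)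
    have h3 : 0 ≤ 2 * γ * zeta β := by positivity
    calc (d : ℝ) * (2 * γ * zeta β * (d : ℝ) ^ (-β))
        = 2 * γ * zeta β * ((d : ℝ) * (d : ℝ) ^ (-β)) := by ring
      _ ≤ 2 * γ * zeta β := mul_le_of_le_one_right h3 h1

/-- The candidates are grouped by the residue x = lw. Summing over l first gives a bound uniform in
x ≠ 0, after which Parseval over `ZMod N` applies; the term x = 0 is again the mean of c. -/
theorem sum_int_candidates_le {N : ℕ} [NeZero N] {β γ : ℝ} (hβ : 1 < β) (hγ : 0 < γ)
    {c : ℕ → ℂ} (hc : ∀ v, ‖c v‖ = 1) :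
    ∑ w ∈ Finset.range N with N.Coprime w, ∑' l : ℤ, ENNReal.ofReal (r β γ l) *
        ‖(1 / (N : ℂ)) * ∑ v ∈ Finset.range N,
          c v * ZMod.stdAddChar ((v : ZMod N) * ((l : ZMod N) * (w : ZMod N)))‖ₑ ^ 2 ≤
      (N.totient : ℝ≥0∞) * ‖(1 / (N : ℂ)) * ∑ v ∈ Finset.range N, c v‖ₑ ^ 2 *
          (1 + ENNReal.ofReal (2 * γ * zeta β * (N : ℝ) ^ (-β))) +
        ENNReal.ofReal (2 * γ * zeta β) := by
  classical
  set F : ZMod N → ℝ≥0∞ := fun x => ‖(1 / (N : ℂ)) * ∑ v ∈ Finset.range N,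
    c v * ZMod.stdAddChar ((v : ZMod N) * x)‖ₑ ^ 2 with hF
  have hF0 : F 0 = ‖(1 / (N : ℂ)) * ∑ v ∈ Finset.range N, c v‖ₑ ^ 2 := by simp [hF]
  have hFsum : ∑ x, F x = 1 := sum_normSq_mean_stdAddChar hc
  have hcount (l : ℤ) : ∑ w ∈ Finset.range N with N.Coprime w, F ((l : ZMod N) * (w : ZMod N)) =
      ∑ x, ((unitSolutions N l x).card : ℝ≥0∞) * F x := by
    rw [← Finset.sum_fiberwise_of_maps_to (t := Finset.univ)
      (g := fun w : ℕ => (l : ZMod N) * (w : ZMod N)) fun _ _ => Finset.mem_univ _]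
    refine Finset.sum_congr rfl fun x _ => ?_
    rw [Finset.sum_congr rfl (g := fun _ => F x) fun w hw => by
      rw [(Finset.mem_filter.mp hw).2], Finset.sum_const, nsmul_eq_mul, Finset.filter_filter]
    rfl
  rw [← Summable.tsum_finsetSum fun _ _ => ENNReal.summable]
  simp_rw [← Finset.mul_sum]
  change ∑' l : ℤ, ENNReal.ofReal (r β γ l) *
    ∑ w ∈ Finset.range N with N.Coprime w, F ((l : ZMod N) * (w : ZMod N)) ≤ _
  rw [ENNReal.tsum_eq_add_tsum_ite 0, ofReal_r_zero, one_mul, ← hF0, mul_add, mul_one, add_assoc]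
  refine add_le_add (le_of_eq ?_) ?_
  · simp only [Int.cast_zero, zero_mul, Finset.sum_const, nsmul_eq_mul]
    rfl
  have hl (l : ℤ) : (if l = 0 then 0 else ENNReal.ofReal (r β γ l) *
      ∑ w ∈ Finset.range N with N.Coprime w, F ((l : ZMod N) * (w : ZMod N))) =
      ∑ x, F x * if l ≠ 0 then
        ENNReal.ofReal (r β γ l) * ((unitSolutions N l x).card : ℝ≥0∞) else 0 := by
    by_cases hl : l = 0
    · simp [hl]
    · rw [if_neg hl, hcount, Finset.mul_sum]
      refine Finset.sum_congr rfl fun x _ => ?_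
      rw [if_pos hl]; ring
  calc _ = ∑' l : ℤ, ∑ x, F x * (if l ≠ 0 then
        ENNReal.ofReal (r β γ l) * ((unitSolutions N l x).card : ℝ≥0∞) else 0) :=
        tsum_congr fun l => by rw [← hl l]; congr
    _ = ∑ x, F x * ∑' l : ℤ, (if l ≠ 0 then
        ENNReal.ofReal (r β γ l) * ((unitSolutions N l x).card : ℝ≥0∞) else 0) := by
        rw [Summable.tsum_finsetSum fun _ _ => ENNReal.summable]
        simp_rw [ENNReal.tsum_mul_left]
    _ ≤ ∑ x, F x * (ENNReal.ofReal (2 * γ * zeta β) + if x = 0 then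
        (N.totient : ℝ≥0∞) * ENNReal.ofReal (2 * γ * zeta β * (N : ℝ) ^ (-β)) else 0) :=
        Finset.sum_le_sum fun x _ => mul_le_mul_right (tsum_r_card_unitSolutions_le hβ hγ x) _
    _ = _ := by
        simp_rw [mul_add, Finset.sum_add_distrib, ← Finset.sum_mul, hFsum, one_mul, mul_ite,
          mul_zero, Finset.sum_ite_eq', Finset.mem_univ, if_true]
        ring

end

section

/-! ### Adding one component -/

variable {b s t : ℕ}

/-- Appending a component to the Walsh frequency. -/
def freqSnocLeft (s t : ℕ) : Freq s t × ℕ ≃ Freq (s + 1) t where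
  toFun q := (Fin.snoc (α := fun _ => ℕ) q.1.1 q.2, q.1.2)
  invFun k := ((Fin.init k.1, k.2), k.1 (Fin.last s))
  left_inv q := by simp
  right_inv k := by simp

/-- Appending a component to the trigonometric frequency. -/
def freqSnocRight (s t : ℕ) : Freq s t × ℤ ≃ Freq s (t + 1) where
  toFun q := (q.1.1, Fin.snoc (α := fun _ => ℤ) q.1.2 q.2)
  invFun k := ((k.1, Fin.init k.2), k.2 (Fin.last t))
  left_inv q := by simp
  right_inv k := by simp

theorem energy_succ_left (hb : 1 < b) {α β : ℝ} {γ₁ γ₂ : ℕ → ℝ}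
    (hγ₁ : ∀ j, 0 < γ₁ j) (hγ₂ : ∀ j, 0 < γ₂ j) (N : ℕ) (pts : ℕ → Pt (s + 1) t) :
    energy b α β γ₁ γ₂ N pts = ∑' kl : Freq s t, ENNReal.ofReal (weight b α β γ₁ γ₂ kl) *
      ∑' k : ℕ, ENNReal.ofReal (rho b α (γ₁ s) k) *
        ‖(1 / (N : ℂ)) * ∑ v ∈ Finset.range N,
          basisFun b kl (Fin.init (pts v).1, (pts v).2) *
            wal b k ((pts v).1 (Fin.last s))‖ₑ ^ 2 := by
  have hw (q : Freq s t × ℕ) : weight b α β γ₁ γ₂ (freqSnocLeft s t q) =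
      weight b α β γ₁ γ₂ q.1 * rho b α (γ₁ s) q.2 := by
    simp only [weight, freqSnocLeft, Equiv.coe_fn_mk, Fin.prod_univ_castSucc, Fin.snoc_castSucc,
      Fin.snoc_last, Fin.val_castSucc, Fin.val_last]
    ring
  have hφ (q : Freq s t × ℕ) (p : Pt (s + 1) t) : basisFun b (freqSnocLeft s t q) p =
      basisFun b q.1 (Fin.init p.1, p.2) * wal b q.2 (p.1 (Fin.last s)) := by
    simp only [basisFun, walVec, freqSnocLeft, Equiv.coe_fn_mk, Fin.prod_univ_castSucc,
      Fin.snoc_castSucc, Fin.snoc_last, Fin.init]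
    ring
  rw [energy, ← (freqSnocLeft s t).tsum_eq, ENNReal.tsum_prod']
  refine tsum_congr fun kl => ?_
  rw [← ENNReal.tsum_mul_left]
  refine tsum_congr fun k => ?_
  rw [hw, ENNReal.ofReal_mul (weight_pos hb hγ₁ hγ₂ kl).le, mul_assoc]
  simp only [nodeMean, hφ]

theorem energy_succ_right (hb : 1 < b) {α β : ℝ} {γ₁ γ₂ : ℕ → ℝ}
    (hγ₁ : ∀ j, 0 < γ₁ j) (hγ₂ : ∀ j, 0 < γ₂ j) (N : ℕ) (pts : ℕ → Pt s (t + 1)) :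
    energy b α β γ₁ γ₂ N pts = ∑' kl : Freq s t, ENNReal.ofReal (weight b α β γ₁ γ₂ kl) *
      ∑' l : ℤ, ENNReal.ofReal (r β (γ₂ t) l) *
        ‖(1 / (N : ℂ)) * ∑ v ∈ Finset.range N,
          basisFun b kl ((pts v).1, Fin.init (pts v).2) *
            Complex.exp (2 * Real.pi * Complex.I * (l : ℂ) *
              (((pts v).2 (Fin.last t) : ℝ) : ℂ))‖ₑ ^ 2 := by
  have hw (q : Freq s t × ℤ) : weight b α β γ₁ γ₂ (freqSnocRight s t q) =
      weight b α β γ₁ γ₂ q.1 * r β (γ₂ t) q.2 := by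
    simp only [weight, freqSnocRight, Equiv.coe_fn_mk, Fin.prod_univ_castSucc, Fin.snoc_castSucc,
      Fin.snoc_last, Fin.val_castSucc, Fin.val_last]
    ring
  have hφ (q : Freq s t × ℤ) (p : Pt s (t + 1)) : basisFun b (freqSnocRight s t q) p =
      basisFun b q.1 (p.1, Fin.init p.2) *
        Complex.exp (2 * Real.pi * Complex.I * (q.2 : ℂ) * ((p.2 (Fin.last t) : ℝ) : ℂ)) := by
    simp only [basisFun, trigVec_eq, freqSnocRight, Equiv.coe_fn_mk, Fin.prod_univ_castSucc,
      Fin.snoc_castSucc, Fin.snoc_last, Fin.init]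
    ring
  rw [energy, ← (freqSnocRight s t).tsum_eq, ENNReal.tsum_prod']
  refine tsum_congr fun kl => ?_
  rw [← ENNReal.tsum_mul_left]
  refine tsum_congr fun k => ?_
  rw [hw, ENNReal.ofReal_mul (weight_pos hb hγ₁ hγ₂ kl).le, mul_assoc]
  simp only [nodeMean, hφ]

theorem tsum_weight_mul_le {α β : ℝ} {γ₁ γ₂ : ℕ → ℝ} {N : ℕ} (pts : ℕ → Pt s t)
    {n : ℝ≥0∞} {ε δ : ℝ≥0∞} {A : Freq s t → ℝ≥0∞}
    (hA : ∀ kl, A kl ≤ n * ‖nodeMean b N pts kl‖ₑ ^ 2 * (1 + ε) + δ) :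
    ∑' kl, ENNReal.ofReal (weight b α β γ₁ γ₂ kl) * A kl ≤
      n * energy b α β γ₁ γ₂ N pts * (1 + ε) +
        δ * ∑' kl : Freq s t, ENNReal.ofReal (weight b α β γ₁ γ₂ kl) := by
  rw [energy, ← ENNReal.tsum_mul_left, ← ENNReal.tsum_mul_left, ← ENNReal.tsum_mul_right,
    ← ENNReal.tsum_add]
  refine ENNReal.tsum_le_tsum fun kl => (mul_le_mul_right (hA kl) _).trans_eq ?_
  ring

/-! ### Hybrid point sets -/

variable {m : ℕ} [Fact b.Prime]

theorem hybridPt_mem_cube (f : (ZMod b)[X]) (g : ℕ → (ZMod b)[X]) (z : ℕ → ℕ) (s t v : ℕ) :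
    hybridPt b m f g z s t v ∈ cube s t :=
  ⟨fun _ => nu_mem_Ico _, fun _ => ⟨Int.fract_nonneg _, Int.fract_lt_one _⟩⟩

theorem hybridPt_update_left (f : (ZMod b)[X]) (g : ℕ → (ZMod b)[X]) (z : ℕ → ℕ)
    (h : (ZMod b)[X]) (s t v : ℕ) :
    hybridPt b m f (Function.update g s h) z s t v = hybridPt b m f g z s t v := by
  refine Prod.ext (funext fun j => ?_) rfl
  have : (j : ℕ) ≠ s := j.2.ne
  simp [hybridPt, polyLatticePt, this]

theorem hybridPt_update_right (f : (ZMod b)[X]) (g : ℕ → (ZMod b)[X]) (z : ℕ → ℕ)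
    (w s t v : ℕ) :
    hybridPt b m f g (Function.update z t w) s t v = hybridPt b m f g z s t v := by
  refine Prod.ext rfl (funext fun j => ?_)
  have : (j : ℕ) ≠ t := j.2.ne
  simp [hybridPt, latticePt, this]

theorem energy_hybridPt_succ_left {α β : ℝ} {γ₁ γ₂ : ℕ → ℝ}
    (hγ₁ : ∀ j, 0 < γ₁ j) (hγ₂ : ∀ j, 0 < γ₂ j) (f : (ZMod b)[X]) (g : ℕ → (ZMod b)[X])
    (z : ℕ → ℕ) (s t : ℕ) :
    energy b α β γ₁ γ₂ (b ^ m) (hybridPt b m f g z (s + 1) t) =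
      ∑' kl : Freq s t, ENNReal.ofReal (weight b α β γ₁ γ₂ kl) *
        ∑' k : ℕ, ENNReal.ofReal (rho b α (γ₁ s) k) *
          ‖(1 / ((b ^ m : ℕ) : ℂ)) * ∑ v ∈ Finset.range (b ^ m),
            basisFun b kl (hybridPt b m f g z s t v) *
              walQuot b m f k (polyOfNat b m v * g s)‖ₑ ^ 2 :=
  energy_succ_left (Fact.out : b.Prime).one_lt hγ₁ hγ₂ _ _

theorem energy_hybridPt_succ_right {α β : ℝ} {γ₁ γ₂ : ℕ → ℝ}
    (hγ₁ : ∀ j, 0 < γ₁ j) (hγ₂ : ∀ j, 0 < γ₂ j) (f : (ZMod b)[X]) (g : ℕ → (ZMod b)[X])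
    (z : ℕ → ℕ) (s t : ℕ) :
    energy b α β γ₁ γ₂ (b ^ m) (hybridPt b m f g z s (t + 1)) =
      ∑' kl : Freq s t, ENNReal.ofReal (weight b α β γ₁ γ₂ kl) *
        ∑' l : ℤ, ENNReal.ofReal (r β (γ₂ t) l) *
          ‖(1 / ((b ^ m : ℕ) : ℂ)) * ∑ v ∈ Finset.range (b ^ m),
            basisFun b kl (hybridPt b m f g z s t v) *
              ZMod.stdAddChar ((v : ZMod (b ^ m)) *
                ((l : ZMod (b ^ m)) * (z t : ZMod (b ^ m))))‖ₑ ^ 2 := by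
  rw [energy_succ_right (Fact.out : b.Prime).one_lt hγ₁ hγ₂]
  have h (kl : Freq s t) (l : ℤ) (v : ℕ) :
      basisFun b kl ((hybridPt b m f g z s (t + 1) v).1,
          Fin.init (hybridPt b m f g z s (t + 1) v).2) *
        Complex.exp (2 * Real.pi * Complex.I * (l : ℂ) *
          (((hybridPt b m f g z s (t + 1) v).2 (Fin.last t) : ℝ) : ℂ)) =
      basisFun b kl (hybridPt b m f g z s t v) * ZMod.stdAddChar ((v : ZMod (b ^ m)) *
        ((l : ZMod (b ^ m)) * (z t : ZMod (b ^ m)))) :=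
    congrArg (basisFun b kl (hybridPt b m f g z s t v) * ·) (exp_fract l v (z t))
  simp_rw [h]

/-- Transfers minimality from the worst-case error to the energy, the quantity that can be averaged.
-/
theorem energy_le_energy_of_intError_le {α β : ℝ} {γ₁ γ₂ : ℕ → ℝ} (hα : 1 < α) (hβ : 1 < β)
    (hγ₁ : ∀ j, 0 < γ₁ j) (hγ₂ : ∀ j, 0 < γ₂ j) {N : ℕ} (hN : N ≠ 0) {pts pts' : ℕ → Pt s t}
    (hpts : ∀ v, pts v ∈ cube s t) (hpts' : ∀ v, pts' v ∈ cube s t)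
    (h : intError b α β γ₁ γ₂ N pts ≤ intError b α β γ₁ γ₂ N pts') :
    energy b α β γ₁ γ₂ N pts ≤ energy b α β γ₁ γ₂ N pts' := by
  have hw := summable_weight (s := s) (t := t) (Fact.out : b.Prime).one_lt hα hβ hγ₁ hγ₂
  rw [← intError_sq_add_one hγ₁ hγ₂ hw hN hpts, ← intError_sq_add_one hγ₁ hγ₂ hw hN hpts']
  gcongr

theorem energy_stepPoly_le {α β : ℝ} {γ₁ γ₂ : ℕ → ℝ} (hα : 1 < α) (hβ : 1 < β)
    (hγ₁ : ∀ j, 0 < γ₁ j) (hγ₂ : ∀ j, 0 < γ₂ j) {f : (ZMod b)[X]} (hf : Irreducible f)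
    (hfm : f.natDegree = m) (g : ℕ → (ZMod b)[X]) (z : ℕ → ℕ)
    (hmin : ∀ h ∈ polyCandidates b m,
        intError b α β γ₁ γ₂ (b ^ m) (hybridPt b m f g z (s + 1) t) ≤
          intError b α β γ₁ γ₂ (b ^ m) (hybridPt b m f (Function.update g s h) z (s + 1) t)) :
    ((b ^ m - 1 : ℕ) : ℝ≥0∞) * energy b α β γ₁ γ₂ (b ^ m) (hybridPt b m f g z (s + 1) t) ≤
      ((b ^ m - 1 : ℕ) : ℝ≥0∞) * energy b α β γ₁ γ₂ (b ^ m) (hybridPt b m f g z s t) *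
        (1 + ENNReal.ofReal (γ₁ s * mu b α * ((b ^ m : ℕ) : ℝ) ^ (-α))) +
        ENNReal.ofReal (γ₁ s * mu b α) *
          ∑' kl : Freq s t, ENNReal.ofReal (weight b α β γ₁ γ₂ kl) := by
  have hb := (Fact.out : b.Prime).pos
  have hN : b ^ m ≠ 0 := by positivity
  have h1 : ((b ^ m - 1 : ℕ) : ℝ≥0∞) *
      energy b α β γ₁ γ₂ (b ^ m) (hybridPt b m f g z (s + 1) t) ≤
      ∑ w ∈ Finset.Ico 1 (b ^ m), energy b α β γ₁ γ₂ (b ^ m)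
        (hybridPt b m f (Function.update g s (polyOfNat b m w)) z (s + 1) t) := by
    rw [← nsmul_eq_mul, ← Nat.card_Ico 1 (b ^ m)]
    refine Finset.card_nsmul_le_sum _ _ _ fun w hw => ?_
    exact energy_le_energy_of_intError_le hα hβ hγ₁ hγ₂ hN (hybridPt_mem_cube _ _ _ _ _)
      (hybridPt_mem_cube _ _ _ _ _) (hmin _ (polyOfNat_mem_polyCandidates hw))
  refine h1.trans ?_
  simp_rw [energy_hybridPt_succ_left hγ₁ hγ₂, hybridPt_update_left, Function.update_self]
  rw [← Summable.tsum_finsetSum fun _ _ => ENNReal.summable]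
  simp_rw [← Finset.mul_sum]
  refine tsum_weight_mul_le _ fun kl => ?_
  have h2 := sum_poly_candidates_le hf hfm hα (hγ₁ s)
    (c := fun v => basisFun b kl (hybridPt b m f g z s t v)) fun v => norm_basisFun _ _
  rwa [Nat.card_Ico] at h2

theorem energy_stepInt_le {α β : ℝ} {γ₁ γ₂ : ℕ → ℝ} (hm : 1 ≤ m) (hα : 1 < α) (hβ : 1 < β)
    (hγ₁ : ∀ j, 0 < γ₁ j) (hγ₂ : ∀ j, 0 < γ₂ j) (f : (ZMod b)[X])
    (g : ℕ → (ZMod b)[X]) (z : ℕ → ℕ)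
    (hmin : ∀ w ∈ intCandidates (b ^ m),
        intError b α β γ₁ γ₂ (b ^ m) (hybridPt b m f g z s (t + 1)) ≤
          intError b α β γ₁ γ₂ (b ^ m) (hybridPt b m f g (Function.update z t w) s (t + 1))) :
    ((b ^ m).totient : ℝ≥0∞) * energy b α β γ₁ γ₂ (b ^ m) (hybridPt b m f g z s (t + 1)) ≤
      ((b ^ m).totient : ℝ≥0∞) * energy b α β γ₁ γ₂ (b ^ m) (hybridPt b m f g z s t) *
        (1 + ENNReal.ofReal (2 * γ₂ t * zeta β * ((b ^ m : ℕ) : ℝ) ^ (-β))) +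
        ENNReal.ofReal (2 * γ₂ t * zeta β) *
          ∑' kl : Freq s t, ENNReal.ofReal (weight b α β γ₁ γ₂ kl) := by
  have hb := (Fact.out : b.Prime).one_lt
  have hN : b ^ m ≠ 0 := by positivity
  have hN1 : 1 < b ^ m := Nat.one_lt_pow (by omega) hb
  have h1 : ((b ^ m).totient : ℝ≥0∞) *
      energy b α β γ₁ γ₂ (b ^ m) (hybridPt b m f g z s (t + 1)) ≤
      ∑ w ∈ Finset.range (b ^ m) with (b ^ m).Coprime w, energy b α β γ₁ γ₂ (b ^ m)
        (hybridPt b m f g (Function.update z t w) s (t + 1)) := by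
    rw [← nsmul_eq_mul]
    refine Finset.card_nsmul_le_sum _ _ _ fun w hw => ?_
    refine energy_le_energy_of_intError_le hα hβ hγ₁ hγ₂ hN (hybridPt_mem_cube _ _ _ _ _)
      (hybridPt_mem_cube _ _ _ _ _) (hmin _ ?_)
    rw [Finset.mem_filter, Finset.mem_range] at hw
    have hw0 : w ≠ 0 := by
      rintro rfl
      have := (Nat.coprime_zero_right _).mp hw.2
      omega
    exact ⟨by omega, by omega, hw.2.symm⟩
  refine h1.trans ?_
  simp_rw [energy_hybridPt_succ_right hγ₁ hγ₂, hybridPt_update_right, Function.update_self]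
  rw [← Summable.tsum_finsetSum fun _ _ => ENNReal.summable]
  simp_rw [← Finset.mul_sum]
  exact tsum_weight_mul_le _ fun kl => sum_int_candidates_le hβ (hγ₂ t)
    (c := fun v => basisFun b kl (hybridPt b m f g z s t v)) fun v => norm_basisFun _ _

/-! ### The component-by-component error bound -/

/-- Arithmetic of one construction step with n candidates. The old energy is at most 2Q, so the
ε-term costs at most 2Qδ/N; the δ-term divided by n costs the same because n ≥ N/2. Together they
give the increment 4Qδ/N. -/
theorem le_of_averaging {n : ℕ} {T T' P : ℝ≥0∞} {N δ ε Q : ℝ} (hN : 2 ≤ N) (hn : N ≤ 2 * n)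
    (hδ : 0 ≤ δ) (hε0 : 0 ≤ ε) (hε : ε ≤ δ / N) (hQ : 1 ≤ Q)
    (hT : T ≤ ENNReal.ofReal (1 + 2 / N * Q)) (hP : P ≤ ENNReal.ofReal Q)
    (h : (n : ℝ≥0∞) * T' ≤ (n : ℝ≥0∞) * T * (1 + ENNReal.ofReal ε) + ENNReal.ofReal δ * P) :
    T' ≤ ENNReal.ofReal (1 + 2 / N * (Q * (1 + 2 * δ))) := by
  have hN0 : 0 < N := by linarith
  have hn0 : (0 : ℝ) < n := by linarith
  have hn' : (n : ℝ≥0∞) ≠ 0 := by exact_mod_cast hn0.ne'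
  refine (ENNReal.mul_le_mul_iff_right hn' (ENNReal.natCast_ne_top n)).mp (h.trans ?_)
  have h1 : (n : ℝ≥0∞) * T * (1 + ENNReal.ofReal ε) + ENNReal.ofReal δ * P ≤
      (n : ℝ≥0∞) * ENNReal.ofReal (1 + 2 / N * Q) * (1 + ENNReal.ofReal ε) +
        ENNReal.ofReal δ * ENNReal.ofReal Q := by gcongr
  have hA : 0 ≤ 1 + 2 / N * Q := by positivity
  refine h1.trans ?_
  rw [← ENNReal.ofReal_natCast, ← ENNReal.ofReal_one, ← ENNReal.ofReal_add zero_le_one hε0,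
    ← ENNReal.ofReal_mul hn0.le, ← ENNReal.ofReal_mul (by positivity), ← ENNReal.ofReal_mul hδ,
    ← ENNReal.ofReal_add (by positivity) (by positivity),
    ← ENNReal.ofReal_mul hn0.le]
  refine ENNReal.ofReal_le_ofReal ?_
  have h2 : (1 + 2 / N * Q) * ε ≤ 2 * Q * δ / N := by
    have h3 : 1 + 2 / N * Q ≤ 2 * Q := by
      have : 2 / N * Q ≤ 1 * Q :=
        mul_le_mul_of_nonneg_right ((div_le_one hN0).mpr hN) (by linarith)
      linarith
    calc (1 + 2 / N * Q) * ε ≤ 2 * Q * (δ / N) := mul_le_mul h3 hε hε0 (by linarith)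
      _ = _ := by ring
  have h4 : δ * Q ≤ n * (2 * Q * δ / N) := by
    rw [mul_div_assoc', le_div_iff₀ hN0]
    nlinarith [mul_nonneg hδ (by linarith : 0 ≤ Q)]
  have h5 : (n : ℝ) * ((1 + 2 / N * Q) * ε) ≤ n * (2 * Q * δ / N) :=
    mul_le_mul_of_nonneg_left h2 hn0.le
  calc (n : ℝ) * (1 + 2 / N * Q) * (1 + ε) + δ * Q
      = n * (1 + 2 / N * Q) + n * ((1 + 2 / N * Q) * ε) + δ * Q := by ring
    _ ≤ n * (1 + 2 / N * Q) + n * (2 * Q * δ / N) + n * (2 * Q * δ / N) := by linarith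
    _ = n * (1 + 2 / N * (Q * (1 + 2 * δ))) := by ring

theorem energy_start_le {α β : ℝ} {γ₁ γ₂ : ℕ → ℝ} (hm : 1 ≤ m) (hα : 1 < α)
    (hγ₁ : ∀ j, 0 < γ₁ j) (hγ₂ : ∀ j, 0 < γ₂ j) {f : (ZMod b)[X]} (hf : Irreducible f)
    (hfm : f.natDegree = m) {g : ℕ → (ZMod b)[X]} (z : ℕ → ℕ) (hg : g 0 = 1) :
    energy b α β γ₁ γ₂ (b ^ m) (hybridPt b m f g z 1 0) ≤
      1 + ENNReal.ofReal (γ₁ 0 * mu b α * ((b ^ m : ℕ) : ℝ) ^ (-α)) := by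
  have hb := (Fact.out : b.Prime).one_lt
  refine le_trans ?_ (tsum_rho_dvd_add_one_le hb hα (hγ₁ 0) m)
  -- In dimension (0, 0) the only frequency is 0, so a single sum over the first Walsh frequency
  -- remains.
  rw [energy_hybridPt_succ_left hγ₁ hγ₂, 
    tsum_eq_single 0 fun kl h => absurd (Subsingleton.elim kl 0) h, weight_zero, ENNReal.ofReal_one, one_mul]
  refine ENNReal.tsum_le_tsum fun k => ?_
  simp only [basisFun_zero, one_mul, hg, mul_one]
  split_ifs with hk
  · refine mul_le_of_le_one_right' ?_
    simp only [walQuot_eq_one_of_dvd f hk]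
    have := norm_mean_le_one (N := b ^ m) (c := fun _ => 1) fun _ => by simp
    refine pow_le_one' ?_ 2
    rw [← ofReal_norm]
    exact ENNReal.ofReal_le_one.mpr this
  · have h0 := sum_walQuot_eq_zero hf hfm (u := 1) one_ne_zero
      (by rw [Polynomial.degree_one]; exact_mod_cast hm) hk
    simp only [one_mul] at h0
    rw [h0]
    simp

theorem rpow_neg_mul_le {N δ x : ℝ} (hN : 1 ≤ N) (hδ : 0 ≤ δ) (hx : 1 < x) :
    δ * N ^ (-x) ≤ δ / N := by
  rw [div_eq_mul_inv, ← Real.rpow_neg_one]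
  exact mul_le_mul_of_nonneg_left (Real.rpow_le_rpow_of_exponent_le hN (by linarith)) hδ

/-- The product in the component-by-component error bound. -/
def cbcProd (b : ℕ) (α β : ℝ) (γ₁ γ₂ : ℕ → ℝ) (s t : ℕ) : ℝ :=
  (∏ j ∈ Finset.range s, (1 + γ₁ j * (2 * mu b α))) *
    ∏ j ∈ Finset.range t, (1 + γ₂ j * (4 * zeta β))

theorem one_le_cbcProd {α β : ℝ} {γ₁ γ₂ : ℕ → ℝ} (hα : 1 < α) (hβ : 1 < β)
    (hγ₁ : ∀ j, 0 < γ₁ j) (hγ₂ : ∀ j, 0 < γ₂ j) (s t : ℕ) : 1 ≤ cbcProd b α β γ₁ γ₂ s t := by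
  have hμ := mu_pos (Fact.out : b.Prime).one_lt hα
  have hζ := zeta_pos hβ
  refine one_le_mul_of_one_le_of_one_le (Finset.one_le_prod fun j _ => ?_)
    (Finset.one_le_prod fun j _ => ?_)
  · have := hγ₁ j
    have : 0 ≤ γ₁ j * (2 * mu b α) := by positivity
    linarith
  · have := hγ₂ j
    have : 0 ≤ γ₂ j * (4 * zeta β) := by positivity
    linarith

/-- The same product must dominate both the error bound and the total weight, since the averaging
step uses one Q for both. -/
theorem tsum_weight_le_cbcProd {α β : ℝ} {γ₁ γ₂ : ℕ → ℝ} (hα : 1 < α) (hβ : 1 < β)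
    (hγ₁ : ∀ j, 0 < γ₁ j) (hγ₂ : ∀ j, 0 < γ₂ j) (s t : ℕ) :
    ∑' kl : Freq s t, ENNReal.ofReal (weight b α β γ₁ γ₂ kl) ≤
      ENNReal.ofReal (cbcProd b α β γ₁ γ₂ s t) := by
  have hb := (Fact.out : b.Prime).one_lt
  have hμ := mu_pos hb hα
  have hζ := zeta_pos hβ
  refine (tsum_weight_le hb hα hβ hγ₁ hγ₂).trans (ENNReal.ofReal_le_ofReal ?_)
  have h1 (j : ℕ) : 0 ≤ γ₁ j * mu b α := by have := hγ₁ j; positivity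
  have h2 (j : ℕ) : 0 ≤ γ₂ j * zeta β := by have := hγ₂ j; positivity
  refine mul_le_mul (Finset.prod_le_prod (fun j _ => ?_) fun j _ => ?_)
    (Finset.prod_le_prod (fun j _ => ?_) fun j _ => ?_)
    (Finset.prod_nonneg fun j _ => ?_) (Finset.prod_nonneg fun j _ => ?_)
  all_goals linarith [h1 j, h2 j]

theorem le_two_mul_totient_pow (hm : 1 ≤ m) : b ^ m ≤ 2 * (b ^ m).totient := by
  have hp := (Fact.out : b.Prime)
  rw [Nat.totient_prime_pow hp hm]
  have h2 : b ≤ 2 * (b - 1) := by have := hp.two_le; omega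
  calc b ^ m = b ^ (m - 1) * b := by rw [← pow_succ]; congr 1; omega
    _ ≤ b ^ (m - 1) * (2 * (b - 1)) := Nat.mul_le_mul_left _ h2
    _ = _ := by ring

theorem energy_le_of_isCBC {α β : ℝ} {γ₁ γ₂ : ℕ → ℝ} (hm : 1 ≤ m) (hα : 1 < α) (hβ : 1 < β)
    (hγ₁ : ∀ j, 0 < γ₁ j) (hγ₂ : ∀ j, 0 < γ₂ j) {f : (ZMod b)[X]} (hf : Irreducible f)
    (hfm : f.natDegree = m) {g : ℕ → (ZMod b)[X]} {z : ℕ → ℕ} {s t : ℕ}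
    (h : IsCBC b m α β γ₁ γ₂ f g z s t) :
    energy b α β γ₁ γ₂ (b ^ m) (hybridPt b m f g z s t) ≤
      ENNReal.ofReal (1 + 2 / ((b ^ m : ℕ) : ℝ) * cbcProd b α β γ₁ γ₂ s t) := by
  have hb := (Fact.out : b.Prime).one_lt
  have hN1 : 2 ≤ b ^ m := Nat.one_lt_pow (by omega) hb
  have hN : (2 : ℝ) ≤ ((b ^ m : ℕ) : ℝ) := by exact_mod_cast hN1
  have hμ := mu_pos hb hα
  have hζ := zeta_pos hβ
  induction h with
  | start hg =>
    refine (energy_start_le hm hα hγ₁ hγ₂ hf hfm z hg).trans ?_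
    have hδ : 0 ≤ γ₁ 0 * mu b α := mul_nonneg (hγ₁ 0).le hμ.le
    rw [← ENNReal.ofReal_one, ← ENNReal.ofReal_add zero_le_one (by positivity)]
    refine ENNReal.ofReal_le_ofReal (add_le_add le_rfl ?_)
    refine (rpow_neg_mul_le (by linarith) hδ hα).trans ?_
    simp only [cbcProd, Finset.prod_range_one, Finset.prod_range_zero, mul_one]
    rw [div_mul_eq_mul_div]
    exact div_le_div_of_nonneg_right (by linarith) (by positivity)
  | stepPoly d₁ d₂ _ hg hmin ih =>
    have hδ : 0 ≤ γ₁ d₁ * mu b α := mul_nonneg (hγ₁ d₁).le hμ.le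
    have hprod : cbcProd b α β γ₁ γ₂ (d₁ + 1) d₂ =
        cbcProd b α β γ₁ γ₂ d₁ d₂ * (1 + 2 * (γ₁ d₁ * mu b α)) := by
      simp only [cbcProd, Finset.prod_range_succ]
      ring
    rw [hprod]
    refine le_of_averaging hN ?_ hδ (by positivity) (rpow_neg_mul_le (by linarith) hδ hα)
      (one_le_cbcProd hα hβ hγ₁ hγ₂ d₁ d₂) ih (tsum_weight_le_cbcProd hα hβ hγ₁ hγ₂ d₁ d₂)
      (energy_stepPoly_le hα hβ hγ₁ hγ₂ hf hfm g z hmin)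
    -- The nonzero polynomials number N - 1, at least N/2 since N ≥ 2.
    have : b ^ m ≤ 2 * (b ^ m - 1) := by omega
    exact_mod_cast this
  | stepInt d₁ d₂ _ hz hmin ih =>
    have hδ : 0 ≤ 2 * γ₂ d₂ * zeta β := by have := hγ₂ d₂; positivity
    have hprod : cbcProd b α β γ₁ γ₂ d₁ (d₂ + 1) =
        cbcProd b α β γ₁ γ₂ d₁ d₂ * (1 + 2 * (2 * γ₂ d₂ * zeta β)) := by
      simp only [cbcProd, Finset.prod_range_succ]
      ring
    rw [hprod]
    refine le_of_averaging hN ?_ hδ (by positivity) (rpow_neg_mul_le (by linarith) hδ hβ)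
      (one_le_cbcProd hα hβ hγ₁ hγ₂ d₁ d₂) ih (tsum_weight_le_cbcProd hα hβ hγ₁ hγ₂ d₁ d₂)
      (energy_stepInt_le hm hα hβ hγ₁ hγ₂ f g z hmin)
    exact_mod_cast le_two_mul_totient_pow hm

end

section

/-! ### Quasi-multiplicativity of the weights -/

variable {b s t : ℕ}

/-- Digitwise subtraction is ultrametric: the top digit of k ⊖ l is no higher than that of the
larger argument. Hence no constant is lost, in contrast to the trigonometric part. -/
theorem rho_mul_rho_le (hb : 1 < b) {α γ : ℝ} (hα : 1 < α) (h0 : 0 < γ) (h1 : γ ≤ 1) (k l : ℕ) :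
    rho b α γ k * rho b α γ l ≤ rho b α γ (digitSub b k l) := by
  have hk0 := rho_pos (α := α) hb h0 k
  have hl0 := rho_pos (α := α) hb h0 l
  have hk1 := rho_le_one hb hα h1 k
  have hl1 := rho_le_one hb hα h1 l
  have hb' : (1 : ℝ) ≤ b := by exact_mod_cast hb.le
  by_cases hd : digitSub b k l = 0
  · rw [hd]
    simpa [rho] using mul_le_one₀ hk1 hl0.le hl1
  set n := Nat.log b (digitSub b k l) with hn
  have key (a : ℕ) (ha : b ^ n ≤ a) : rho b α γ a ≤ rho b α γ (digitSub b k l) := by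
    have ha0 : a ≠ 0 := by have : 0 < b ^ n := by positivity
                           omega
    have hlog : (n : ℝ) ≤ Nat.log b a := by exact_mod_cast Nat.le_log_of_pow_le hb ha
    rw [rho_eq_mul ha0, rho_eq_mul hd, ← hn]
    refine mul_le_mul_of_nonneg_left (Real.rpow_le_rpow_of_exponent_le hb' ?_) h0.le
    nlinarith
  by_cases hk : b ^ n ≤ k
  · exact (mul_le_of_le_one_right hk0.le hl1).trans (key k hk)
  by_cases hl : b ^ n ≤ l
  · exact (mul_le_of_le_one_left hl0.le hk1).trans (key l hl)
  · have := digitSub_lt_pow hb (not_le.mp hk) (not_le.mp hl)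
    exact absurd (Nat.pow_log_le_self b hd) (not_le.mpr this)

/-- When k, l and k - l are all nonzero, |k - l| ≤ |k| + |l| ≤ 2|k||l| yields the constant 2^β γ,
one γ being left over. In the degenerate cases 1 suffices. -/
theorem r_mul_r_le {β γ : ℝ} (hβ : 1 < β) (h0 : 0 < γ) (h1 : γ ≤ 1) (k l : ℤ) :
    r β γ k * r β γ l ≤ max 1 ((2 : ℝ) ^ β * γ) * r β γ (k - l) := by
  have hk0 := r_pos (β := β) h0 k
  have hl0 := r_pos (β := β) h0 l
  have hk1 := r_le_one hβ h1 k
  have hl1 := r_le_one hβ h1 l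
  have hd0 := r_pos (β := β) h0 (k - l)
  have hmax : r β γ (k - l) ≤ max 1 ((2 : ℝ) ^ β * γ) * r β γ (k - l) :=
    le_mul_of_one_le_left hd0.le (le_max_left _ _)
  by_cases hkl : k - l = 0
  · refine le_trans ?_ hmax
    rw [hkl]
    simpa [r] using mul_le_one₀ hk1 hl0.le hl1
  by_cases hk : k = 0
  · refine le_trans (le_of_eq ?_) hmax
    simp [hk, r]
  by_cases hl : l = 0
  · refine le_trans (le_of_eq ?_) hmax
    simp [hl, r]
  refine le_trans ?_ (mul_le_mul_of_nonneg_right (le_max_right _ _) hd0.le)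
  have hk' : (1 : ℝ) ≤ |(k : ℝ)| := by exact_mod_cast Int.one_le_abs hk
  have hl' : (1 : ℝ) ≤ |(l : ℝ)| := by exact_mod_cast Int.one_le_abs hl
  have hkl' : (1 : ℝ) ≤ |((k - l : ℤ) : ℝ)| := by exact_mod_cast Int.one_le_abs hkl
  have habs : |((k - l : ℤ) : ℝ)| ≤ 2 * (|(k : ℝ)| * |(l : ℝ)|) := by
    push_cast
    have := abs_sub (k : ℝ) l
    nlinarith [mul_nonneg (sub_nonneg.mpr hk') (sub_nonneg.mpr hl')]
  have h2 : (2 * (|(k : ℝ)| * |(l : ℝ)|)) ^ (-β) ≤ |((k - l : ℤ) : ℝ)| ^ (-β) :=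
    Real.rpow_le_rpow_of_nonpos (by linarith) habs (by linarith)
  rw [Real.mul_rpow (by positivity) (by positivity), Real.mul_rpow (by positivity) (by positivity),
    Real.rpow_neg (by positivity) β, inv_mul_le_iff₀ (by positivity)] at h2
  simp only [r, if_neg hk, if_neg hl, if_neg hkl]
  calc γ * |(k : ℝ)| ^ (-β) * (γ * |(l : ℝ)| ^ (-β))
      = γ * γ * (|(k : ℝ)| ^ (-β) * |(l : ℝ)| ^ (-β)) := by ring
    _ ≤ γ * γ * ((2 : ℝ) ^ β * |((k - l : ℤ) : ℝ)| ^ (-β)) :=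
        mul_le_mul_of_nonneg_left h2 (by positivity)
    _ = _ := by ring

theorem weight_mul_weight_le (hb : 1 < b) {α β : ℝ} (hα : 1 < α) (hβ : 1 < β) {γ₁ γ₂ : ℕ → ℝ}
    (hγ₁ : ∀ j, 0 < γ₁ j ∧ γ₁ j ≤ 1) (hγ₂ : ∀ j, 0 < γ₂ j ∧ γ₂ j ≤ 1) (k l : Freq s t) :
    weight b α β γ₁ γ₂ k * weight b α β γ₁ γ₂ l ≤
      (∏ j ∈ Finset.range t, max 1 ((2 : ℝ) ^ β * γ₂ j)) *
        weight b α β γ₁ γ₂ (freqSub b k l) := by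
  rw [← Fin.prod_univ_eq_prod_range (fun j => max 1 ((2 : ℝ) ^ β * γ₂ j)) t]
  have h1 : (∏ j : Fin s, rho b α (γ₁ j) (k.1 j)) * ∏ j : Fin s, rho b α (γ₁ j) (l.1 j) ≤
      ∏ j : Fin s, rho b α (γ₁ j) (digitSub b (k.1 j) (l.1 j)) := by
    rw [← Finset.prod_mul_distrib]
    exact Finset.prod_le_prod
      (fun j _ => mul_nonneg (rho_pos hb (hγ₁ j).1 _).le (rho_pos hb (hγ₁ j).1 _).le)
      fun j _ => rho_mul_rho_le hb hα (hγ₁ j).1 (hγ₁ j).2 _ _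
  have h2 : (∏ j : Fin t, r β (γ₂ j) (k.2 j)) * ∏ j : Fin t, r β (γ₂ j) (l.2 j) ≤
      (∏ j : Fin t, max 1 ((2 : ℝ) ^ β * γ₂ j)) * ∏ j : Fin t, r β (γ₂ j) (k.2 j - l.2 j) := by
    rw [← Finset.prod_mul_distrib, ← Finset.prod_mul_distrib]
    exact Finset.prod_le_prod
      (fun j _ => mul_nonneg (r_pos (hγ₂ j).1 _).le (r_pos (hγ₂ j).1 _).le)
      fun j _ => r_mul_r_le hβ (hγ₂ j).1 (hγ₂ j).2 _ _
  have h3 := mul_le_mul h1 h2 (mul_nonneg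
    (Finset.prod_nonneg fun j _ => (r_pos (hγ₂ j).1 _).le)
    (Finset.prod_nonneg fun j _ => (r_pos (hγ₂ j).1 _).le))
    (Finset.prod_nonneg fun j _ => (rho_pos hb (hγ₁ j).1 _).le)
  simp only [weight, freqSub, Pi.sub_apply]
  calc _ = _ := by ring
    _ ≤ _ := h3
    _ = _ := by ring

/-! ### The approximation error -/

/-- The part of the energy that stems from the nonzero frequencies. -/
def defect (b : ℕ) (α β : ℝ) (γ₁ γ₂ : ℕ → ℝ) (N : ℕ) (pts : ℕ → Pt s t) : ℝ :=
  ∑' kl : Freq s t, weight b α β γ₁ γ₂ kl * ‖if kl = 0 then 0 else nodeMean b N pts kl‖ ^ 2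

theorem const_eq (b : ℕ) (α β : ℝ) (γ₁ γ₂ : ℕ → ℝ) (s t : ℕ) (κ : ℝ) : const b α β γ₁ γ₂ s t κ =
    2 * cbcProd b α β γ₁ γ₂ s t * (∏ j ∈ Finset.range t, max 1 ((2 : ℝ) ^ β * γ₂ j)) *
      ((∏ j ∈ Finset.range s, (1 + 2 * zeta (min α β * κ) * ((b : ℝ) ^ α * γ₁ j) ^ κ)) *
        ∏ j ∈ Finset.range t, (1 + 2 * zeta (min α β * κ) * (γ₂ j) ^ κ)) := by
  simp only [const, cbcProd]
  ring

variable [Fact b.Prime] {α β : ℝ} {γ₁ γ₂ : ℕ → ℝ}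

theorem summable_defect (hα : 1 < α) (hβ : 1 < β)
    (hγ₁ : ∀ j, 0 < γ₁ j) (hγ₂ : ∀ j, 0 < γ₂ j) (N : ℕ) (pts : ℕ → Pt s t) :
    Summable fun kl : Freq s t => weight b α β γ₁ γ₂ kl *
      ‖if kl = 0 then 0 else nodeMean b N pts kl‖ ^ 2 := by
  have hb := (Fact.out : b.Prime).one_lt
  have hw (kl : Freq s t) := (weight_pos (α := α) (β := β) hb hγ₁ hγ₂ kl).le
  refine Summable.of_nonneg_of_le (fun kl => mul_nonneg (hw kl) (sq_nonneg _)) (fun kl => ?_)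
    (summable_weight (s := s) (t := t) hb hα hβ hγ₁ hγ₂)
  refine mul_le_of_le_one_right (hw kl) (pow_le_one₀ (norm_nonneg _) ?_)
  split_ifs
  · simp
  · exact norm_nodeMean_le_one N pts kl

theorem defect_nonneg (hγ₁ : ∀ j, 0 < γ₁ j) (hγ₂ : ∀ j, 0 < γ₂ j) (N : ℕ) (pts : ℕ → Pt s t) :
    0 ≤ defect b α β γ₁ γ₂ N pts :=
  tsum_nonneg fun kl => mul_nonneg
    (weight_pos (Fact.out : b.Prime).one_lt hγ₁ hγ₂ kl).le (sq_nonneg _)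

theorem defect_le_of_energy_le (hα : 1 < α) (hβ : 1 < β)
    (hγ₁ : ∀ j, 0 < γ₁ j) (hγ₂ : ∀ j, 0 < γ₂ j) {N : ℕ} (hN : N ≠ 0) {pts : ℕ → Pt s t}
    (hpts : ∀ v, pts v ∈ cube s t) {x : ℝ} (hx : 0 ≤ x)
    (h : energy b α β γ₁ γ₂ N pts ≤ ENNReal.ofReal (1 + x)) :
    defect b α β γ₁ γ₂ N pts ≤ x := by
  have hw := summable_weight (s := s) (t := t) (Fact.out : b.Prime).one_lt hα hβ hγ₁ hγ₂
  have h0 := defect_nonneg (α := α) (β := β) (b := b) hγ₁ hγ₂ N pts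
  have h1 : intError b α β γ₁ γ₂ N pts = ENNReal.ofReal √(defect b α β γ₁ γ₂ N pts) :=
    intError_eq hγ₁ hγ₂ hw hN hpts
  rw [← intError_sq_add_one hγ₁ hγ₂ hw hN hpts, h1, ← ENNReal.ofReal_pow (Real.sqrt_nonneg _),
    Real.sq_sqrt h0, ← ENNReal.ofReal_one, ← ENNReal.ofReal_add h0 zero_le_one,
    ENNReal.ofReal_le_ofReal_iff (by linarith)] at h
  linarith

/-- The error in the k-th coefficient is a pairing of f̂ with the node means at l ⊖ k, l ≠ k.
Cauchy–Schwarz produces w(l), and quasi-multiplicativity trades it for w(l ⊖ k)/w(k), after which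
the sum is a reindexed part of the defect. -/
theorem aliasing_error_le (hα : 1 < α) (hβ : 1 < β)
    (hγ₁ : ∀ j, 0 < γ₁ j ∧ γ₁ j ≤ 1) (hγ₂ : ∀ j, 0 < γ₂ j ∧ γ₂ j ≤ 1)
    {N : ℕ} (hN : N ≠ 0) {pts : ℕ → Pt s t} (hpts : ∀ v, pts v ∈ cube s t)
    {f : Pt s t → ℂ} (hf : MemH b α β γ₁ γ₂ f) (hn : normH b α β γ₁ γ₂ f ≤ 1)
    (k : Freq s t) :
    ‖coeff b f k - (1 / (N : ℂ)) * ∑ v ∈ Finset.range N,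
        f (pts v) * (starRingEnd ℂ) (basisFun b k (pts v))‖ ^ 2 ≤
      (∏ j ∈ Finset.range t, max 1 ((2 : ℝ) ^ β * γ₂ j)) * (weight b α β γ₁ γ₂ k)⁻¹ *
        defect b α β γ₁ γ₂ N pts := by
  have hb := (Fact.out : b.Prime).one_lt
  have hw (kl : Freq s t) : 0 < weight b α β γ₁ γ₂ kl :=
    weight_pos hb (fun j => (hγ₁ j).1) (fun j => (hγ₂ j).1) kl
  set C : ℝ := ∏ j ∈ Finset.range t, max 1 ((2 : ℝ) ^ β * γ₂ j) with hC
  set a : Freq s t → ℂ := fun l => if l = 0 then 0 else nodeMean b N pts l with ha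
  have ha1 (l : Freq s t) : ‖a l‖ ≤ 1 := by
    simp only [ha]
    split_ifs
    · simp
    · exact norm_nodeMean_le_one N pts l
  have hsum (a' : Freq s t → ℂ) (h' : ∀ l, ‖a' l‖ ≤ 1) :
      Summable fun l => coeff b f l * a' (freqSub b l k) := by
    refine Summable.of_norm_bounded hf.summable_coeff fun l => ?_
    rw [norm_mul]
    exact mul_le_of_le_one_right (norm_nonneg _) (h' _)
  have h1 : (1 / (N : ℂ)) * ∑ v ∈ Finset.range N,
      f (pts v) * (starRingEnd ℂ) (basisFun b k (pts v)) =
      ∑' l, coeff b f l * nodeMean b N pts (freqSub b l k) := by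
    rw [mean_mul_eq_tsum hf.summable_coeff hf.eq_series hpts]
    simp only [basisFun_mul_conj hb]
    rfl
  have h2 : coeff b f k - ∑' l, coeff b f l * nodeMean b N pts (freqSub b l k) =
      - ∑' l, coeff b f l * a (freqSub b l k) := by
    have hs := (hsum (nodeMean b N pts) (norm_nodeMean_le_one N pts)).tsum_eq_add_tsum_ite k
    rw [hs, (freqSub_eq_zero_iff hb).mpr rfl, nodeMean_zero hN, mul_one, sub_add_cancel_left]
    congr 1
    refine tsum_congr fun l => ?_
    simp only [ha, freqSub_eq_zero_iff hb]
    split_ifs <;> simp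
  have hdef := summable_defect (b := b) hα hβ (fun j => (hγ₁ j).1) (fun j => (hγ₂ j).1) N pts
  have hinj := freqSub_left_injective hb k
  have hterm (l : Freq s t) : weight b α β γ₁ γ₂ l * ‖a (freqSub b l k)‖ ^ 2 ≤
      C * (weight b α β γ₁ γ₂ k)⁻¹ *
        (weight b α β γ₁ γ₂ (freqSub b l k) * ‖a (freqSub b l k)‖ ^ 2) := by
    have := weight_mul_weight_le hb hα hβ hγ₁ hγ₂ l k
    rw [← le_div_iff₀ (hw k)] at this
    calc _ ≤ C * weight b α β γ₁ γ₂ (freqSub b l k) / weight b α β γ₁ γ₂ k *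
          ‖a (freqSub b l k)‖ ^ 2 := mul_le_mul_of_nonneg_right this (sq_nonneg _)
      _ = _ := by rw [div_eq_mul_inv]; ring
  have hC0 : 0 ≤ C * (weight b α β γ₁ γ₂ k)⁻¹ :=
    mul_nonneg (Finset.prod_nonneg fun j _ => zero_le_one.trans (le_max_left _ _))
      (inv_nonneg.mpr (hw k).le)
  have hright : Summable fun l => C * (weight b α β γ₁ γ₂ k)⁻¹ *
      (weight b α β γ₁ γ₂ (freqSub b l k) * ‖a (freqSub b l k)‖ ^ 2) :=
    (hdef.comp_injective hinj).mul_left _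
  have hleft : Summable fun l => weight b α β γ₁ γ₂ l * ‖a (freqSub b l k)‖ ^ 2 :=
    Summable.of_nonneg_of_le (fun l => mul_nonneg (hw l).le (sq_nonneg _)) hterm hright
  rw [h1, h2, norm_neg]
  refine (norm_tsum_mul_sq_le hw hf.summable_norm hleft (hsum a ha1)).trans ?_
  have hn' : ∑' kl : Freq s t, ‖coeff b f kl‖ ^ 2 / weight b α β γ₁ γ₂ kl ≤ 1 := by
    rwa [normH, Real.sqrt_le_one] at hn
  refine (mul_le_of_le_one_left (tsum_nonneg fun l => mul_nonneg (hw l).le (sq_nonneg _))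
    hn').trans ?_
  refine (hleft.tsum_le_tsum hterm hright).trans ?_
  rw [tsum_mul_left]
  refine mul_le_mul_of_nonneg_left ?_ hC0
  -- Injectivity of l ↦ l ⊖ k is enough, all terms being nonnegative.
  exact tsum_comp_le_tsum_of_inj hdef (fun l => mul_nonneg (hw l).le (sq_nonneg _)) hinj

/-- Each member of the index set satisfies 1 ≤ (M w)^κ; the count is then bounded by extending the
sum of (M w)^κ to all frequencies. -/
theorem card_indexSet_le (hα : 1 < α) {κ M : ℝ} (hκ : 0 < κ) (hθκ : 1 < min α β * κ) (hM : 0 < M)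
    (hγ₁ : ∀ j, 0 < γ₁ j) (hγ₂ : ∀ j, 0 < γ₂ j)
    (A : Finset (Freq s t)) (hA : ∀ kl ∈ A, kl ∈ indexSet b α β γ₁ γ₂ s t M) :
    (A.card : ℝ) ≤ M ^ κ *
      ((∏ j ∈ Finset.range s, (1 + 2 * zeta (min α β * κ) * ((b : ℝ) ^ α * γ₁ j) ^ κ)) *
        ∏ j ∈ Finset.range t, (1 + 2 * zeta (min α β * κ) * (γ₂ j) ^ κ)) := by
  have hb := (Fact.out : b.Prime).one_lt
  have hζ := zeta_pos hθκ
  set B : ℝ := (∏ j ∈ Finset.range s, (1 + 2 * zeta (min α β * κ) * ((b : ℝ) ^ α * γ₁ j) ^ κ)) *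
        ∏ j ∈ Finset.range t, (1 + 2 * zeta (min α β * κ) * (γ₂ j) ^ κ) with hB
  have hB0 : 0 ≤ B := by
    refine mul_nonneg (Finset.prod_nonneg fun j _ => ?_) (Finset.prod_nonneg fun j _ => ?_)
    · have := hγ₁ j; positivity
    · have := hγ₂ j; positivity
  rw [← ENNReal.ofReal_le_ofReal_iff (by positivity), ENNReal.ofReal_natCast,
    ENNReal.ofReal_mul (by positivity)]
  calc (A.card : ℝ≥0∞) = ∑ kl ∈ A, 1 := by simp
    _ ≤ ∑ kl ∈ A, ENNReal.ofReal (M ^ κ) * ENNReal.ofReal (weight b α β γ₁ γ₂ kl) ^ κ := by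
        refine Finset.sum_le_sum fun kl hkl => ?_
        have hw : 0 < weight b α β γ₁ γ₂ kl := weight_pos hb hγ₁ hγ₂ kl
        have h1 : (weight b α β γ₁ γ₂ kl)⁻¹ ≤ M := hA kl hkl
        rw [inv_le_iff_one_le_mul₀ hw] at h1
        rw [ENNReal.ofReal_rpow_of_nonneg hw.le hκ.le, ← ENNReal.ofReal_mul (by positivity),
          ← Real.mul_rpow hM.le hw.le]
        exact ENNReal.one_le_ofReal.mpr (Real.one_le_rpow h1 hκ.le)
    _ ≤ ENNReal.ofReal (M ^ κ) *
        ∑' kl : Freq s t, ENNReal.ofReal (weight b α β γ₁ γ₂ kl) ^ κ := by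
        rw [← Finset.mul_sum]
        gcongr
        exact ENNReal.sum_le_tsum A
    _ ≤ _ := mul_le_mul_right (tsum_weight_rpow_le hb hα hκ hθκ hγ₁ hγ₂) _

theorem eLpNorm_sub_algorithm_le (hα : 1 < α) (hβ : 1 < β)
    (hγ₁ : ∀ j, 0 < γ₁ j ∧ γ₁ j ≤ 1) (hγ₂ : ∀ j, 0 < γ₂ j ∧ γ₂ j ≤ 1)
    {N : ℕ} (hN : N ≠ 0) {pts : ℕ → Pt s t} (hpts : ∀ v, pts v ∈ cube s t) {M : ℝ} (hM : 0 < M)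
    {f : Pt s t → ℂ} (hf : MemH b α β γ₁ γ₂ f) (hn : normH b α β γ₁ γ₂ f ≤ 1) :
    MeasureTheory.eLpNorm (fun p => f p - algorithm b α β γ₁ γ₂ N M pts f p) 2
      (cubeMeasure s t) ≤ ENNReal.ofReal √(M⁻¹ +
        ((indexSet_finite (Fact.out : b.Prime).one_lt hα hβ hγ₁ hγ₂ s t M).toFinset.card : ℝ) *
          ((∏ j ∈ Finset.range t, max 1 ((2 : ℝ) ^ β * γ₂ j)) * M *
            defect b α β γ₁ γ₂ N pts)) := by
  classical
  have hb := (Fact.out : b.Prime).one_lt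
  have hw (kl : Freq s t) : 0 < weight b α β γ₁ γ₂ kl :=
    weight_pos hb (fun j => (hγ₁ j).1) (fun j => (hγ₂ j).1) kl
  have hfin := indexSet_finite hb hα hβ hγ₁ hγ₂ s t M
  set A := hfin.toFinset with hA
  set C : ℝ := ∏ j ∈ Finset.range t, max 1 ((2 : ℝ) ^ β * γ₂ j) with hC
  have hC0 : 0 ≤ C := Finset.prod_nonneg fun j _ => zero_le_one.trans (le_max_left _ _)
  have hG0 := defect_nonneg (b := b) (α := α) (β := β) (fun j => (hγ₁ j).1) (fun j => (hγ₂ j).1)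
    N pts
  set G := defect b α β γ₁ γ₂ N pts with hG
  set a : Freq s t → ℂ := fun kl => (1 / (N : ℂ)) * ∑ v ∈ Finset.range N,
    f (pts v) * (starRingEnd ℂ) (basisFun b kl (pts v)) with ha
  set e : Freq s t → ℂ := fun kl => if kl ∈ A then a kl else 0 with he
  have hesum : Summable fun kl => ‖e kl‖ :=
    summable_of_ne_finset_zero (s := A) fun kl hkl => by simp [he, hkl]
  have hdsum : Summable fun kl => ‖coeff b f kl - e kl‖ :=
    Summable.of_nonneg_of_le (fun _ => norm_nonneg _) (fun kl => norm_sub_le _ _)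
      (hf.summable_coeff.add hesum)
  have hser : ∀ p ∈ cube s t, f p - algorithm b α β γ₁ γ₂ N M pts f p =
      ∑' kl, (coeff b f kl - e kl) * basisFun b kl p := by
    intro p hp
    have halg : algorithm b α β γ₁ γ₂ N M pts f p = ∑' kl, e kl * basisFun b kl p := by
      rw [algorithm, finsum_mem_eq_finite_toFinset_sum _ hfin,
        tsum_eq_sum (s := A) fun kl hkl => by simp [he, hkl]]
      exact Finset.sum_congr rfl fun kl hkl => by simp only [he, if_pos hkl, ha]
    rw [hf.eq_series p hp, halg, ← (summable_mul_basisFun hf.summable_coeff p).tsum_sub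
      (summable_mul_basisFun hesum p)]
    exact tsum_congr fun kl => (sub_mul _ _ _).symm
  rw [eLpNorm_series hdsum hser]
  refine ENNReal.ofReal_le_ofReal (Real.sqrt_le_sqrt ?_)
  -- Inside the index set the aliasing bound is used with w⁻¹ ≤ M; outside it the algorithm
  -- contributes nothing and 1 ≤ M⁻¹/w.
  have hbd (kl : Freq s t) : ‖coeff b f kl - e kl‖ ^ 2 ≤
      M⁻¹ * (‖coeff b f kl‖ ^ 2 / weight b α β γ₁ γ₂ kl) + if kl ∈ A then C * M * G else 0 := by
    have h0 : 0 ≤ M⁻¹ * (‖coeff b f kl‖ ^ 2 / weight b α β γ₁ γ₂ kl) :=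
      mul_nonneg (by positivity) (div_nonneg (sq_nonneg _) (hw kl).le)
    by_cases hkl : kl ∈ A
    · have hkl' : (weight b α β γ₁ γ₂ kl)⁻¹ ≤ M := hfin.mem_toFinset.mp hkl
      have := aliasing_error_le hα hβ hγ₁ hγ₂ hN hpts hf hn kl
      simp only [he, if_pos hkl]
      refine le_add_of_nonneg_of_le h0 (this.trans ?_)
      exact mul_le_mul_of_nonneg_right (mul_le_mul_of_nonneg_left hkl' hC0) hG0
    · have hkl' : ¬ (weight b α β γ₁ γ₂ kl)⁻¹ ≤ M := fun h => hkl (hfin.mem_toFinset.mpr h)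
      simp only [he, if_neg hkl, sub_zero, add_zero]
      rw [inv_mul_eq_div, div_div, le_div_iff₀ (mul_pos (hw kl) hM)]
      refine mul_le_of_le_one_right (sq_nonneg _) ?_
      rw [not_le, lt_inv_comm₀ hM (hw kl)] at hkl'
      calc weight b α β γ₁ γ₂ kl * M ≤ M⁻¹ * M := mul_le_mul_of_nonneg_right hkl'.le hM.le
        _ = 1 := inv_mul_cancel₀ hM.ne'
  have hs1 : Summable fun kl => M⁻¹ * (‖coeff b f kl‖ ^ 2 / weight b α β γ₁ γ₂ kl) :=
    hf.summable_norm.mul_left _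
  have hs2 : Summable fun kl : Freq s t => if kl ∈ A then C * M * G else 0 :=
    summable_of_ne_finset_zero (s := A) fun kl hkl => by simp [hkl]
  refine ((Summable.of_nonneg_of_le (fun _ => sq_nonneg _) hbd (hs1.add hs2)).tsum_le_tsum hbd
    (hs1.add hs2)).trans ?_
  rw [hs1.tsum_add hs2, tsum_mul_left]
  refine add_le_add ?_ (le_of_eq ?_)
  · refine mul_le_of_le_one_right (by positivity) ?_
    rwa [normH, Real.sqrt_le_one] at hn
  · rw [tsum_eq_sum (s := A) fun kl hkl => by simp [hkl], Finset.sum_congr rfl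
      fun kl hkl => if_pos hkl, Finset.sum_const, nsmul_eq_mul]

/-- The choice of M gives M^(2+κ) = N/c, so both terms equal 1/M; this yields the factor √2 and
halves the exponent. -/
theorem sqrt_balanced_eq {c N κ : ℝ} (hc : 0 < c) (hN : 0 < N) (hκ : 0 < κ) :
    √(((N / c) ^ (1 / (2 + κ)))⁻¹ + ((N / c) ^ (1 / (2 + κ))) ^ (1 + κ) * (c / N)) =
      √2 * (c / N) ^ (1 / (4 + 2 * κ)) := by
  set M := (N / c) ^ (1 / (2 + κ)) with hM
  have hM0 : 0 < M := by positivity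
  have h1 : M ^ (2 + κ) = N / c := by
    rw [hM, ← Real.rpow_mul (by positivity), one_div_mul_cancel (by positivity), Real.rpow_one]
  have h2 : M ^ (1 + κ) * (c / N) = M⁻¹ := by
    have h3 : c / N = (M ^ (2 + κ))⁻¹ := by rw [h1, inv_div]
    rw [h3, ← Real.rpow_neg hM0.le, ← Real.rpow_add hM0, ← Real.rpow_neg_one]
    congr 1; ring
  have h4 : M⁻¹ = (c / N) ^ (1 / (2 + κ)) := by
    rw [hM, ← Real.inv_rpow (by positivity), inv_div]
  rw [h2, h4, ← two_mul, Real.sqrt_mul zero_le_two, Real.sqrt_eq_rpow ((c / N) ^ _),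
    ← Real.rpow_mul (by positivity)]
  congr 2
  field_simp
  ring

end

end HybridSpace

end

/-! ### Assembly of the error bound -/

theorem proposition1 (b : ℕ) [Fact b.Prime] (m s t : ℕ) (hm : 1 ≤ m) (hs : 1 ≤ s) (ht : 1 ≤ t)
    (α β : ℝ) (hα : 1 < α) (hβ : 1 < β)
    (γ₁ γ₂ : ℕ → ℝ) (hγ₁ : Antitone γ₁) (hγ₂ : Antitone γ₂)
    (hγ₁' : ∀ j, 0 < γ₁ j ∧ γ₁ j ≤ 1) (hγ₂' : ∀ j, 0 < γ₂ j ∧ γ₂ j ≤ 1)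
    (κ : ℝ) (hκ : 1 / min α β < κ)
    (f : Polynomial (ZMod b)) (hf : Irreducible f) (hfdeg : f.natDegree = m)
    (g : ℕ → Polynomial (ZMod b)) (z : ℕ → ℕ)
    (hgz : HybridSpace.IsCBC b m α β γ₁ γ₂ f g z s t) :
    HybridSpace.appError b α β γ₁ γ₂
        (HybridSpace.algorithm b α β γ₁ γ₂ (b ^ m)
          ((((b ^ m : ℕ) : ℝ) / HybridSpace.const b α β γ₁ γ₂ s t κ) ^ (1 / (2 + κ)))
          (HybridSpace.hybridPt b m f g z s t)) ≤
      ENNReal.ofReal (Real.sqrt 2 *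
        (HybridSpace.const b α β γ₁ γ₂ s t κ / ((b ^ m : ℕ) : ℝ)) ^ (1 / (4 + 2 * κ))) := by
  open HybridSpace in
  have hb := (Fact.out : b.Prime).one_lt
  have hθ : 0 < min α β := lt_min (by linarith) (by linarith)
  have hκ0 : 0 < κ := (one_div_pos.mpr hθ).trans hκ
  have hθκ : 1 < min α β * κ := by rwa [div_lt_iff₀' hθ] at hκ
  have hγ₁p (j : ℕ) := (hγ₁' j).1
  have hγ₂p (j : ℕ) := (hγ₂' j).1
  have hN : b ^ m ≠ 0 := by positivity
  have hN0 : (0 : ℝ) < ((b ^ m : ℕ) : ℝ) := by exact_mod_cast Nat.pos_of_ne_zero hN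
  have hζ := zeta_pos hθκ
  have hQ := one_le_cbcProd (b := b) hα hβ hγ₁p hγ₂p s t
  set Q := cbcProd b α β γ₁ γ₂ s t with hQdef
  set C : ℝ := ∏ j ∈ Finset.range t, max 1 ((2 : ℝ) ^ β * γ₂ j) with hC
  have hC0 : 0 < C := Finset.prod_pos fun j _ => zero_lt_one.trans_le (le_max_left _ _)
  set B : ℝ := (∏ j ∈ Finset.range s, (1 + 2 * zeta (min α β * κ) * ((b : ℝ) ^ α * γ₁ j) ^ κ)) *
    ∏ j ∈ Finset.range t, (1 + 2 * zeta (min α β * κ) * (γ₂ j) ^ κ) with hB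
  have hB0 : 0 < B := by
    refine mul_pos (Finset.prod_pos fun j _ => ?_) (Finset.prod_pos fun j _ => ?_)
    · have := hγ₁p j; positivity
    · have := hγ₂p j; positivity
  have hconst : const b α β γ₁ γ₂ s t κ = 2 * Q * C * B := const_eq b α β γ₁ γ₂ s t κ
  have hc0 : 0 < const b α β γ₁ γ₂ s t κ := by rw [hconst]; positivity
  set N : ℝ := ((b ^ m : ℕ) : ℝ) with hNdef
  rw [← sqrt_balanced_eq hc0 hN0 hκ0]
  set M : ℝ := (N / const b α β γ₁ γ₂ s t κ) ^ (1 / (2 + κ)) with hM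
  have hM0 : 0 < M := by positivity
  have hpts := hybridPt_mem_cube (b := b) (m := m) f g z s t
  have hG := defect_le_of_energy_le hα hβ hγ₁p hγ₂p hN hpts (x := 2 / N * Q) (by positivity)
    (energy_le_of_isCBC hm hα hβ hγ₁p hγ₂p hf hfdeg hgz)
  have hcard := card_indexSet_le hα hκ0 hθκ hM0 hγ₁p hγ₂p
    (indexSet_finite hb hα hβ hγ₁' hγ₂' s t M).toFinset
    fun kl hkl => (Set.Finite.mem_toFinset _).mp hkl
  refine iSup_le fun h => iSup_le fun hh => iSup_le fun hn => ?_
  refine (eLpNorm_sub_algorithm_le hα hβ hγ₁' hγ₂' hN hpts hM0 hh hn).trans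
    (ENNReal.ofReal_le_ofReal (Real.sqrt_le_sqrt (add_le_add le_rfl ?_)))
  have hG0 := defect_nonneg (b := b) (α := α) (β := β) hγ₁p hγ₂p (b ^ m)
    (hybridPt b m f g z s t)
  -- Number of retained frequencies times the aliasing bound per frequency; the factors 2, Q, C and
  -- B combine into the constant c.
  calc _ ≤ M ^ κ * B * (C * M * (2 / N * Q)) :=
        mul_le_mul hcard (mul_le_mul_of_nonneg_left hG (by positivity)) (by positivity)
          (by positivity)
    _ = M ^ (1 + κ) * (const b α β γ₁ γ₂ s t κ / N) := by
        rw [hconst, Real.rpow_add hM0, Real.rpow_one]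
        ring
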